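/- Let $p_0,p_1,p_2,p_3$ be four distinct points of $\mathbb C\subset\hat{\mathbb C}=\mathbb C\cup\{\infty\}$, and let $\gamma_1,\gamma_2,\gamma_3$ (the slits) be embedded regular $C^1$ arcs in $\mathbb C$, where $\gamma_j$ runs from $p_0$ to $p_j$ and any two of the arcs meet only in $p_0$. Let $\Sigma$ be the sphere $\hat{\mathbb C}$ slit along $\gamma_1,\gamma_2,\gamma_3$, so that every slit has a left and a right hand side as seen from $p_0$. Take twelve copies $\Sigma_i$ ($i\in\mathbb Z/12$) of $\Sigma$, put $d_1=1$, $d_2=4$, $d_3=7$, and identify, for each $i$ and $j$, the left hand side of the slit $\gamma_j$ in $\Sigma_i$ with the right hand side of the same slit in $\Sigma_{i+d_j}$ (end points of the slits omitted). This gives a surface with a projection to $\hat{\mathbb C}\setminus\{p_0,p_1,p_2,p_3\}$. Let $S_{147}$ be the surface obtained by filling in the missing points: over each $p\in\{p_0,p_1,p_2,p_3\}$ one point is added for every connected component of the preimage of a small punctured disc around $p$. Let $x:S_{147}\to\hat{\mathbb C}$ be the resulting projection. Theorem. $S_{147}$, with a complex structure for which $x$ is holomorphic, is a compact connected Riemann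 surface of genus $4$ (that is, of Euler characteristic $-6$). It is the compact Riemann surface given by the equation $$y^{12}=(x-p_1)(x-p_2)^4(x-p_3)^7,$$ that is: there is a meromorphic function $y$ on $S_{147}$ such that $x$ and $y$ satisfy this equation wherever both are finite, $x$ and $y$ have only finitely many poles, every point $(a,b)\in\mathbb C^2$ with $b^{12}=(a-p_1)(a-p_2)^4(a-p_3)^7$ is of the form $(x(s),y(s))$ for some $s\in S_{147}$, and the map $(x,y)$ is injective outside a finite subset of $S_{147}$. -/

import Mathlib

open Set Filter Topology
open scoped Manifold ContDiff

noncomputable section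

/-! ### The slit sphere -/

/-- A system of slits in the Riemann sphere `ℂ ∪ {∞}` joining `p₀` to `p 0, p 1, p 2`: three embedded
regular arcs of class `C¹`, parametrized by `[0, 1]`, which start at `p₀`, end at `p j`, and have
pairwise only the point `p₀` in common. (In particular `p₀, p 0, p 1, p 2` are distinct.) -/
structure SlitSystem (p₀ : ℂ) (p : Fin 3 → ℂ) where
  arc : Fin 3 → ℝ → ℂ
  arc_zero : ∀ j, arc j 0 = p₀
  arc_one : ∀ j, arc j 1 = p j
  contDiffOn : ∀ j, ContDiffOn ℝ 1 (arc j) (Icc 0 1)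
  regular : ∀ j, ∀ t ∈ Icc (0 : ℝ) 1, derivWithin (arc j) (Icc 0 1) t ≠ 0
  injOn : ∀ j, InjOn (arc j) (Icc 0 1)
  disjoint : ∀ j k, j ≠ k → ∀ s ∈ Icc (0 : ℝ) 1, ∀ t ∈ Icc (0 : ℝ) 1, arc j s = arc k t → s = 0

namespace SlitSystem

variable {p₀ : ℂ} {p : Fin 3 → ℂ} (Γ : SlitSystem p₀ p)

/-- The union of the three (closed) slits, as a subset of the Riemann sphere. -/
def slits : Set (OnePoint ℂ) :=
  {z | ∃ j, ∃ t ∈ Icc (0 : ℝ) 1, z = (Γ.arc j t : OnePoint ℂ)}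

/-- The tangent vector of the `j`-th slit, pointing away from `p₀`. -/
def tangent (j : Fin 3) (t : ℝ) : ℂ := derivWithin (Γ.arc j) (Icc 0 1) t

/-- The one-sided neighbourhoods, on the left hand side as seen from `p₀`, of the point with
parameter `t` of the `j`-th slit; multiplication by `I` turns the tangent vector to the left. -/
def leftSide (j : Fin 3) (t : ℝ) : Filter ℂ :=
  map (fun q : ℝ × ℝ => Γ.arc j q.1 + q.2 * (Complex.I * Γ.tangent j t)) (𝓝 t ×ˢ 𝓝[>] 0)

/-- The one-sided neighbourhoods, on the right hand side as seen from `p₀`, of the point with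
parameter `t` of the `j`-th slit. -/
def rightSide (j : Fin 3) (t : ℝ) : Filter ℂ :=
  map (fun q : ℝ × ℝ => Γ.arc j q.1 + q.2 * (Complex.I * Γ.tangent j t)) (𝓝 t ×ˢ 𝓝[<] 0)

/-- The slit sphere with the two sides of its slits: the complement of the slits in the Riemann
sphere, together with two banks of every (open) slit. The four end points of the slits are left
out; they are the punctures that are filled in later. -/
inductive SlitSphere : Type
  | inner (z : OnePoint ℂ) (hz : z ∉ Γ.slits) : SlitSphere
  | left (j : Fin 3) (t : Ioo (0 : ℝ) 1) : SlitSphere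
  | right (j : Fin 3) (t : Ioo (0 : ℝ) 1) : SlitSphere

/-- A set is open in the slit sphere if its part off the slits is open, and if with a point of a left
(right) bank it contains the nearby points of that bank and the nearby points of the sphere on the
left (right) of the slit. -/
instance : TopologicalSpace Γ.SlitSphere where
  IsOpen U :=
    (∀ z hz, SlitSphere.inner z hz ∈ U → ∀ᶠ w in 𝓝 z, ∀ hw, SlitSphere.inner w hw ∈ U) ∧
    (∀ j t, SlitSphere.left j t ∈ U → (∀ᶠ s in 𝓝 t, SlitSphere.left j s ∈ U) ∧
      ∀ᶠ w : ℂ in Γ.leftSide j t, ∀ hw, SlitSphere.inner (w : OnePoint ℂ) hw ∈ U) ∧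
    (∀ j t, SlitSphere.right j t ∈ U → (∀ᶠ s in 𝓝 t, SlitSphere.right j s ∈ U) ∧
      ∀ᶠ w : ℂ in Γ.rightSide j t, ∀ hw, SlitSphere.inner (w : OnePoint ℂ) hw ∈ U)
  isOpen_univ := by simp
  isOpen_inter := by
    rintro U V ⟨hU, hUl, hUr⟩ ⟨hV, hVl, hVr⟩
    refine ⟨fun z hz h => ?_, fun j t h => ⟨?_, ?_⟩, fun j t h => ⟨?_, ?_⟩⟩
    · filter_upwards [hU z hz h.1, hV z hz h.2] with w h1 h2 hw using ⟨h1 hw, h2 hw⟩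
    · filter_upwards [(hUl j t h.1).1, (hVl j t h.2).1] with w h1 h2 using ⟨h1, h2⟩
    · filter_upwards [(hUl j t h.1).2, (hVl j t h.2).2] with w h1 h2 hw using ⟨h1 hw, h2 hw⟩
    · filter_upwards [(hUr j t h.1).1, (hVr j t h.2).1] with w h1 h2 using ⟨h1, h2⟩
    · filter_upwards [(hUr j t h.1).2, (hVr j t h.2).2] with w h1 h2 hw using ⟨h1 hw, h2 hw⟩
  isOpen_sUnion := by
    intro S hS
    refine ⟨?_, ?_, ?_⟩
    · rintro z hz ⟨U, hUS, h⟩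
      filter_upwards [(hS U hUS).1 z hz h] with w h1 hw using ⟨U, hUS, h1 hw⟩
    · rintro j t ⟨U, hUS, h⟩
      have H := (hS U hUS).2.1 j t h
      refine ⟨?_, ?_⟩
      · filter_upwards [H.1] with w h1 using ⟨U, hUS, h1⟩
      · filter_upwards [H.2] with w h1 hw using ⟨U, hUS, h1 hw⟩
    · rintro j t ⟨U, hUS, h⟩
      have H := (hS U hUS).2.2 j t h
      refine ⟨?_, ?_⟩
      · filter_upwards [H.1] with w h1 using ⟨U, hUS, h1⟩
      · filter_upwards [H.2] with w h1 hw using ⟨U, hUS, h1 hw⟩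

/-- The point of the Riemann sphere underlying a point of the slit sphere. -/
def SlitSphere.toSphere : Γ.SlitSphere → OnePoint ℂ
  | .inner z _ => z
  | .left j t => (Γ.arc j t : OnePoint ℂ)
  | .right j t => (Γ.arc j t : OnePoint ℂ)

/-! ### Gluing `n` copies of the slit sphere -/

/-- The identifications: the left hand side of the `j`-th slit in the `i`-th copy is identified with
the right hand side of the same slit in the copy number `i + d j` modulo `n`. -/
inductive Glue (n : ℕ) (d : Fin 3 → ℕ) :
    (Σ _ : ZMod n, Γ.SlitSphere) → (Σ _ : ZMod n, Γ.SlitSphere) → Prop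
  | cross (i : ZMod n) (j : Fin 3) (t : Ioo (0 : ℝ) 1) :
      Glue n d ⟨i, .left j t⟩ ⟨i + (d j : ZMod n), .right j t⟩

/-- The surface obtained from the disjoint union of `n` copies of the slit sphere by crosswise
identification of the slits with shifts `d j`, with the quotient topology; here the points over
`p₀, p 0, p 1, p 2` are still missing. -/
def GluedSurface (n : ℕ) (d : Fin 3 → ℕ) : Type := Quot (Γ.Glue n d)

instance (n : ℕ) (d : Fin 3 → ℕ) : TopologicalSpace (Γ.GluedSurface n d) :=
  inferInstanceAs (TopologicalSpace (Quot (Γ.Glue n d)))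

/-- The projection of the glued surface to the Riemann sphere. -/
def GluedSurface.toSphere (n : ℕ) (d : Fin 3 → ℕ) : Γ.GluedSurface n d → OnePoint ℂ :=
  Quot.lift (fun a => SlitSphere.toSphere Γ a.2) (by rintro _ _ ⟨i, j, t⟩; rfl)

end SlitSystem

/-! ### Filling in the punctures of a branched cover -/

/-- The completion of a map `f : E → X` (in the sense of R. H. Fox), which fills in the missing points
of a branched cover: a point over `x` is a compatible choice, for all open neighbourhoods `U` of `x`,
of a connected component of `f ⁻¹' U`. When `f` is a finite unramified cover of a surface minus a
point `x`, this adds one point over `x` for each connected component of the preimage of a small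
punctured disc around `x`. -/
structure BranchedCompletion {E X : Type*} [TopologicalSpace E] [TopologicalSpace X]
    (f : E → X) where
  pt : X
  germ : ∀ U : TopologicalSpace.Opens X, pt ∈ U → Set E
  isComponent : ∀ (U : TopologicalSpace.Opens X) hU, ∃ e ∈ f ⁻¹' (U : Set X),
    germ U hU = connectedComponentIn (f ⁻¹' (U : Set X)) e
  mono : ∀ (U V : TopologicalSpace.Opens X) hU hV, U ≤ V → germ U hU ⊆ germ V hV

/-- The basic open sets consist of all points over an open set `U` which single out the same
component of `f ⁻¹' U`. -/
instance {E X : Type*} [TopologicalSpace E] [TopologicalSpace X] (f : E → X) :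
    TopologicalSpace (BranchedCompletion f) :=
  TopologicalSpace.generateFrom
    {W | ∃ (U : TopologicalSpace.Opens X) (C : Set E),
      W = {a | ∃ h : a.pt ∈ U, a.germ U h = C}}

/-- The surface `S₁₄₇`: the completed 12-fold cover with slit shifts `1, 4, 7`. -/
abbrev S147 {p₀ : ℂ} {p : Fin 3 → ℂ} (Γ : SlitSystem p₀ p) : Type :=
  BranchedCompletion (SlitSystem.GluedSurface.toSphere Γ 12 ![1, 4, 7])

/-- The projection of `S₁₄₇` to the Riemann sphere. -/
def S147.x {p₀ : ℂ} {p : Fin 3 → ℂ} (Γ : SlitSystem p₀ p) (s : S147 Γ) : OnePoint ℂ := s.pt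

/-! ### Meromorphic functions, algebraic equations, genus -/

/-- The affine coordinate `z` of the Riemann sphere (with junk value `0` at `∞`). -/
def sphereCoord : OnePoint ℂ → ℂ
  | some z => z
  | none => 0

/-- The coordinate `1 / z` of the Riemann sphere at `∞`, where it is `0` (junk value at `0`). -/
def sphereCoordInfty : OnePoint ℂ → ℂ
  | some z => z⁻¹
  | none => 0

/-- A holomorphic map from a Riemann surface to the Riemann sphere, i.e. (if it is not constantly `∞`
on a component) a meromorphic function. -/
def IsHolomorphicToSphere {S : Type*} [TopologicalSpace S] [ChartedSpace ℂ S]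
    (F : S → OnePoint ℂ) : Prop :=
  Continuous F ∧
  (∀ s, F s ≠ OnePoint.infty → MDifferentiableAt 𝓘(ℂ) 𝓘(ℂ) (fun t => sphereCoord (F t)) s) ∧
  (∀ s, F s ≠ ((0 : ℂ) : OnePoint ℂ) →
    MDifferentiableAt 𝓘(ℂ) 𝓘(ℂ) (fun t => sphereCoordInfty (F t)) s)

/-- The compact Riemann surface `S` is given by the equation of the affine plane curve `C`, through
the meromorphic functions `x` and `y`: these satisfy the equation, every point of the curve is
attained, and off finitely many points of `S` the map `(x, y)` is finite and injective. In other
words, `(x, y)` exhibits `S` as the normalization of the projective closure of `C`. -/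
structure IsRiemannSurfaceOfCurve {S : Type*} [TopologicalSpace S] [ChartedSpace ℂ S]
    (C : Set (ℂ × ℂ)) (x y : S → OnePoint ℂ) : Prop where
  holomorphic_x : IsHolomorphicToSphere x
  holomorphic_y : IsHolomorphicToSphere y
  finite_poles : {s | x s = OnePoint.infty ∨ y s = OnePoint.infty}.Finite
  equation : ∀ s (a b : ℂ), x s = (a : OnePoint ℂ) → y s = (b : OnePoint ℂ) → (a, b) ∈ C
  surjective : ∀ a b : ℂ, (a, b) ∈ C → ∃ s, x s = (a : OnePoint ℂ) ∧ y s = (b : OnePoint ℂ)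
  finite_multiple : {s | ∃ s', s' ≠ s ∧ x s' = x s ∧ y s' = y s}.Finite

/-- The space `X` has Euler characteristic `χ`: it has a decomposition as a finite CW complex whose
numbers of cells have alternating sum `χ` (vertices minus edges plus faces, for a surface). -/
def HasEulerCharacteristic (X : Type*) [TopologicalSpace X] (χ : ℤ) : Prop :=
  ∃ _ : CWComplex (univ : Set X), CWComplex.Finite (univ : Set X) ∧
    ∑ᶠ n : ℕ, (-1 : ℤ) ^ n * (Nat.card (RelCWComplex.cell (univ : Set X) n) : ℤ) = χ

/-- The genus `g` of a compact connected orientable surface: its Euler characteristic is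
`2 - 2 g`. -/
def HasGenus (S : Type*) [TopologicalSpace S] (g : ℕ) : Prop :=
  HasEulerCharacteristic S (2 - 2 * (g : ℤ))

end

/-!
The surface `S₁₄₇` is identified with an explicit model of the curve, and everything is read off
from the model.

The model. The function field of the curve `y ^ 12 = (x - p 0) (x - p 1) ^ 4 (x - p 2) ^ 7` is
generated by two functions `q` and `r` with `q ^ 3 = r ^ 5 - r`: here `u = r ^ 4` is the Möbius
transform of `x` with values `0`, `1`, `∞` at `p 0`, `p 1`, `p 2`, and `y` is a constant multiple of
`q / (u - λ)`, where `λ` is the value of `u` at `x = ∞`. The curve `q ^ 3 = r ^ 5 - r` is smooth and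
has a single point at infinity. Its one-point compactification `TrigonalModel` is a compact Riemann
surface: `q` or `r` is a local coordinate at each affine point, and the involution
`(q, r) ↦ (-q / r ^ 2, 1 / r)` exchanges the origin and the point at infinity. Maps to the sphere
which are locally quotients of holomorphic functions of such coordinates are holomorphic
(`exists_chartedSpace_isHolomorphicToSphere`), and the claims about the equation become computations
with `q` and `r`.

The gluing. A compact space over the sphere which contains the glued surface, and in which the added
points do not disconnect small neighbourhoods, is its completion
(`BranchedCompletion.IsModel.exists_homeomorph`). So it suffices to identify the glued surface with
the part of the model which is not over the end points of the slits. Off the slits, `q` and `r` are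
constant multiples of exponentials of linear combinations of logarithms `ℓ k` of
`(x - p k) / (x - p₀)`, and the multiples by twelfth roots of unity are the sheets (`sheet`). Such
logarithms are the Cauchy integrals `∫ dζ / (ζ - x)` over the slits, which jump by `2 π i` from the
right to the left of a slit (`exists_cauchyIntegral_eq`; the `C¹` regularity is needed here and for
tubular coordinates along the slits). Therefore crossing the `j`-th slit leads from one sheet to the
one prescribed by the gluing (`sheet_add`). The resulting homeomorphism is
`SlitSystem.exists_homeomorph_model`.

The genus. The function `u = r ^ 4` is invariant under a group of order `12` which is simply
transitive on all fibres except those over `0`, `1`, `∞`. The complement of `[0, ∞]` and the open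
intervals `(0, 1)` and `(1, ∞)` lift to `12` faces and `24` edges; over `0`, `1`, `∞` there are
`1 + 4 + 1` vertices. Hence the Euler characteristic is `6 - 24 + 12 = -6`
(`TrigonalModel.hasEulerCharacteristic_of_homeomorph`). The closed faces contain the origin and the
point at infinity, so that the model is connected.
-/

open Set Filter Topology
open scoped Manifold ContDiff
noncomputable section

/-! ### The completion of a branched cover with a known compact model -/

namespace BranchedCompletion

variable {E X M : Type*} [TopologicalSpace E] [TopologicalSpace X] [TopologicalSpace M]
  {f : E → X} {π : M → X} {i : E → M}

/-- `i` embeds `E` in a space `M` over `X`, in such a way that the complement of `E` does not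
disconnect small neighbourhoods of the points of `M`. A compact such
`M` is the completion of `f`. -/
structure IsModel (f : E → X) (π : M → X) (i : E → M) : Prop where
  isEmbedding : IsEmbedding i
  comp_eq : ∀ e, π (i e) = f e
  continuous : Continuous π
  finite_fiber : ∀ x, (π ⁻¹' {x}).Finite
  exists_isConnected : ∀ m, ∀ W ∈ 𝓝 m, ∃ W' ⊆ W, IsOpen W' ∧ m ∈ W' ∧ IsConnected (i ⁻¹' W')

/-- `W` is an open neighbourhood of `m` over `U` whose trace on `E` is connected. -/
def IsSmallNhd (π : M → X) (i : E → M) (m : M) (U : Set X) (W : Set M) : Prop :=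
  IsOpen W ∧ m ∈ W ∧ W ⊆ π ⁻¹' U ∧ IsConnected (i ⁻¹' W)

/-- The component of `f ⁻¹' U` to which `m` is adherent. -/
def modelGerm (f : E → X) (π : M → X) (i : E → M) (m : M) (U : Set X) : Set E :=
  {e | ∃ W, IsSmallNhd π i m U W ∧ ∃ e' ∈ i ⁻¹' W, e ∈ connectedComponentIn (f ⁻¹' U) e'}

@[ext]
theorem ext' {a b : BranchedCompletion f} (h : a.pt = b.pt)
    (hg : ∀ U ha hb, a.germ U ha = b.germ U hb) : a = b := by
  obtain ⟨x, g, _, _⟩ := a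
  obtain ⟨x', g', _, _⟩ := b
  obtain rfl : x = x' := h
  obtain rfl : g = g' := by
    funext U hU
    exact hg U hU hU
  rfl

namespace IsModel

theorem exists_isSmallNhd (H : IsModel f π i) {m : M} {U : Set X} (hU : IsOpen U) (hm : π m ∈ U)
    {N : Set M} (hN : N ∈ 𝓝 m) : ∃ W ⊆ N, IsSmallNhd π i m U W := by
  obtain ⟨W, hW, hWo, hmW, hc⟩ := H.exists_isConnected m (N ∩ π ⁻¹' U)
    (inter_mem hN ((hU.preimage H.continuous).mem_nhds hm))
  exact ⟨W, hW.trans inter_subset_left, hWo, hmW, hW.trans inter_subset_right, hc⟩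

theorem preimage_subset (H : IsModel f π i) {m : M} {U : Set X} {W : Set M}
    (hW : IsSmallNhd π i m U W) : i ⁻¹' W ⊆ f ⁻¹' U := by
  intro e he
  have := hW.2.2.1 he
  rwa [mem_preimage, H.comp_eq] at this

theorem preimage_subset_component (H : IsModel f π i) {m : M} {U : Set X} {W : Set M}
    (hW : IsSmallNhd π i m U W) {e : E} (he : e ∈ i ⁻¹' W) :
    i ⁻¹' W ⊆ connectedComponentIn (f ⁻¹' U) e :=
  hW.2.2.2.isPreconnected.subset_connectedComponentIn he (H.preimage_subset hW)

theorem modelGerm_eq (H : IsModel f π i) {m : M} {U : Set X} (hU : IsOpen U) {W : Set M}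
    (hW : IsSmallNhd π i m U W) {e : E} (he : e ∈ i ⁻¹' W) :
    modelGerm f π i m U = connectedComponentIn (f ⁻¹' U) e := by
  ext e₁
  constructor
  · rintro ⟨W', hW', e', he', h⟩
    obtain ⟨W₃, hs, hW₃⟩ := H.exists_isSmallNhd hU (hW.2.2.1 hW.2.1)
      (inter_mem (hW.1.mem_nhds hW.2.1) (hW'.1.mem_nhds hW'.2.1))
    obtain ⟨e₃, he₃⟩ := hW₃.2.2.2.nonempty
    have h1 := H.preimage_subset_component hW he (hs he₃).1
    have h2 := H.preimage_subset_component hW' he' (hs he₃).2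
    rwa [connectedComponentIn_eq h1, ← connectedComponentIn_eq h2]
  · intro h
    exact ⟨W, hW, e, he, h⟩

theorem preimage_subset_modelGerm (H : IsModel f π i) {m : M} {U : Set X} (hU : IsOpen U)
    {W : Set M} (hW : IsSmallNhd π i m U W) : i ⁻¹' W ⊆ modelGerm f π i m U := by
  intro e he
  rw [H.modelGerm_eq hU hW he]
  exact mem_connectedComponentIn (H.preimage_subset hW he)

/-- The point of the completion given by a point of the model. -/
def toCompletion (H : IsModel f π i) (m : M) : BranchedCompletion f where
  pt := π m
  germ U _ := modelGerm f π i m U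
  isComponent U hU := by
    obtain ⟨W, -, hW⟩ := H.exists_isSmallNhd U.isOpen hU univ_mem
    obtain ⟨e, he⟩ := hW.2.2.2.nonempty
    exact ⟨e, H.preimage_subset hW he, H.modelGerm_eq U.isOpen hW he⟩
  mono U V hU hV hUV := by
    obtain ⟨W, -, hW⟩ := H.exists_isSmallNhd U.isOpen hU univ_mem
    obtain ⟨e, he⟩ := hW.2.2.2.nonempty
    rw [H.modelGerm_eq U.isOpen hW he, H.modelGerm_eq V.isOpen
      (W := W) ⟨hW.1, hW.2.1, hW.2.2.1.trans (preimage_mono hUV), hW.2.2.2⟩ he]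
    exact connectedComponentIn_mono _ (preimage_mono hUV)

theorem continuous_toCompletion (H : IsModel f π i) : Continuous H.toCompletion := by
  refine continuous_generateFrom_iff.2 ?_
  rintro _ ⟨U, C, rfl⟩
  refine isOpen_iff_mem_nhds.2 ?_
  rintro m ⟨hU, hC⟩
  obtain ⟨W, -, hW⟩ := H.exists_isSmallNhd U.isOpen hU univ_mem
  filter_upwards [hW.1.mem_nhds hW.2.1] with m' hm'
  obtain ⟨W', hs, hW'⟩ := H.exists_isSmallNhd U.isOpen (hW.2.2.1 hm') (hW.1.mem_nhds hm')
  obtain ⟨e, he⟩ := hW'.2.2.2.nonempty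
  refine ⟨hW.2.2.1 hm', ?_⟩
  rw [← hC]
  exact (H.modelGerm_eq U.isOpen hW' he).trans (H.modelGerm_eq U.isOpen hW (hs he)).symm

theorem injective_toCompletion [CompactSpace M] [T2Space M] [T2Space X] (H : IsModel f π i) :
    Function.Injective H.toCompletion := by
  intro m m' h
  have hpt : π m = π m' := congrArg BranchedCompletion.pt h
  by_contra hne
  -- Disjoint neighbourhoods of the points of the fibre contain the preimage of some open `U`.
  obtain ⟨O, hO, hdisj⟩ := (H.finite_fiber (π m)).t2_separation
  have hcl : IsClosedMap π := H.continuous.isClosedMap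
  obtain ⟨U, hxU, hUo, hUO⟩ : ∃ U, π m ∈ U ∧ IsOpen U ∧
      π ⁻¹' U ⊆ ⋃ a ∈ π ⁻¹' {π m}, O a := by
    have hopen : IsOpen (⋃ a ∈ π ⁻¹' {π m}, O a) := isOpen_biUnion fun a _ => (hO a).2
    refine ⟨(π '' (⋃ a ∈ π ⁻¹' {π m}, O a)ᶜ)ᶜ, ?_, (hcl _ hopen.isClosed_compl).isOpen_compl, ?_⟩
    · rintro ⟨a, ha, hpa⟩
      exact ha (mem_biUnion hpa (hO a).1)
    · intro a ha
      by_contra hna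
      exact ha ⟨a, hna, rfl⟩
  have key : ∀ a, π a = π m → modelGerm f π i a U ⊆ i ⁻¹' (O a) := by
    intro a ha
    obtain ⟨W, hs, hW⟩ := H.exists_isSmallNhd (m := a) hUo (ha ▸ hxU) ((hO a).2.mem_nhds (hO a).1)
    obtain ⟨e, he⟩ := hW.2.2.2.nonempty
    rw [H.modelGerm_eq hUo hW he]
    have hfU := H.preimage_subset hW he
    have hsub : ∀ e', e' ∈ f ⁻¹' U → i e' ∈ ⋃ a ∈ π ⁻¹' {π m}, O a := fun e' he' =>
      hUO (by rwa [mem_preimage, H.comp_eq])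
    refine isPreconnected_connectedComponentIn.subset_left_of_subset_union
      (u := i ⁻¹' (O a)) (v := i ⁻¹' (⋃ b ∈ π ⁻¹' {π m} \ {a}, O b))
      ((hO a).2.preimage H.isEmbedding.continuous)
      ((isOpen_biUnion fun b _ => (hO b).2).preimage H.isEmbedding.continuous) ?_ ?_
      ⟨e, mem_connectedComponentIn hfU, hs he⟩
    · refine Disjoint.preimage _ ?_
      simp only [disjoint_iUnion_right]
      intro b hb
      exact hdisj ha hb.1 (fun h => hb.2 h.symm)
    · intro e' he'
      obtain ⟨b, hb, hb'⟩ := mem_iUnion₂.1 (hsub e' (connectedComponentIn_subset _ _ he'))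
      by_cases hba : b = a
      · subst hba; exact Or.inl hb'
      · exact Or.inr (mem_biUnion (show b ∈ π ⁻¹' {π m} \ {a} from ⟨hb, hba⟩) hb')
  obtain ⟨W, -, hW⟩ := H.exists_isSmallNhd (m := m) hUo hxU univ_mem
  obtain ⟨e, he⟩ := hW.2.2.2.nonempty
  have h1 : e ∈ modelGerm f π i m U := H.preimage_subset_modelGerm hUo hW he
  have hg : modelGerm f π i m U = modelGerm f π i m' U := by
    have : ∀ (a b : BranchedCompletion f), a = b →
        ∀ ha hb, a.germ ⟨U, hUo⟩ ha = b.germ ⟨U, hUo⟩ hb := by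
      rintro a _ rfl _ _; rfl
    exact this _ _ h hxU (show π m' ∈ U from hpt ▸ hxU)
  exact (hdisj (show m ∈ π ⁻¹' {π m} from rfl) hpt.symm hne).le_bot
    ⟨key m rfl h1, key m' hpt.symm (hg ▸ h1)⟩

theorem surjective_toCompletion [CompactSpace M] [RegularSpace X] [T2Space X]
    (H : IsModel f π i) : Function.Surjective H.toCompletion := by
  intro a
  have hne : ∀ U hU, (a.germ U hU).Nonempty := by
    intro U hU
    obtain ⟨e, he, h⟩ := a.isComponent U hU
    exact ⟨e, h ▸ mem_connectedComponentIn he⟩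
  have hsub : ∀ U hU, a.germ U hU ⊆ f ⁻¹' (U : Set X) := by
    intro U hU
    obtain ⟨e, he, h⟩ := a.isComponent U hU
    exact h ▸ connectedComponentIn_subset _ _
  -- A point of the model adherent to all the components of the family.
  obtain ⟨m, hm⟩ : (⋂ U : {U : TopologicalSpace.Opens X // a.pt ∈ U},
      closure (i '' a.germ U.1 U.2)).Nonempty := by
    have : Nonempty {U : TopologicalSpace.Opens X // a.pt ∈ U} := ⟨⟨⊤, trivial⟩⟩
    refine IsCompact.nonempty_iInter_of_directed_nonempty_isCompact_isClosed _ ?_ ?_ ?_ ?_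
    · rintro ⟨U, hU⟩ ⟨V, hV⟩
      refine ⟨⟨U ⊓ V, hU, hV⟩, ?_, ?_⟩
      · exact closure_mono (image_mono (a.mono _ _ _ _ inf_le_left))
      · exact closure_mono (image_mono (a.mono _ _ _ _ inf_le_right))
    · rintro ⟨U, hU⟩
      exact ((hne U hU).image _).closure
    · rintro ⟨U, hU⟩
      exact isClosed_closure.isCompact
    · rintro ⟨U, hU⟩
      exact isClosed_closure
  rw [mem_iInter] at hm
  have hpt : π m = a.pt := by
    by_contra hne'
    obtain ⟨U, V, hU, hV, hpU, hmV, hd⟩ := t2_separation (Ne.symm hne')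
    have h1 := hm ⟨⟨U, hU⟩, hpU⟩
    obtain ⟨_, hb, ⟨e, he, rfl⟩⟩ := mem_closure_iff.1 h1 _ (hV.preimage H.continuous) hmV
    refine hd.le_bot ⟨hsub _ _ he, ?_⟩
    rwa [mem_preimage, H.comp_eq] at hb
  refine ⟨m, ext' hpt ?_⟩
  intro U hU hU'
  obtain ⟨W, -, hW⟩ := H.exists_isSmallNhd U.isOpen hU univ_mem
  obtain ⟨_, hb, ⟨e, he, rfl⟩⟩ := mem_closure_iff.1 (hm ⟨U, hU'⟩) _ hW.1 hW.2.1
  refine (H.modelGerm_eq U.isOpen hW hb).trans ?_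
  obtain ⟨e', he', h⟩ := a.isComponent U hU'
  rw [h] at he ⊢
  exact (connectedComponentIn_eq he).symm

theorem t2Space [T2Space X] : T2Space (BranchedCompletion f) := by
  refine ⟨fun a b hab => ?_⟩
  have hopen : ∀ U C, IsOpen {a : BranchedCompletion f | ∃ h : a.pt ∈ U, a.germ U h = C} :=
    fun U C => TopologicalSpace.isOpen_generateFrom_of_mem ⟨U, C, rfl⟩
  by_cases hpt : a.pt = b.pt
  · obtain ⟨U, ha, hb, hU⟩ : ∃ U, ∃ (ha : a.pt ∈ U) (hb : b.pt ∈ U), a.germ U ha ≠ b.germ U hb := by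
      by_contra! h
      exact hab (ext' hpt h)
    refine ⟨_, _, hopen U (a.germ U ha), hopen U (b.germ U hb), ⟨ha, rfl⟩, ⟨hb, rfl⟩, ?_⟩
    refine Set.disjoint_left.2 ?_
    rintro c ⟨hc, h1⟩ ⟨_, h2⟩
    exact hU (h1.symm.trans h2)
  · obtain ⟨U, V, hU, hV, hpU, hmV, hd⟩ := t2_separation hpt
    refine ⟨_, _, hopen ⟨U, hU⟩ (a.germ ⟨U, hU⟩ hpU), hopen ⟨V, hV⟩ (b.germ ⟨V, hV⟩ hmV),
      ⟨hpU, rfl⟩, ⟨hmV, rfl⟩, ?_⟩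
    refine Set.disjoint_left.2 ?_
    rintro c ⟨hc, _⟩ ⟨hc', _⟩
    exact hd.le_bot ⟨hc, hc'⟩

/-- A compact model of a branched cover is homeomorphic to its completion. -/
theorem exists_homeomorph [CompactSpace M] [T2Space M] [RegularSpace X] [T2Space X]
    (H : IsModel f π i) : ∃ Ψ : BranchedCompletion f ≃ₜ M, ∀ a, π (Ψ a) = a.pt := by
  have := t2Space (f := f)
  let e : M ≃ BranchedCompletion f :=
    Equiv.ofBijective _ ⟨H.injective_toCompletion, H.surjective_toCompletion⟩
  let Φ : M ≃ₜ BranchedCompletion f :=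
    Continuous.homeoOfEquivCompactToT2 (f := e) H.continuous_toCompletion
  refine ⟨Φ.symm, fun a => ?_⟩
  have : (Φ (Φ.symm a)).pt = π (Φ.symm a) := rfl
  rw [← this, Φ.apply_symm_apply]

end IsModel

end BranchedCompletion

/-! ### The Cauchy integral of a constant over an arc -/

/-- The Cauchy integral `∫ dζ / (ζ - z)` over the part of the arc `γ` with parameters in
`[a, b]`. -/
def cauchyIntegral (γ : ℝ → ℂ) (a b : ℝ) (z : ℂ) : ℂ :=
  ∫ t in a..b, derivWithin γ (Icc 0 1) t / (γ t - z)

section CauchyIntegral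

variable {γ : ℝ → ℂ}

theorem continuousOn_derivWithin_arc (hγ : ContDiffOn ℝ 1 γ (Icc 0 1)) :
    ContinuousOn (derivWithin γ (Icc 0 1)) (Icc 0 1) :=
  hγ.continuousOn_derivWithin (uniqueDiffOn_Icc zero_lt_one) le_rfl

theorem intervalIntegrable_cauchyKernel (hγ : ContDiffOn ℝ 1 γ (Icc 0 1)) {a b : ℝ} (hab : a ≤ b)
    (h : Icc a b ⊆ Icc 0 1) {z : ℂ} (hz : z ∉ γ '' Icc a b) :
    IntervalIntegrable (fun t => derivWithin γ (Icc 0 1) t / (γ t - z))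
      MeasureTheory.volume a b := by
  refine ContinuousOn.intervalIntegrable_of_Icc hab ?_
  refine ((continuousOn_derivWithin_arc hγ).mono h).div
    ((hγ.continuousOn.mono h).sub continuousOn_const) ?_
  intro t ht h0
  exact hz ⟨t, ht, sub_eq_zero.1 h0⟩

theorem continuousAt_cauchyIntegral (hγ : ContDiffOn ℝ 1 γ (Icc 0 1)) {a b : ℝ} (hab : a ≤ b)
    (h : Icc a b ⊆ Icc 0 1) {z : ℂ} (hz : z ∉ γ '' Icc a b) :
    ContinuousAt (cauchyIntegral γ a b) z := by
  have hK : IsCompact (γ '' Icc a b) := isCompact_Icc.image_of_continuousOn (hγ.continuousOn.mono h)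
  obtain ⟨δ, hδ, hball⟩ := Metric.isOpen_iff.1 hK.isClosed.isOpen_compl z hz
  obtain ⟨B, hB⟩ := isCompact_Icc.exists_bound_of_continuousOn (continuousOn_derivWithin_arc hγ)
  have hnear : ∀ w ∈ Metric.ball z (δ / 2), ∀ t ∈ Icc a b, δ / 2 ≤ ‖γ t - w‖ := by
    intro w hw t ht
    have h1 : ¬ dist (γ t) z < δ := fun h1 => hball h1 ⟨t, ht, rfl⟩
    have h2 := dist_triangle (γ t) w z
    rw [Metric.mem_ball] at hw
    rw [← dist_eq_norm]
    linarith
  have hsub : uIoc a b ⊆ Icc a b := by rw [uIoc_of_le hab]; exact Ioc_subset_Icc_self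
  refine intervalIntegral.continuousAt_of_dominated_interval
    (bound := fun _ => B / (δ / 2)) ?_ ?_ ?_ ?_
  · filter_upwards [Metric.ball_mem_nhds z (half_pos hδ)] with w hw
    refine (intervalIntegrable_cauchyKernel hγ hab h ?_).aestronglyMeasurable_restrict_uIoc
    rintro ⟨t, ht, rfl⟩
    have := hnear _ hw t ht
    simp at this
    linarith
  · filter_upwards [Metric.ball_mem_nhds z (half_pos hδ)] with w hw
    refine Eventually.of_forall fun t ht => ?_
    rw [norm_div]
    have h1 := hB t (h (hsub ht))
    exact div_le_div₀ ((norm_nonneg _).trans h1) h1 (half_pos hδ) (hnear w hw t (hsub ht))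
  · exact intervalIntegrable_const
  · refine Eventually.of_forall fun t ht => ?_
    refine continuousAt_const.div (continuousAt_const.sub continuousAt_id) ?_
    intro h0
    exact hz ⟨t, hsub ht, sub_eq_zero.1 h0⟩

theorem tendsto_cauchyIntegral_cocompact (hγ : ContDiffOn ℝ 1 γ (Icc 0 1)) :
    Tendsto (cauchyIntegral γ 0 1) (cocompact ℂ) (𝓝 0) := by
  obtain ⟨B, hB⟩ := isCompact_Icc.exists_bound_of_continuousOn (continuousOn_derivWithin_arc hγ)
  obtain ⟨R, hR⟩ := isCompact_Icc.exists_bound_of_continuousOn hγ.continuousOn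
  have hlim : Tendsto (fun z : ℂ => B / (‖z‖ - R)) (cocompact ℂ) (𝓝 0) :=
    (tendsto_atTop_add_const_right _ (-R) (tendsto_norm_cocompact_atTop (E := ℂ))).const_div_atTop B
  refine squeeze_zero_norm' ?_ hlim
  filter_upwards [tendsto_norm_cocompact_atTop.eventually (eventually_gt_atTop R)] with z hz
  have := intervalIntegral.norm_integral_le_of_norm_le_const (a := 0) (b := 1) (C := B / (‖z‖ - R))
    (f := fun t => derivWithin γ (Icc 0 1) t / (γ t - z)) ?_
  · simpa [cauchyIntegral] using this
  · intro t ht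
    rw [uIoc_of_le zero_le_one] at ht
    have ht' := Ioc_subset_Icc_self ht
    rw [norm_div]
    refine div_le_div₀ ((norm_nonneg _).trans (hB t ht')) (hB t ht') (by linarith) ?_
    have := norm_sub_norm_le z (γ t)
    have := hR t ht'
    rw [norm_sub_rev]
    linarith

/-- The Cauchy integral of an arc is a logarithm of `(z - γ 1) / (z - γ 0)`. -/
theorem exp_cauchyIntegral (hγ : ContDiffOn ℝ 1 γ (Icc 0 1)) {z : ℂ} (hz : z ∉ γ '' Icc 0 1) :
    Complex.exp (cauchyIntegral γ 0 1 z) = (z - γ 1) / (z - γ 0) := by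
  set g : ℝ → ℂ := fun t => derivWithin γ (Icc 0 1) t / (γ t - z)
  have hg : ContinuousOn g (Icc 0 1) := by
    refine (continuousOn_derivWithin_arc hγ).div (hγ.continuousOn.sub continuousOn_const) ?_
    intro t ht h0
    exact hz ⟨t, ht, sub_eq_zero.1 h0⟩
  set G : ℝ → ℂ := IccExtend zero_le_one (fun t : Icc (0 : ℝ) 1 => g t)
  have hG : Continuous G := (continuousOn_iff_continuous_domRestrict.1 hg).Icc_extend'
  have hGg : ∀ t ∈ Icc (0 : ℝ) 1, G t = g t := fun t ht => IccExtend_of_mem _ _ ht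
  have hne : ∀ t ∈ Icc (0 : ℝ) 1, γ t - z ≠ 0 := fun t ht h0 => hz ⟨t, ht, sub_eq_zero.1 h0⟩
  -- The function `(γ s - z) exp (- ∫₀ˢ γ' / (γ - z))` has derivative zero.
  have hconst := constant_of_has_deriv_right_zero (a := 0) (b := 1)
    (f := fun s => Complex.exp (-∫ t in (0 : ℝ)..s, G t) * (γ s - z)) ?_ ?_ 1 (by simp)
  · have hI : cauchyIntegral γ 0 1 z = ∫ t in (0 : ℝ)..1, G t := by
      refine intervalIntegral.integral_congr fun t ht => ?_
      rw [uIcc_of_le zero_le_one] at ht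
      exact (hGg t ht).symm
    simp only [intervalIntegral.integral_same, neg_zero, Complex.exp_zero, one_mul] at hconst
    rw [← hI, Complex.exp_neg] at hconst
    have h0 := hne 0 (by simp)
    have he := Complex.exp_ne_zero (cauchyIntegral γ 0 1 z)
    have h0' : z - γ 0 ≠ 0 := fun h => h0 (by linear_combination -h)
    rw [inv_mul_eq_div, div_eq_iff he] at hconst
    rw [eq_div_iff h0']
    linear_combination hconst
  · have : Continuous fun s : ℝ => ∫ t in (0 : ℝ)..s, G t :=
      intervalIntegral.continuous_primitive (fun a b => hG.intervalIntegrable a b) 0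
    exact (Complex.continuous_exp.comp this.neg).continuousOn.mul
      (hγ.continuousOn.sub continuousOn_const)
  · intro s hs
    have hs' : s ∈ Icc (0 : ℝ) 1 := Ico_subset_Icc_self hs
    have h1 : HasDerivAt (fun s : ℝ => ∫ t in (0 : ℝ)..s, G t) (G s) s :=
      intervalIntegral.integral_hasDerivAt_right (hG.intervalIntegrable _ _)
        (hG.stronglyMeasurableAtFilter _ _) hG.continuousAt
    have h2 : HasDerivWithinAt γ (derivWithin γ (Icc 0 1) s) (Ici s) s := by
      refine ((hγ.differentiableOn one_ne_zero s hs').hasDerivWithinAt).mono_of_mem_nhdsWithin ?_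
      filter_upwards [Icc_mem_nhdsGE hs.2] with u hu using ⟨hs.1.trans hu.1, hu.2⟩
    have h3 := (h1.hasDerivWithinAt (s := Ici s)).neg.cexp.mul (h2.sub_const z)
    convert! h3 using 1
    rw [hGg s hs']
    simp only [g]
    field_simp [hne s hs']
    ring

/-- A quantitative form of: the point `Iα + rβ` does not lie on the negative real axis if `α` is
almost real, `β` is almost `1` and `r` is positive. -/
theorem I_mul_add_mem_slitPlane {α β : ℂ} {d r : ℝ} (hα : ‖α - d‖ ≤ |d| / 4)
    (hβ : ‖β - 1‖ ≤ 1 / 4) (hr : 0 < r) : Complex.I * α + r * β ∈ Complex.slitPlane := by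
  have h1 := (Complex.abs_re_le_norm _).trans hα
  have h2 := (Complex.abs_im_le_norm _).trans hα
  have h3 := (Complex.abs_re_le_norm _).trans hβ
  have h4 := (Complex.abs_im_le_norm _).trans hβ
  simp only [Complex.sub_re, Complex.sub_im, Complex.ofReal_re, Complex.ofReal_im,
    Complex.one_re, Complex.one_im, sub_zero] at h1 h2 h3 h4
  rw [Complex.mem_slitPlane_iff]
  by_contra! hcon
  simp at hcon
  obtain ⟨hre, him⟩ := hcon
  rw [abs_le] at h1 h2 h3 h4
  have h5 : r * β.im ≤ r * (1 / 4) := by gcongr; exact h4.2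
  have h6 : r * (-(1 / 4)) ≤ r * β.im := by gcongr; exact h4.1
  have h7 : r * (3 / 4) ≤ r * β.re := by gcongr; linarith
  rcases abs_cases d with ⟨hd, _⟩ | ⟨hd, _⟩ <;> rw [hd] at h1 h2 <;>
    linarith [h1.1, h1.2, h2.1, h2.2]

theorem log_I_mul_of_re_pos {w : ℂ} (hw : 0 < w.re) :
    Complex.log (Complex.I * w) = Complex.log w + Real.pi / 2 * Complex.I ∧
    Complex.log (-Complex.I * w) = Complex.log w - Real.pi / 2 * Complex.I := by
  have hw0 : w ≠ 0 := by rintro rfl; simp at hw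
  have h := Complex.abs_arg_lt_pi_div_two_iff.2 (Or.inl hw)
  rw [abs_lt] at h
  have hπ := Real.pi_pos
  constructor
  · rw [Complex.log_mul Complex.I_ne_zero hw0 (by rw [Complex.arg_I]; constructor <;> linarith),
      Complex.log_I]
    ring
  · rw [Complex.log_mul (neg_ne_zero.2 Complex.I_ne_zero) hw0
      (by rw [Complex.arg_neg_I]; constructor <;> linarith), Complex.log_neg_I]
    ring

theorem hasStrictDerivAt_arc (hγ : ContDiffOn ℝ 1 γ (Icc 0 1)) {t : ℝ} (ht : t ∈ Ioo (0 : ℝ) 1) :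
    HasStrictDerivAt γ (derivWithin γ (Icc 0 1) t) t := by
  have hmem : Icc (0 : ℝ) 1 ∈ 𝓝 t := Icc_mem_nhds ht.1 ht.2
  rw [derivWithin_of_mem_nhds hmem]
  exact (hγ.contDiffAt hmem).hasStrictDerivAt one_ne_zero

theorem continuousAt_derivWithin_arc (hγ : ContDiffOn ℝ 1 γ (Icc 0 1)) {t : ℝ}
    (ht : t ∈ Ioo (0 : ℝ) 1) : ContinuousAt (derivWithin γ (Icc 0 1)) t :=
  (continuousOn_derivWithin_arc hγ).continuousAt (Icc_mem_nhds ht.1 ht.2)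

/-- The integral over a part of the arc whose translate by `-z`, multiplied by `c`, stays in the
slit plane is the increment of the principal logarithm. -/
theorem cauchyIntegral_eq_log_sub_log (hγ : ContDiffOn ℝ 1 γ (Icc 0 1)) {a b : ℝ} (hab : a ≤ b)
    (h : Icc a b ⊆ Ioo 0 1) {z c : ℂ} (hz : ∀ u ∈ Icc a b, c * (γ u - z) ∈ Complex.slitPlane) :
    cauchyIntegral γ a b z = Complex.log (c * (γ b - z)) - Complex.log (c * (γ a - z)) := by
  have hne : ∀ u ∈ Icc a b, c * (γ u - z) ≠ 0 := fun u hu => Complex.slitPlane_ne_zero (hz u hu)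
  refine intervalIntegral.integral_eq_sub_of_hasDerivAt
    (f := fun u => Complex.log (c * (γ u - z))) ?_ ?_
  · intro u hu
    rw [uIcc_of_le hab] at hu
    have h1 := (((hasStrictDerivAt_arc hγ (h hu)).hasDerivAt.sub_const z).const_mul c).clog_real
      (hz u hu)
    convert! h1 using 1
    rw [mul_div_mul_left _ _ (left_ne_zero_of_mul (hne u hu))]
  · refine intervalIntegrable_cauchyKernel hγ hab (h.trans Ioo_subset_Icc_self) ?_
    rintro ⟨u, hu, rfl⟩
    exact hne u hu (by simp)

/-- The jump of the Cauchy integral across the arc: near an inner point of the arc it is of the form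
`C + iπ` on the left and `C - iπ` on the right, with a continuous function `C`. -/
theorem exists_cauchyIntegral_eq (hγ : ContDiffOn ℝ 1 γ (Icc 0 1)) (hinj : InjOn γ (Icc 0 1))
    {t : ℝ} (ht : t ∈ Ioo (0 : ℝ) 1) (hτ : derivWithin γ (Icc 0 1) t ≠ 0) :
    ∃ C : ℂ → ℂ, (∀ᶠ z in 𝓝 (γ t), ContinuousAt C z) ∧
      ∀ᶠ q : (ℝ × ℝ) × ℝ in (𝓝 t ×ˢ 𝓝 t) ×ˢ 𝓝 0, ∀ z,
        z = γ q.1.1 + q.2 * (Complex.I * derivWithin γ (Icc 0 1) q.1.2) →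
        (0 < q.2 → cauchyIntegral γ 0 1 z = C z + Real.pi * Complex.I) ∧
        (q.2 < 0 → cauchyIntegral γ 0 1 z = C z - Real.pi * Complex.I) := by
  set τ := derivWithin γ (Icc 0 1) t
  have hτ' : 0 < ‖τ‖ := norm_pos_iff.2 hτ
  -- On a parameter interval `[a, b]` around `t` the function `γ / τ` is close to a translation.
  have hstrict := (hasStrictDerivAt_arc hγ ht).hasStrictFDerivAt.isLittleO.def
    (c := ‖τ‖ / 4) (by positivity)
  rw [Metric.eventually_nhds_iff] at hstrict
  obtain ⟨δ₀, hδ₀, hstrict⟩ := hstrict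
  obtain ⟨δ, hδ, hδ1, hδ2, hδ3⟩ : ∃ δ > 0, δ < δ₀ ∧ δ < t ∧ δ < 1 - t := by
    refine ⟨min δ₀ (min t (1 - t)) / 2, ?_, ?_, ?_, ?_⟩
    · have := ht.1; have := ht.2
      have : 0 < min δ₀ (min t (1 - t)) := by
        simp only [lt_min_iff]
        refine ⟨hδ₀, ?_, ?_⟩ <;> linarith
      linarith
    all_goals
      have h1 := min_le_left δ₀ (min t (1 - t))
      have h2 := min_le_right δ₀ (min t (1 - t))
      have h3 := min_le_left t (1 - t)
      have h4 := min_le_right t (1 - t)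
      have := ht.1; have := ht.2
      linarith
  set a := t - δ
  set b := t + δ
  have hslope : ∀ u ∈ Icc a b, ∀ s ∈ Icc a b,
      ‖(γ u - γ s) / τ - ((u - s : ℝ) : ℂ)‖ ≤ |u - s| / 4 := by
    intro u hu s hs
    have h1 := hstrict (y := (u, s)) (by
      rw [Prod.dist_eq, Real.dist_eq, Real.dist_eq, max_lt_iff, abs_lt, abs_lt]
      simp only [a, b, mem_Icc] at hu hs
      refine ⟨⟨?_, ?_⟩, ?_, ?_⟩ <;> linarith [hu.1, hu.2, hs.1, hs.2])
    have h2 : (γ u - γ s) / τ - ((u - s : ℝ) : ℂ) = (γ u - γ s - (u - s) • τ) / τ := by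
      rw [sub_div (γ u - γ s), Complex.real_smul, mul_div_cancel_right₀ _ hτ]
    rw [h2, norm_div, div_le_iff₀ hτ']
    simp at h1 ⊢
    linarith
  have haI : a ∈ Ioo (0 : ℝ) 1 := ⟨by simp only [a]; linarith, by simp only [a]; linarith⟩
  have hbI : b ∈ Ioo (0 : ℝ) 1 := ⟨by simp only [b]; linarith, by simp only [b]; linarith⟩
  have hat : a < t := by simp only [a]; linarith
  have htb : t < b := by simp only [b]; linarith
  have habI : Icc a b ⊆ Ioo 0 1 := fun u hu => ⟨haI.1.trans_le hu.1, hu.2.trans_lt hbI.2⟩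
  have h0a : Icc 0 a ⊆ Icc (0 : ℝ) 1 := Icc_subset_Icc_right haI.2.le
  have hb1 : Icc b 1 ⊆ Icc (0 : ℝ) 1 := Icc_subset_Icc_left hbI.1.le
  have htI := Ioo_subset_Icc_self ht
  have hKa : ∀ᶠ z in 𝓝 (γ t), z ∉ γ '' Icc 0 a := by
    refine (isCompact_Icc.image_of_continuousOn
      (hγ.continuousOn.mono h0a)).isClosed.isOpen_compl.mem_nhds ?_
    rintro ⟨u, hu, h⟩
    have := hinj (h0a hu) htI h
    linarith [hu.2]
  have hKb : ∀ᶠ z in 𝓝 (γ t), z ∉ γ '' Icc b 1 := by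
    refine (isCompact_Icc.image_of_continuousOn
      (hγ.continuousOn.mono hb1)).isClosed.isOpen_compl.mem_nhds ?_
    rintro ⟨u, hu, h⟩
    have := hinj (hb1 hu) htI h
    linarith [hu.1]
  have hre : ∀ u ∈ Icc a b, u ≠ t → 0 < (u - t) * ((γ u - γ t) / τ).re := by
    intro u hu hut
    have h1 := (Complex.abs_re_le_norm _).trans (hslope u hu t ⟨hat.le, htb.le⟩)
    rw [Complex.sub_re, Complex.ofReal_re, abs_le] at h1
    rcases lt_or_gt_of_ne hut with h | h
    · rw [abs_of_neg (by linarith)] at h1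
      exact mul_pos_of_neg_of_neg (by linarith) (by linarith [h1.2])
    · rw [abs_of_pos (by linarith)] at h1
      exact mul_pos (by linarith) (by linarith [h1.1])
  have hWb : ∀ᶠ z in 𝓝 (γ t), 0 < ((γ b - z) / τ).re := by
    have hc : ContinuousAt (fun z => ((γ b - z) / τ).re) (γ t) := by fun_prop
    refine hc.eventually (lt_mem_nhds ?_)
    have := hre b ⟨hat.le.trans htb.le, le_rfl⟩ htb.ne'
    exact (pos_iff_pos_of_mul_pos this).1 (by linarith)
  have hWa : ∀ᶠ z in 𝓝 (γ t), 0 < (-((γ a - z) / τ)).re := by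
    have hc : ContinuousAt (fun z => (-((γ a - z) / τ)).re) (γ t) := by fun_prop
    refine hc.eventually (lt_mem_nhds ?_)
    have := hre a ⟨le_rfl, hat.le.trans htb.le⟩ hat.ne
    have := (neg_iff_neg_of_mul_pos this).1 (by linarith)
    simpa using this
  -- The integrals over the outer parts of the arc are continuous at `γ t`. The middle part is the
  -- increment of a logarithm of `(γ u - z) / τ`, whose branch depends on the side of `z`: rotated
  -- by `± I`, this quotient avoids the negative real axis for all `u` in `[a, b]`.
  refine ⟨fun z => cauchyIntegral γ 0 a z + cauchyIntegral γ b 1 z + Complex.log ((γ b - z) / τ) -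
    Complex.log (-((γ a - z) / τ)), ?_, ?_⟩
  · filter_upwards [hKa, hKb, hWa, hWb] with z h1 h2 h3 h4
    refine (((continuousAt_cauchyIntegral hγ haI.1.le h0a h1).add
      (continuousAt_cauchyIntegral hγ hbI.2.le hb1 h2)).add ?_).sub ?_
    · exact ContinuousAt.clog (by fun_prop) (Complex.mem_slitPlane_iff.2 (Or.inl h4))
    · exact ContinuousAt.clog (by fun_prop) (Complex.mem_slitPlane_iff.2 (Or.inl h3))
  · have hΦ : Tendsto (fun q : (ℝ × ℝ) × ℝ =>
        γ q.1.1 + q.2 * (Complex.I * derivWithin γ (Icc 0 1) q.1.2))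
        ((𝓝 t ×ˢ 𝓝 t) ×ˢ 𝓝 0) (𝓝 (γ t)) := by
      have h1 : Tendsto (fun q : (ℝ × ℝ) × ℝ => γ q.1.1) ((𝓝 t ×ˢ 𝓝 t) ×ˢ 𝓝 0) (𝓝 (γ t)) :=
        (hasStrictDerivAt_arc hγ ht).hasDerivAt.continuousAt.tendsto.comp
          (tendsto_fst.comp tendsto_fst)
      have h2 : Tendsto (fun q : (ℝ × ℝ) × ℝ => derivWithin γ (Icc 0 1) q.1.2)
          ((𝓝 t ×ˢ 𝓝 t) ×ˢ 𝓝 0) (𝓝 τ) :=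
        (continuousAt_derivWithin_arc hγ ht).tendsto.comp (tendsto_snd.comp tendsto_fst)
      have h3 : Tendsto (fun q : (ℝ × ℝ) × ℝ => (q.2 : ℂ)) ((𝓝 t ×ˢ 𝓝 t) ×ˢ 𝓝 0) (𝓝 0) := by
        have := (Complex.continuous_ofReal.tendsto 0).comp
          (tendsto_snd (f := 𝓝 t ×ˢ 𝓝 t) (g := 𝓝 (0 : ℝ)))
        simpa [Function.comp_def] using this
      have := h1.add (h3.mul (h2.const_mul Complex.I))
      simpa using this
    have hs : ∀ᶠ q : (ℝ × ℝ) × ℝ in (𝓝 t ×ˢ 𝓝 t) ×ˢ 𝓝 0, q.1.1 ∈ Icc a b :=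
      (tendsto_fst.comp tendsto_fst).eventually (Icc_mem_nhds hat htb)
    have hs' : ∀ᶠ q : (ℝ × ℝ) × ℝ in (𝓝 t ×ˢ 𝓝 t) ×ˢ 𝓝 0,
        ‖derivWithin γ (Icc 0 1) q.1.2 / τ - 1‖ ≤ 1 / 4 := by
      have hc : ContinuousAt (fun s => ‖derivWithin γ (Icc 0 1) s / τ - 1‖) t :=
        (((continuousAt_derivWithin_arc hγ ht).div_const τ).sub continuousAt_const).norm
      refine (tendsto_snd.comp tendsto_fst).eventually (hc.eventually (ge_mem_nhds ?_))
      change ‖τ / τ - 1‖ < 1 / 4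
      rw [div_self hτ]
      norm_num
    filter_upwards [hΦ.eventually hKa, hΦ.eventually hKb, hΦ.eventually hWa, hΦ.eventually hWb, hs,
      hs'] with ⟨⟨s, s'⟩, r⟩ h1 h2 h3 h4 h5 h6 z hz
    dsimp only at h1 h2 h3 h4 h5 h6 hz ⊢
    rw [← hz] at h1 h2 h3 h4
    have key : ∀ c : ℂ, (∀ u ∈ Icc a b, c * (γ u - z) ∈ Complex.slitPlane) →
        cauchyIntegral γ 0 1 z = cauchyIntegral γ 0 a z + cauchyIntegral γ b 1 z +
          (Complex.log (c * (γ b - z)) - Complex.log (c * (γ a - z))) := by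
      intro c hc
      rw [← cauchyIntegral_eq_log_sub_log hγ (hat.le.trans htb.le) habI hc]
      have hi := intervalIntegrable_cauchyKernel hγ haI.1.le h0a h1
      have hi' := intervalIntegrable_cauchyKernel hγ hbI.2.le hb1 h2
      have hi'' := intervalIntegrable_cauchyKernel hγ (hat.le.trans htb.le)
        (habI.trans Ioo_subset_Icc_self) (z := z) (by
          rintro ⟨u, hu, rfl⟩
          exact Complex.slitPlane_ne_zero (hc u hu) (by simp))
      simp only [cauchyIntegral]
      rw [← intervalIntegral.integral_add_adjacent_intervals (hi.trans hi'') hi',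
        ← intervalIntegral.integral_add_adjacent_intervals hi hi'']
      ring
    have hquot : ∀ u, (γ u - z) / τ = (γ u - γ s) / τ -
        r * (Complex.I * (derivWithin γ (Icc 0 1) s' / τ)) := by
      intro u
      rw [hz]; ring
    have hIb := log_I_mul_of_re_pos h4
    have hIa := log_I_mul_of_re_pos h3
    constructor
    · intro hr
      rw [key (Complex.I / τ)]
      · rw [div_mul_eq_mul_div, div_mul_eq_mul_div, mul_div_assoc, mul_div_assoc, hIb.1,
          show Complex.I * ((γ a - z) / τ) = -Complex.I * -((γ a - z) / τ) by ring, hIa.2]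
        ring
      · intro u hu
        rw [div_mul_eq_mul_div, mul_div_assoc, hquot]
        convert I_mul_add_mem_slitPlane (hslope u hu s h5) h6 hr using 1
        linear_combination (-r * (derivWithin γ (Icc 0 1) s' / τ)) * Complex.I_sq
    · intro hr
      rw [key (-Complex.I / τ)]
      · rw [div_mul_eq_mul_div, div_mul_eq_mul_div, mul_div_assoc, mul_div_assoc, hIb.2,
          show -Complex.I * ((γ a - z) / τ) = Complex.I * -((γ a - z) / τ) by ring, hIa.1]
        ring
      · intro u hu
        rw [div_mul_eq_mul_div, mul_div_assoc, hquot]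
        have h7 : ‖-((γ u - γ s) / τ) - ((-(u - s) : ℝ) : ℂ)‖ ≤ |(-(u - s))| / 4 := by
          rw [abs_neg, ← norm_neg]
          rw [show -(-((γ u - γ s) / τ) - ((-(u - s) : ℝ) : ℂ)) =
              (γ u - γ s) / τ - ((u - s : ℝ) : ℂ) by
            push_cast; ring]
          exact hslope u hu s h5
        convert I_mul_add_mem_slitPlane h7 h6 (neg_pos.2 hr) using 1
        push_cast
        linear_combination (r * (derivWithin γ (Icc 0 1) s' / τ)) * Complex.I_sq

end CauchyIntegral

/-! ### The trigonal curve `q ^ 3 = r ^ 5 - r` and its one-point compactification -/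

/-- The smooth affine plane curve `q ^ 3 = r ^ 5 - r`. -/
def trigonalCurve : Set (ℂ × ℂ) := {z | z.1 ^ 3 = z.2 ^ 5 - z.2}

/-- The one-point compactification of the curve `q ^ 3 = r ^ 5 - r`, a compact Riemann surface of
genus `4`. -/
abbrev TrigonalModel : Type := OnePoint trigonalCurve

namespace TrigonalModel

theorem isClosed_trigonalCurve : IsClosed trigonalCurve :=
  isClosed_eq (by fun_prop) (by fun_prop)

instance : LocallyCompactSpace trigonalCurve :=
  isClosed_trigonalCurve.isClosedEmbedding_subtypeVal.locallyCompactSpace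

/-- The point `(0, 0)` of the curve. -/
def origin : trigonalCurve := ⟨(0, 0), by simp [trigonalCurve]⟩

/-- The affine coordinates `(q, r)`, with junk value `(0, 0)` at the point at infinity. -/
def aff (m : TrigonalModel) : ℂ × ℂ := m.elim 0 Subtype.val

@[simp] theorem aff_coe (z : trigonalCurve) : aff z = z := rfl

theorem aff_mem {m : TrigonalModel} (hm : m ≠ OnePoint.infty) :
    (aff m).1 ^ 3 = (aff m).2 ^ 5 - (aff m).2 := by
  obtain ⟨z, rfl⟩ := OnePoint.ne_infty_iff_exists.1 hm
  exact z.2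

theorem aff_injective {m m' : TrigonalModel} (hm : m ≠ OnePoint.infty) (hm' : m' ≠ OnePoint.infty)
    (h : aff m = aff m') : m = m' := by
  obtain ⟨z, rfl⟩ := OnePoint.ne_infty_iff_exists.1 hm
  obtain ⟨w, rfl⟩ := OnePoint.ne_infty_iff_exists.1 hm'
  rw [aff_coe, aff_coe] at h
  rw [Subtype.ext h]

theorem continuousAt_aff {m : TrigonalModel} (hm : m ≠ OnePoint.infty) : ContinuousAt aff m := by
  obtain ⟨z, rfl⟩ := OnePoint.ne_infty_iff_exists.1 hm
  exact OnePoint.continuousAt_coe.2 continuous_subtype_val.continuousAt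

theorem eventually_ne_infty {m : TrigonalModel} (hm : m ≠ OnePoint.infty) :
    ∀ᶠ m' in 𝓝 m, m' ≠ OnePoint.infty :=
  isOpen_ne.mem_nhds hm

/-- The coordinate `r` tends to infinity at the point at infinity. -/
theorem tendsto_norm_snd :
    Tendsto (fun z : trigonalCurve => ‖(z : ℂ × ℂ).2‖) (coclosedCompact trigonalCurve) atTop := by
  rw [coclosedCompact_eq_cocompact]
  refine tendsto_atTop.2 fun R => ?_
  have hK : IsCompact (Subtype.val ⁻¹' (Metric.closedBall (0 : ℂ) (1 + (|R| ^ 5 + |R|)) ×ˢ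
      Metric.closedBall (0 : ℂ) |R|) : Set trigonalCurve) :=
    isClosed_trigonalCurve.isClosedEmbedding_subtypeVal.isCompact_preimage
      ((isCompact_closedBall _ _).prod (isCompact_closedBall _ _))
  filter_upwards [hK.compl_mem_cocompact] with z hz
  by_contra! hlt
  refine hz ?_
  have h2 : ‖(z : ℂ × ℂ).2‖ ≤ |R| := hlt.le.trans (le_abs_self R)
  refine ⟨?_, by simpa using h2⟩
  rw [mem_closedBall_zero_iff]
  have h3 : ‖(z : ℂ × ℂ).1‖ ^ 3 ≤ |R| ^ 5 + |R| := by
    rw [← norm_pow, show (z : ℂ × ℂ).1 ^ 3 = _ from z.2]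
    refine (norm_sub_le _ _).trans ?_
    rw [norm_pow]
    gcongr
  by_contra! h4
  have h5 : (1 : ℝ) ≤ ‖(z : ℂ × ℂ).1‖ := by
    have : 0 ≤ |R| ^ 5 + |R| := by positivity
    linarith
  have h6 : ‖(z : ℂ × ℂ).1‖ ≤ ‖(z : ℂ × ℂ).1‖ ^ 3 := le_self_pow₀ h5 (by norm_num)
  linarith

/-- A function into the model tends to infinity if its `r`-coordinate does. -/
theorem tendsto_nhds_infty_of_norm {α : Type*} {l : Filter α} {F : α → TrigonalModel}
    (h : ∀ B : ℝ, ∀ᶠ a in l, F a = OnePoint.infty ∨ B < ‖(aff (F a)).2‖) :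
    Tendsto F l (𝓝 OnePoint.infty) := by
  refine OnePoint.hasBasis_nhds_infty.tendsto_right_iff.2 ?_
  rintro s ⟨-, hs⟩
  obtain ⟨B, hB⟩ := hs.exists_bound_of_continuousOn (f := fun z : trigonalCurve => (z : ℂ × ℂ).2)
    (by fun_prop)
  filter_upwards [h B] with a ha
  rcases ha with ha | ha
  · exact Or.inr ha
  · by_cases hinf : F a = OnePoint.infty
    · exact Or.inr hinf
    · obtain ⟨z, hz⟩ := OnePoint.ne_infty_iff_exists.1 hinf
      rw [← hz] at ha ⊢
      exact Or.inl ⟨z, fun hzs => absurd (hB z hzs) (not_le.2 ha), rfl⟩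

/-- A function into the model is continuous at points with finite value if its coordinates are. -/
theorem tendsto_of_tendsto_aff {α : Type*} {l : Filter α} {F : α → TrigonalModel}
    {m : TrigonalModel} (hm : m ≠ OnePoint.infty) (hF : ∀ᶠ a in l, F a ≠ OnePoint.infty)
    (h : Tendsto (fun a => aff (F a)) l (𝓝 (aff m))) : Tendsto F l (𝓝 m) := by
  obtain ⟨z, rfl⟩ := OnePoint.ne_infty_iff_exists.1 hm
  have h1 : Tendsto (fun a => (F a).elim origin id) l (𝓝 z) := by
    rw [tendsto_subtype_rng]
    refine h.congr' ?_
    filter_upwards [hF] with a ha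
    obtain ⟨w, hw⟩ := OnePoint.ne_infty_iff_exists.1 ha
    rw [← hw]
    rfl
  refine ((OnePoint.continuous_coe.tendsto z).comp h1).congr' ?_
  filter_upwards [hF] with a ha
  obtain ⟨w, hw⟩ := OnePoint.ne_infty_iff_exists.1 ha
  rw [Function.comp_apply, ← hw]
  rfl

/-- The formula for the involution of the curve which exchanges `r` and `1 / r`. -/
def flipFun (z : ℂ × ℂ) : ℂ × ℂ := (-z.1 / z.2 ^ 2, 1 / z.2)

theorem flipFun_mem {z : ℂ × ℂ} (hz : z ∈ trigonalCurve) (h : z.2 ≠ 0) :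
    flipFun z ∈ trigonalCurve := by
  have hz' : z.1 ^ 3 = z.2 ^ 5 - z.2 := hz
  simp only [flipFun, trigonalCurve, mem_ofPred_eq]
  field_simp
  linear_combination -hz'

/-- The involution `(q, r) ↦ (-q / r ^ 2, 1 / r)`, which exchanges the origin and the point at
infinity. -/
def flip (m : TrigonalModel) : TrigonalModel :=
  m.elim (origin : TrigonalModel)
    (fun z => if h : (z : ℂ × ℂ).2 = 0 then OnePoint.infty
      else ((⟨flipFun z, flipFun_mem z.2 h⟩ : trigonalCurve) : TrigonalModel))

@[simp] theorem flip_infty : flip OnePoint.infty = (origin : TrigonalModel) := rfl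

theorem flip_coe_of_eq {z : trigonalCurve} (h : (z : ℂ × ℂ).2 = 0) :
    flip z = OnePoint.infty := dif_pos h

theorem flip_coe_of_ne {z : trigonalCurve} (h : (z : ℂ × ℂ).2 ≠ 0) :
    flip z = ((⟨flipFun z, flipFun_mem z.2 h⟩ : trigonalCurve) : TrigonalModel) := dif_neg h

theorem eq_origin {z : trigonalCurve} (h : (z : ℂ × ℂ).2 = 0) : z = origin := by
  have := z.2
  simp only [trigonalCurve, mem_ofPred_eq, h] at this
  refine Subtype.ext (Prod.ext ?_ h)
  simpa [origin] using this

theorem flip_flip (m : TrigonalModel) : flip (flip m) = m := by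
  induction m using OnePoint.rec with
  | infty => exact flip_coe_of_eq rfl
  | coe z =>
    by_cases h : (z : ℂ × ℂ).2 = 0
    · rw [flip_coe_of_eq h, flip_infty, eq_origin h]
    · rw [flip_coe_of_ne h, flip_coe_of_ne (by simpa [flipFun] using h)]
      congr 1
      refine Subtype.ext (Prod.ext ?_ ?_)
      · simp only [flipFun]
        field_simp
      · simp [flipFun]

theorem flip_ne_infty {m : TrigonalModel} (hm : m ≠ OnePoint.infty)
    (h : flip m ≠ OnePoint.infty) : (aff m).2 ≠ 0 ∧ aff (flip m) = flipFun (aff m) := by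
  obtain ⟨z, rfl⟩ := OnePoint.ne_infty_iff_exists.1 hm
  by_cases hz : (z : ℂ × ℂ).2 = 0
  · exact absurd (flip_coe_of_eq hz) h
  · exact ⟨hz, by rw [flip_coe_of_ne hz]; rfl⟩

theorem continuous_flip : Continuous flip := by
  refine continuous_iff_continuousAt.2 fun m => ?_
  induction m using OnePoint.rec with
  | infty =>
    refine OnePoint.continuousAt_infty'.2 ?_
    refine tendsto_of_tendsto_aff (OnePoint.coe_ne_infty _) ?_ ?_
    · filter_upwards [tendsto_norm_snd.eventually (eventually_gt_atTop 0)] with z hz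
      rw [Function.comp_apply, flip_coe_of_ne (norm_pos_iff.1 hz)]
      exact OnePoint.coe_ne_infty _
    · have hinv : Tendsto (fun z : trigonalCurve => 1 / (z : ℂ × ℂ).2)
          (coclosedCompact trigonalCurve) (𝓝 0) := by
        refine tendsto_zero_iff_norm_tendsto_zero.2 ?_
        simpa [Pi.inv_def] using tendsto_norm_snd.inv_tendsto_atTop
      have hev : ∀ᶠ z : trigonalCurve in coclosedCompact trigonalCurve,
          flipFun z = aff (flip z) := by
        filter_upwards [tendsto_norm_snd.eventually (eventually_gt_atTop 0)] with z hz
        rw [flip_coe_of_ne (norm_pos_iff.1 hz)]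
        rfl
      -- The cube of the first coordinate tends to zero, hence so does this coordinate.
      have hcube : Tendsto (fun z : trigonalCurve => ‖(flipFun z).1‖ ^ 3)
          (coclosedCompact trigonalCurve) (𝓝 0) := by
        have h1 := ((hinv.pow 5).sub hinv).norm
        simp only [ne_eq, OfNat.ofNat_ne_zero, not_false_eq_true, zero_pow, sub_zero,
          norm_zero] at h1
        refine h1.congr' ?_
        filter_upwards [tendsto_norm_snd.eventually (eventually_gt_atTop 0)] with z hz
        rw [← norm_pow, show (flipFun z).1 ^ 3 = _ from flipFun_mem z.2 (norm_pos_iff.1 hz)]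
        rfl
      have hfst : Tendsto (fun z : trigonalCurve => (flipFun z).1)
          (coclosedCompact trigonalCurve) (𝓝 0) := by
        refine Metric.tendsto_nhds.2 fun ε hε => ?_
        filter_upwards [hcube.eventually
          (gt_mem_nhds (show (0 : ℝ) < ε ^ 3 by positivity))] with z hz
        rw [dist_zero_right]
        exact lt_of_pow_lt_pow_left₀ 3 hε.le hz
      exact (hfst.prodMk_nhds hinv).congr' hev
  | coe z =>
    refine OnePoint.continuousAt_coe.2 ?_
    by_cases h : (z : ℂ × ℂ).2 = 0
    · unfold ContinuousAt
      rw [Function.comp_apply, flip_coe_of_eq h]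
      refine tendsto_nhds_infty_of_norm fun B => ?_
      have hc : ContinuousAt (fun w : trigonalCurve => ‖(w : ℂ × ℂ).2‖) z := by fun_prop
      filter_upwards [hc.eventually (gt_mem_nhds (show ‖(z : ℂ × ℂ).2‖ < 1 / (|B| + 1) by
        rw [h, norm_zero]; positivity))] with w hw
      by_cases hw0 : (w : ℂ × ℂ).2 = 0
      · exact Or.inl (flip_coe_of_eq hw0)
      · right
        rw [Function.comp_apply, flip_coe_of_ne hw0]
        simp only [aff_coe, flipFun, norm_div, norm_one]
        have : |B| + 1 < 1 / ‖(w : ℂ × ℂ).2‖ := by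
          rw [lt_one_div (by positivity) (norm_pos_iff.2 hw0)]
          exact hw
        linarith [le_abs_self B]
    · have hne : ∀ᶠ w : trigonalCurve in 𝓝 z, (w : ℂ × ℂ).2 ≠ 0 :=
        (show ContinuousAt (fun w : trigonalCurve => (w : ℂ × ℂ).2) z by fun_prop).eventually_ne h
      refine tendsto_of_tendsto_aff ?_ ?_ ?_
      · rw [Function.comp_apply, flip_coe_of_ne h]
        exact OnePoint.coe_ne_infty _
      · filter_upwards [hne] with w hw
        rw [Function.comp_apply, flip_coe_of_ne hw]
        exact OnePoint.coe_ne_infty _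
      · have h1 : ContinuousAt (fun w : trigonalCurve => flipFun w) z := by
          refine ContinuousAt.prodMk ?_ ?_
          · exact ContinuousAt.div (by fun_prop) (by fun_prop) (pow_ne_zero 2 h)
          · exact ContinuousAt.div (by fun_prop) (by fun_prop) h
        rw [Function.comp_apply, flip_coe_of_ne h, aff_coe]
        refine h1.tendsto.congr' ?_
        filter_upwards [hne] with w hw
        rw [Function.comp_apply, flip_coe_of_ne hw]
        rfl

/-- The involution as a homeomorphism. -/
def flipHomeomorph : TrigonalModel ≃ₜ TrigonalModel where
  toFun := flip
  invFun := flip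
  left_inv := flip_flip
  right_inv := flip_flip
  continuous_toFun := continuous_flip
  continuous_invFun := continuous_flip

end TrigonalModel

/-! ### Holomorphic charts -/

theorem exists_openPartialHomeomorph_of_deriv_ne_zero {P : ℂ → ℂ} (hP : ContDiff ℂ 1 P) {a : ℂ}
    (ha : deriv P a ≠ 0) : ∃ e : OpenPartialHomeomorph ℂ ℂ, a ∈ e.source ∧ (∀ z, e z = P z) ∧
      DifferentiableOn ℂ e.symm e.target := by
  have hs : HasStrictDerivAt P (deriv P a) a := hP.contDiffAt.hasStrictDerivAt one_ne_zero
  have hs' := hs.hasStrictFDerivAt_equiv ha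
  have hopen : IsOpen {z | deriv P z ≠ 0} :=
    isOpen_ne_fun (hP.continuous_deriv le_rfl) continuous_const
  refine ⟨(hs'.toOpenPartialHomeomorph P).restrOpen _ hopen,
    ⟨hs'.mem_toOpenPartialHomeomorph_source, ha⟩, fun z => rfl, fun y hy => ?_⟩
  set e := (hs'.toOpenPartialHomeomorph P).restrOpen _ hopen
  have h1 : e.symm y ∈ e.source := e.map_target hy
  have h2 : deriv P (e.symm y) ≠ 0 := h1.2
  have h3 := e.hasDerivAt_symm hy h2 (hP.differentiable one_ne_zero _).hasDerivAt
  exact h3.differentiableAt.differentiableWithinAt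

theorem differentiableAt_div {F G : ℂ × ℂ → ℂ} {z : ℂ × ℂ} (hF : DifferentiableAt ℂ F z)
    (hG : DifferentiableAt ℂ G z) (h : G z ≠ 0) : DifferentiableAt ℂ (fun z => F z / G z) z := by
  simp only [div_eq_mul_inv]
  exact hF.mul ((differentiableAt_inv h).comp z hG)

namespace TrigonalModel

/-- A chart of the affine part of the curve, given by a holomorphic function of the coordinates
`(q, r)`, in which `(q, r)` is holomorphic. -/
structure IsAffineChart (e : OpenPartialHomeomorph TrigonalModel ℂ) : Prop where
  ne_infty : ∀ m ∈ e.source, m ≠ OnePoint.infty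
  differentiableOn : DifferentiableOn ℂ (fun t => aff (e.symm t)) e.target
  exists_eq : ∃ c : ℂ × ℂ → ℂ, Differentiable ℂ c ∧ ∀ m ∈ e.source, e m = c (aff m)

/-- The point of the model with given affine coordinates; junk value `∞` off the curve. -/
def mk (z : ℂ × ℂ) : TrigonalModel :=
  open Classical in if h : z ∈ trigonalCurve then ((⟨z, h⟩ : trigonalCurve) : TrigonalModel)
    else OnePoint.infty

theorem aff_mk {z : ℂ × ℂ} (h : z ∈ trigonalCurve) : aff (mk z) = z := by
  rw [mk, dif_pos h, aff_coe]

theorem mk_ne_infty {z : ℂ × ℂ} (h : z ∈ trigonalCurve) : mk z ≠ OnePoint.infty := by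
  rw [mk, dif_pos h]
  exact OnePoint.coe_ne_infty _

theorem mk_aff {m : TrigonalModel} (h : m ≠ OnePoint.infty) : mk (aff m) = m :=
  aff_injective (mk_ne_infty (aff_mem h)) h (aff_mk (aff_mem h))

/-- The chart of the curve given by a coordinate function `c` and a holomorphic parametrization
`g` inverse to it. -/
theorem exists_isAffineChart_of_param {c : ℂ × ℂ → ℂ} (hc : Differentiable ℂ c) {g : ℂ → ℂ × ℂ}
    {S : Set (ℂ × ℂ)} {T : Set ℂ} (hS : IsOpen S) (hT : IsOpen T) (hg : DifferentiableOn ℂ g T)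
    (h1 : ∀ z ∈ trigonalCurve, z ∈ S → c z ∈ T ∧ g (c z) = z)
    (h2 : ∀ t ∈ T, g t ∈ trigonalCurve ∧ g t ∈ S ∧ c (g t) = t) :
    ∃ e : OpenPartialHomeomorph TrigonalModel ℂ, IsAffineChart e ∧
      e.source = {m | m ≠ OnePoint.infty ∧ aff m ∈ S} := by
  let e : OpenPartialHomeomorph TrigonalModel ℂ :=
    { toFun := fun m => c (aff m)
      invFun := fun t => mk (g t)
      source := {m | m ≠ OnePoint.infty ∧ aff m ∈ S}
      target := T
      map_source' := fun m hm => (h1 _ (aff_mem hm.1) hm.2).1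
      map_target' := fun t ht =>
        ⟨mk_ne_infty (h2 t ht).1, by rw [aff_mk (h2 t ht).1]; exact (h2 t ht).2.1⟩
      left_inv' := fun m hm => by
        rw [(h1 _ (aff_mem hm.1) hm.2).2, mk_aff hm.1]
      right_inv' := fun t ht => by
        rw [aff_mk (h2 t ht).1, (h2 t ht).2.2]
      open_source := by
        refine isOpen_iff_mem_nhds.2 fun m hm => ?_
        filter_upwards [eventually_ne_infty hm.1,
          (continuousAt_aff hm.1).eventually (hS.mem_nhds hm.2)] with m' h1 h2 using ⟨h1, h2⟩
      open_target := hT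
      continuousOn_toFun := fun m hm =>
        (hc.continuous.continuousAt.comp (continuousAt_aff hm.1)).continuousWithinAt
      continuousOn_invFun := fun t ht => by
        refine tendsto_of_tendsto_aff (mk_ne_infty (h2 t ht).1) ?_ ?_
        · filter_upwards [self_mem_nhdsWithin] with t' ht' using mk_ne_infty (h2 t' ht').1
        · rw [aff_mk (h2 t ht).1]
          refine (hg.continuousOn t ht).tendsto.congr' ?_
          filter_upwards [self_mem_nhdsWithin] with t' ht' using (aff_mk (h2 t' ht').1).symm }
  refine ⟨e, ⟨fun m hm => hm.1, ?_, c, hc, fun m hm => rfl⟩, rfl⟩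
  exact hg.congr fun t ht => aff_mk (h2 t ht).1

theorem exists_isAffineChart {m : TrigonalModel} (hm : m ≠ OnePoint.infty) :
    ∃ e, IsAffineChart e ∧ m ∈ e.source := by
  have hcurve := aff_mem hm
  by_cases hq : (aff m).1 = 0
  · -- The polynomial `r ^ 5 - r` has simple roots, so `q` is a local coordinate at its roots.
    obtain ⟨e, he, heP, hed⟩ := exists_openPartialHomeomorph_of_deriv_ne_zero
      (P := fun r : ℂ => r ^ 5 - r) (a := (aff m).2) (by fun_prop) (by
        have hd : HasDerivAt (fun r : ℂ => r ^ 5 - r) (5 * (aff m).2 ^ 4 - 1) (aff m).2 := by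
          simpa using (hasDerivAt_pow 5 (aff m).2).fun_sub (hasDerivAt_id' _)
        rw [hd.deriv]
        intro h0
        rw [hq] at hcurve
        have h5 : (aff m).2 * ((aff m).2 ^ 4 - 1) = 0 := by linear_combination -hcurve
        rcases mul_eq_zero.1 h5 with h | h
        · rw [h] at h0; norm_num at h0
        · have : (4 : ℂ) = 0 := by linear_combination h0 - 5 * h
          norm_num at this)
    obtain ⟨E, hE, hEs⟩ := exists_isAffineChart_of_param (c := Prod.fst) (by fun_prop)
      (g := fun q => (q, e.symm (q ^ 3))) (S := Prod.snd ⁻¹' e.source)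
      (T := (fun q => q ^ 3) ⁻¹' e.target) (e.open_source.preimage continuous_snd)
      (e.open_target.preimage (by fun_prop))
      (differentiableOn_id.prodMk (hed.comp (by fun_prop) fun q hq => hq))
      (fun z hz hzS => by
        have h : z.1 ^ 3 = e z.2 := by rw [heP]; exact hz
        refine ⟨?_, ?_⟩
        · rw [mem_preimage, h]; exact e.map_source hzS
        · rw [h, e.left_inv hzS])
      (fun q hq => by
        refine ⟨?_, e.map_target hq, rfl⟩
        have := e.right_inv hq
        rw [heP] at this
        exact this.symm)
    exact ⟨E, hE, by rw [hEs]; exact ⟨hm, he⟩⟩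
  · obtain ⟨e, he, heP, hed⟩ := exists_openPartialHomeomorph_of_deriv_ne_zero
      (P := fun q : ℂ => q ^ 3) (a := (aff m).1) (by fun_prop) (by simpa using hq)
    obtain ⟨E, hE, hEs⟩ := exists_isAffineChart_of_param (c := Prod.snd) (by fun_prop)
      (g := fun r => (e.symm (r ^ 5 - r), r)) (S := Prod.fst ⁻¹' e.source)
      (T := (fun r => r ^ 5 - r) ⁻¹' e.target) (e.open_source.preimage continuous_fst)
      (e.open_target.preimage (by fun_prop))
      ((hed.comp (f := fun r : ℂ => r ^ 5 - r) (by fun_prop) fun r hr => hr).prodMk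
        differentiableOn_id)
      (fun z hz hzS => by
        have h : z.2 ^ 5 - z.2 = e z.1 := by rw [heP]; exact hz.symm
        refine ⟨?_, ?_⟩
        · rw [mem_preimage, h]; exact e.map_source hzS
        · rw [h, e.left_inv hzS])
      (fun r hr => by
        refine ⟨?_, e.map_target hr, rfl⟩
        have := e.right_inv hr
        rw [heP] at this
        exact this)
    exact ⟨E, hE, by rw [hEs]; exact ⟨hm, he⟩⟩

/-- The affine charts and their images under the involution. -/
def charts : Set (OpenPartialHomeomorph TrigonalModel ℂ) :=
  {e | IsAffineChart e} ∪
    {e | ∃ e', IsAffineChart e' ∧ e = flipHomeomorph.transOpenPartialHomeomorph e'}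

theorem exists_mem_charts (m : TrigonalModel) : ∃ e ∈ charts, m ∈ e.source := by
  by_cases hm : m = OnePoint.infty
  · obtain ⟨e, he, hme⟩ := exists_isAffineChart (OnePoint.coe_ne_infty origin)
    refine ⟨_, Or.inr ⟨e, he, rfl⟩, ?_⟩
    rw [hm]
    exact hme
  · obtain ⟨e, he, hme⟩ := exists_isAffineChart hm
    exact ⟨e, Or.inl he, hme⟩

theorem IsAffineChart.differentiableAt_aff {e : OpenPartialHomeomorph TrigonalModel ℂ}
    (he : IsAffineChart e) {t : ℂ} (ht : t ∈ e.target) :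
    DifferentiableAt ℂ (fun t => aff (e.symm t)) t :=
  (he.differentiableOn t ht).differentiableAt (e.open_target.mem_nhds ht)

theorem differentiableAt_flipFun {z : ℂ × ℂ} (h : z.2 ≠ 0) : DifferentiableAt ℂ flipFun z := by
  exact DifferentiableAt.prodMk
    (differentiableAt_div differentiableAt_fst.neg (differentiableAt_snd.fun_pow 2)
      (pow_ne_zero 2 h))
    (differentiableAt_div (differentiableAt_const 1) differentiableAt_snd h)

theorem IsAffineChart.differentiableAt_aff_flip {e : OpenPartialHomeomorph TrigonalModel ℂ}
    (he : IsAffineChart e) {t : ℂ} (ht : t ∈ e.target) (hf : flip (e.symm t) ≠ OnePoint.infty) :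
    DifferentiableAt ℂ (fun t => aff (flip (e.symm t))) t := by
  have h1 := flip_ne_infty (he.ne_infty _ (e.map_target ht)) hf
  have h2 := (differentiableAt_flipFun h1.1).comp t (he.differentiableAt_aff ht)
  refine h2.congr_of_eventuallyEq ?_
  have h3 : ContinuousAt (fun t => flip (e.symm t)) t :=
    continuous_flip.continuousAt.comp (e.continuousAt_symm ht)
  filter_upwards [e.open_target.mem_nhds ht, h3.eventually (eventually_ne_infty hf)] with t' h4 h5
  exact (flip_ne_infty (he.ne_infty _ (e.map_target h4)) h5).2

theorem IsAffineChart.differentiableAt_of_aff {e : OpenPartialHomeomorph TrigonalModel ℂ}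
    (he : IsAffineChart e) {G : ℂ → TrigonalModel} {t : ℂ} (ht : G t ∈ e.source)
    (hG : ContinuousAt G t) (hd : DifferentiableAt ℂ (fun t => aff (G t)) t) :
    DifferentiableAt ℂ (fun t => e (G t)) t := by
  obtain ⟨c, hc, hec⟩ := he.exists_eq
  refine ((hc _).comp t hd).congr_of_eventuallyEq ?_
  filter_upwards [hG.eventually (e.open_source.mem_nhds ht)] with t' h
  exact hec _ h

/-- In every chart, the coordinates `(q, r)` are holomorphic off the point at infinity, and their
images under the involution are holomorphic off the origin. -/
theorem differentiableAt_aff_of_mem_charts {e : OpenPartialHomeomorph TrigonalModel ℂ}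
    (he : e ∈ charts) {t : ℂ} (ht : t ∈ e.target) :
    (e.symm t ≠ OnePoint.infty → DifferentiableAt ℂ (fun t => aff (e.symm t)) t) ∧
    (flip (e.symm t) ≠ OnePoint.infty → DifferentiableAt ℂ (fun t => aff (flip (e.symm t))) t) := by
  rcases he with he | ⟨e', he', rfl⟩
  · exact ⟨fun _ => he.differentiableAt_aff ht, he.differentiableAt_aff_flip ht⟩
  · have h : ∀ t, (flipHomeomorph.transOpenPartialHomeomorph e').symm t = flip (e'.symm t) :=
      fun _ => rfl
    simp only [h, flip_flip]
    exact ⟨he'.differentiableAt_aff_flip ht, fun _ => he'.differentiableAt_aff ht⟩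

theorem differentiableOn_of_mem_charts {e e' : OpenPartialHomeomorph TrigonalModel ℂ}
    (he : e ∈ charts) (he' : e' ∈ charts) {t : ℂ} (ht : t ∈ e.target) (ht' : e.symm t ∈ e'.source) :
    DifferentiableAt ℂ (fun t => e' (e.symm t)) t := by
  have h := differentiableAt_aff_of_mem_charts he ht
  have hc := e.continuousAt_symm ht
  rcases he' with he' | ⟨e₁, he₁, rfl⟩
  · exact he'.differentiableAt_of_aff ht' hc (h.1 (he'.ne_infty _ ht'))
  · exact he₁.differentiableAt_of_aff (G := fun t => flip (e.symm t)) ht'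
      (continuous_flip.continuousAt.comp hc) (h.2 (he₁.ne_infty _ ht'))

end TrigonalModel

open TrigonalModel in
/-- A space homeomorphic to the model carries a complex structure for which all functions are
holomorphic that are locally holomorphic functions of `(q, r)`, or of the image of `(q, r)` under
the involution. -/
theorem exists_chartedSpace_of_homeomorph {S : Type*} [TopologicalSpace S]
    (Ψ : S ≃ₜ TrigonalModel) :
    ∃ (_ : ChartedSpace ℂ S) (_ : IsManifold 𝓘(ℂ) ω S), ∀ (f : S → ℂ) (s : S),
      (∃ F : ℂ × ℂ → ℂ,
        (Ψ s ≠ OnePoint.infty ∧ DifferentiableAt ℂ F (aff (Ψ s)) ∧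
          f =ᶠ[𝓝 s] fun s' => F (aff (Ψ s'))) ∨
        (flip (Ψ s) ≠ OnePoint.infty ∧ DifferentiableAt ℂ F (aff (flip (Ψ s))) ∧
          f =ᶠ[𝓝 s] fun s' => F (aff (flip (Ψ s'))))) →
      MDifferentiableAt 𝓘(ℂ) 𝓘(ℂ) f s := by
  choose ch hch hmem using fun s : S => exists_mem_charts (Ψ s)
  let E : OpenPartialHomeomorph TrigonalModel ℂ → OpenPartialHomeomorph S ℂ :=
    Ψ.transOpenPartialHomeomorph
  have hE : ∀ e t, (E e).symm t = Ψ.symm (e.symm t) := fun _ _ => rfl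
  have hE' : ∀ e s, E e s = e (Ψ s) := fun _ _ => rfl
  let cs : ChartedSpace ℂ S :=
    { atlas := E '' charts
      chartAt := fun s => E (ch s)
      mem_chart_source := fun s => hmem s
      chart_mem_atlas := fun s => ⟨_, hch s, rfl⟩ }
  refine ⟨cs, isManifold_of_contDiffOn 𝓘(ℂ) ω S ?_, ?_⟩
  · rintro _ _ ⟨e, he, rfl⟩ ⟨e', he', rfl⟩
    simp only [mfld_simps]
    refine DifferentiableOn.contDiffOn (fun t ht => ?_) ?_
    · have := differentiableOn_of_mem_charts he he' (t := t) ht.1 (by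
        have := ht.2
        simpa [E] using this)
      refine DifferentiableAt.differentiableWithinAt ?_
      refine this.congr_of_eventuallyEq (Eventually.of_forall fun t' => ?_)
      simp [hE, hE']
    · exact ((E e).symm.trans (E e')).open_source
  · rintro f s ⟨F, hF⟩
    have hs : (ch s) (Ψ s) ∈ (ch s).target := (ch s).map_source (hmem s)
    have hinv : (ch s).symm ((ch s) (Ψ s)) = Ψ s := (ch s).left_inv (hmem s)
    have hd := differentiableAt_aff_of_mem_charts (hch s) hs
    have hcont : ContinuousAt (fun t => Ψ.symm ((ch s).symm t)) ((ch s) (Ψ s)) :=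
      Ψ.symm.continuous.continuousAt.comp ((ch s).continuousAt_symm hs)
    rw [hinv] at hd
    have hlift : ∀ G : S → ℂ × ℂ, DifferentiableAt ℂ F (G s) → ContinuousAt G s →
        DifferentiableAt ℂ (fun t => G (Ψ.symm ((ch s).symm t))) ((ch s) (Ψ s)) →
        f =ᶠ[𝓝 s] (fun s' => F (G s')) → MDifferentiableAt 𝓘(ℂ) 𝓘(ℂ) f s := by
      intro G hFG hG hGd hfG
      rw [mdifferentiableAt_iff]
      refine ⟨(hFG.continuousAt.comp hG).congr hfG.symm, ?_⟩
      simp only [mfld_simps, differentiableWithinAt_univ]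
      have hpt : Ψ.symm ((ch s).symm ((ch s) (Ψ s))) = s := by rw [hinv, Ψ.symm_apply_apply]
      have h1 : DifferentiableAt ℂ (fun t => F (G (Ψ.symm ((ch s).symm t)))) ((ch s) (Ψ s)) := by
        refine DifferentiableAt.comp (g := F) _ ?_ hGd
        rwa [hpt]
      refine h1.congr_of_eventuallyEq ?_
      have h2 : Tendsto (fun t => Ψ.symm ((ch s).symm t)) (𝓝 ((ch s) (Ψ s))) (𝓝 s) := by
        have := hcont.tendsto
        rwa [hpt] at this
      exact h2.eventually hfG
    rcases hF with ⟨hne, hFd, hfF⟩ | ⟨hne, hFd, hfF⟩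
    · refine hlift (fun s => aff (Ψ s)) hFd
        (ContinuousAt.comp (g := aff) (continuousAt_aff hne) Ψ.continuous.continuousAt) ?_ hfF
      simpa using hd.1 hne
    · refine hlift (fun s => aff (flip (Ψ s))) hFd
        (ContinuousAt.comp (g := aff) (continuousAt_aff hne)
          (continuous_flip.comp Ψ.continuous).continuousAt) ?_ hfF
      simpa using hd.2 hne

/-! ### Quotients of holomorphic functions as maps to the sphere -/

/-- The point `a / b` of the Riemann sphere, to be used for `(a, b) ≠ (0, 0)`. -/
def sphereRatio (a b : ℂ) : OnePoint ℂ :=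
  open Classical in if b = 0 then OnePoint.infty else ((a / b : ℂ) : OnePoint ℂ)

theorem sphereRatio_zero (a : ℂ) : sphereRatio a 0 = OnePoint.infty := if_pos rfl

theorem sphereRatio_of_ne (a : ℂ) {b : ℂ} (hb : b ≠ 0) :
    sphereRatio a b = ((a / b : ℂ) : OnePoint ℂ) := if_neg hb

theorem sphereRatio_eq_infty_iff {a b : ℂ} : sphereRatio a b = OnePoint.infty ↔ b = 0 := by
  refine ⟨fun h => ?_, fun h => by rw [h, sphereRatio_zero]⟩
  by_contra hb
  rw [sphereRatio_of_ne a hb] at h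
  exact OnePoint.coe_ne_infty _ h

theorem sphereRatio_eq_coe_iff {a b w : ℂ} :
    sphereRatio a b = (w : OnePoint ℂ) ↔ b ≠ 0 ∧ a = w * b := by
  by_cases hb : b = 0
  · rw [hb, sphereRatio_zero]
    simp
  · rw [sphereRatio_of_ne a hb, OnePoint.coe_eq_coe, div_eq_iff hb]
    simp [hb]

theorem sphereRatio_mul {c : ℂ} (hc : c ≠ 0) (a b : ℂ) :
    sphereRatio (c * a) (c * b) = sphereRatio a b := by
  by_cases hb : b = 0
  · rw [hb, mul_zero, sphereRatio_zero, sphereRatio_zero]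
  · rw [sphereRatio_of_ne _ hb, sphereRatio_of_ne _ (mul_ne_zero hc hb), mul_div_mul_left _ _ hc]

theorem sphereCoord_sphereRatio {a b : ℂ} (hb : b ≠ 0) : sphereCoord (sphereRatio a b) = a / b := by
  rw [sphereRatio_of_ne a hb]
  rfl

theorem sphereCoordInfty_sphereRatio (a b : ℂ) : sphereCoordInfty (sphereRatio a b) = b / a := by
  by_cases hb : b = 0
  · rw [hb, sphereRatio_zero, zero_div]
    rfl
  · rw [sphereRatio_of_ne a hb]
    exact inv_div a b

theorem continuousAt_sphereRatio {z : ℂ × ℂ} (hz : z.1 ≠ 0 ∨ z.2 ≠ 0) :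
    ContinuousAt (fun z : ℂ × ℂ => sphereRatio z.1 z.2) z := by
  by_cases h : z.2 = 0
  · have h1 : z.1 ≠ 0 := hz.resolve_right (not_not.2 h)
    change Tendsto _ _ (𝓝 (sphereRatio z.1 z.2))
    rw [h, sphereRatio_zero]
    refine OnePoint.hasBasis_nhds_infty.tendsto_right_iff.2 ?_
    rintro s ⟨-, hs⟩
    obtain ⟨R, hR⟩ := hs.exists_bound_of_continuousOn (f := id) continuousOn_id
    have hc : ContinuousAt (fun w : ℂ × ℂ => ‖w.1‖ - (|R| + 1) * ‖w.2‖) z := by fun_prop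
    filter_upwards [hc.eventually (lt_mem_nhds (a := 0) (by simp [h, h1]))] with w hw
    by_cases hw2 : w.2 = 0
    · rw [hw2, sphereRatio_zero]
      exact Or.inr rfl
    · rw [sphereRatio_of_ne _ hw2]
      refine Or.inl ⟨_, fun hmem => ?_, rfl⟩
      have h2 := hR _ hmem
      rw [id, norm_div, div_le_iff₀ (norm_pos_iff.2 hw2)] at h2
      have h3 : R * ‖w.2‖ ≤ (|R| + 1) * ‖w.2‖ := by
        gcongr
        linarith [le_abs_self R]
      linarith
  · have h1 : ContinuousAt (fun w : ℂ × ℂ => ((w.1 / w.2 : ℂ) : OnePoint ℂ)) z :=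
      OnePoint.continuous_coe.continuousAt.comp
        (ContinuousAt.div (by fun_prop) (by fun_prop) h)
    refine h1.congr ?_
    filter_upwards [(continuous_snd.continuousAt (x := z)).eventually_ne h] with w hw
    exact (sphereRatio_of_ne _ hw).symm

namespace TrigonalModel

/-- A map from the model to the sphere is locally a ratio if near every point it is the quotient of
two holomorphic functions without common zeros of `(q, r)` or of the image of `(q, r)` under the
involution. -/
def IsLocallyRatio (F : TrigonalModel → OnePoint ℂ) : Prop :=
  ∀ m, ∃ (P Q : ℂ × ℂ → ℂ) (G : TrigonalModel → TrigonalModel), (G = id ∨ G = flip) ∧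
    G m ≠ OnePoint.infty ∧ DifferentiableAt ℂ P (aff (G m)) ∧ DifferentiableAt ℂ Q (aff (G m)) ∧
    (P (aff (G m)) ≠ 0 ∨ Q (aff (G m)) ≠ 0) ∧
    ∀ᶠ m' in 𝓝 m, F m' = sphereRatio (P (aff (G m'))) (Q (aff (G m')))

theorem IsLocallyRatio.continuous {F : TrigonalModel → OnePoint ℂ} (hF : IsLocallyRatio F) :
    Continuous F := by
  refine continuous_iff_continuousAt.2 fun m => ?_
  obtain ⟨P, Q, G, hG, hGm, hP, hQ, hne, hev⟩ := hF m
  have hGc : Continuous G := by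
    rcases hG with rfl | rfl
    · exact continuous_id
    · exact continuous_flip
  have h1 : ContinuousAt (fun m' => aff (G m')) m :=
    ContinuousAt.comp (g := aff) (continuousAt_aff hGm) hGc.continuousAt
  have h2 : ContinuousAt (fun m' => (P (aff (G m')), Q (aff (G m')))) m :=
    (ContinuousAt.comp (f := fun m' => aff (G m')) hP.continuousAt h1).prodMk
      (ContinuousAt.comp (f := fun m' => aff (G m')) hQ.continuousAt h1)
  exact (ContinuousAt.comp (g := fun z : ℂ × ℂ => sphereRatio z.1 z.2)
    (continuousAt_sphereRatio hne) h2).congr (hev.mono fun _ h => h.symm)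

end TrigonalModel

open TrigonalModel in
/-- A space homeomorphic to the model carries a complex structure for which the maps to the sphere
that are locally ratios are holomorphic. -/
theorem exists_chartedSpace_isHolomorphicToSphere {S : Type*} [TopologicalSpace S]
    (Ψ : S ≃ₜ TrigonalModel) :
    ∃ (_ : ChartedSpace ℂ S) (_ : IsManifold 𝓘(ℂ) ω S), ∀ F : TrigonalModel → OnePoint ℂ,
      IsLocallyRatio F → IsHolomorphicToSphere (fun s => F (Ψ s)) := by
  obtain ⟨cs, hm, H⟩ := exists_chartedSpace_of_homeomorph Ψ
  refine ⟨cs, hm, fun F hF => ⟨hF.continuous.comp Ψ.continuous, fun s hs => ?_, fun s hs => ?_⟩⟩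
  all_goals
    obtain ⟨P, Q, G, hG, hGm, hP, hQ, hne, hev⟩ := hF (Ψ s)
    have hev' : ∀ᶠ s' in 𝓝 s, F (Ψ s') = sphereRatio (P (aff (G (Ψ s')))) (Q (aff (G (Ψ s')))) :=
      Ψ.continuous.continuousAt.eventually hev
    rw [show (fun s => F (Ψ s)) s = _ from hev.self_of_nhds] at hs
  · have hQ0 : Q (aff (G (Ψ s))) ≠ 0 := fun h => hs (by rw [h, sphereRatio_zero])
    have hQ1 : ∀ᶠ s' in 𝓝 s, Q (aff (G (Ψ s'))) ≠ 0 := by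
      have hGc : Continuous G := by
        rcases hG with rfl | rfl
        · exact continuous_id
        · exact continuous_flip
      have h1 : ContinuousAt (fun s' => aff (G (Ψ s'))) s :=
        ContinuousAt.comp (g := aff) (continuousAt_aff hGm) (hGc.comp Ψ.continuous).continuousAt
      exact (ContinuousAt.comp (f := fun s' => aff (G (Ψ s'))) hQ.continuousAt h1).eventually_ne hQ0
    have hev'' : (fun t => sphereCoord (F (Ψ t))) =ᶠ[𝓝 s]
        fun s' => P (aff (G (Ψ s'))) / Q (aff (G (Ψ s'))) := by
      filter_upwards [hev', hQ1] with s' h1 h2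
      rw [h1, sphereCoord_sphereRatio h2]
    refine H _ s ⟨fun z => P z / Q z, ?_⟩
    rcases hG with rfl | rfl
    · exact Or.inl ⟨hGm, differentiableAt_div hP hQ hQ0, hev''⟩
    · exact Or.inr ⟨hGm, differentiableAt_div hP hQ hQ0, hev''⟩
  · have hP0 : P (aff (G (Ψ s))) ≠ 0 := by
      intro h
      rw [h] at hne hs
      exact hs (sphereRatio_eq_coe_iff.2 ⟨hne.resolve_left (not_not.2 rfl), by simp⟩)
    have hev'' : (fun t => sphereCoordInfty (F (Ψ t))) =ᶠ[𝓝 s]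
        fun s' => Q (aff (G (Ψ s'))) / P (aff (G (Ψ s'))) := by
      filter_upwards [hev'] with s' h1
      rw [h1, sphereCoordInfty_sphereRatio]
    refine H _ s ⟨fun z => Q z / P z, ?_⟩
    rcases hG with rfl | rfl
    · exact Or.inl ⟨hGm, differentiableAt_div hQ hP hP0, hev''⟩
    · exact Or.inr ⟨hGm, differentiableAt_div hQ hP hP0, hev''⟩

/-! ### Small punctured neighbourhoods are connected -/

theorem isConnected_ball_diff_center {c : ℂ} {ε : ℝ} (hε : 0 < ε) :
    IsConnected (Metric.ball c ε \ {c}) := by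
  have h : Metric.ball c ε \ {c} =
      (fun q : ℝ × ℝ => c + q.1 * Complex.exp (q.2 * Complex.I)) '' (Ioo 0 ε ×ˢ univ) := by
    ext z
    constructor
    · rintro ⟨hz, hzc⟩
      refine ⟨(‖z - c‖, Complex.arg (z - c)), ⟨⟨?_, ?_⟩, mem_univ _⟩, ?_⟩
      · exact norm_pos_iff.2 (sub_ne_zero.2 hzc)
      · rwa [← dist_eq_norm]
      · simp only [Complex.norm_mul_exp_arg_mul_I]
        ring
    · rintro ⟨⟨ρ, θ⟩, ⟨⟨h1, h2⟩, -⟩, rfl⟩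
      refine ⟨?_, ?_⟩
      · simp [Complex.norm_exp_ofReal_mul_I, abs_of_pos h1, h2]
      · simp [h1.ne', Complex.exp_ne_zero]
  rw [h]
  refine IsConnected.image ?_ _ (by fun_prop)
  exact (isConnected_Ioo hε).prod isConnected_univ

/-- A set with charts to `ℂ` is not locally disconnected by finitely many points. -/
theorem exists_isConnected_diff_finite {M : Type*} [TopologicalSpace M] [T1Space M] {m : M}
    {e : OpenPartialHomeomorph M ℂ} (hm : m ∈ e.source) {F : Set M} (hF : F.Finite) {W : Set M}
    (hW : W ∈ 𝓝 m) : ∃ W' ⊆ W, IsOpen W' ∧ m ∈ W' ∧ IsConnected (W' \ F) := by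
  have hN : W ∩ (F \ {m})ᶜ ∈ 𝓝 (e.symm (e m)) := by
    rw [e.left_inv hm]
    exact inter_mem hW ((hF.subset sdiff_subset).isClosed.isOpen_compl.mem_nhds fun h => h.2 rfl)
  have hN' := inter_mem ((e.continuousAt_symm (e.map_source hm)).preimage_mem_nhds hN)
    (e.open_target.mem_nhds (e.map_source hm))
  obtain ⟨ε, hε, hball⟩ := Metric.mem_nhds_iff.1 hN'
  have htarget : Metric.ball (e m) ε ⊆ e.target := fun t ht => (hball ht).2
  have hcont : ContinuousOn e.symm (Metric.ball (e m) ε) := e.continuousOn_symm.mono htarget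
  refine ⟨e.symm '' Metric.ball (e m) ε, ?_, ?_, ?_, ?_⟩
  · rintro _ ⟨t, ht, rfl⟩
    exact (hball ht).1.1
  · exact e.isOpen_image_symm_of_subset_target Metric.isOpen_ball htarget
  · exact ⟨e m, Metric.mem_ball_self hε, e.left_inv hm⟩
  · have hsub : ∀ t ∈ Metric.ball (e m) ε, e.symm t ∈ F → t = e m := by
      intro t ht htF
      have h1 : e.symm t = m := by
        by_contra hne
        exact (hball ht).1.2 ⟨htF, hne⟩
      rw [← h1, e.right_inv (htarget ht)]
    by_cases hmF : m ∈ F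
    · have : e.symm '' Metric.ball (e m) ε \ F = e.symm '' (Metric.ball (e m) ε \ {e m}) := by
        ext a
        constructor
        · rintro ⟨⟨t, ht, rfl⟩, haF⟩
          refine ⟨t, ⟨ht, fun h => haF ?_⟩, rfl⟩
          rw [show t = e m from h, e.left_inv hm]
          exact hmF
        · rintro ⟨t, ⟨ht, hne⟩, rfl⟩
          exact ⟨⟨t, ht, rfl⟩, fun h => hne (hsub t ht h)⟩
      rw [this]
      exact (isConnected_ball_diff_center hε).image _ (hcont.mono sdiff_subset)
    · have : e.symm '' Metric.ball (e m) ε \ F = e.symm '' Metric.ball (e m) ε := by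
        refine Disjoint.sdiff_eq_left (Set.disjoint_left.2 ?_)
        rintro _ ⟨t, ht, rfl⟩ h
        rw [hsub t ht h, e.left_inv hm] at h
        exact hmF h
      rw [this]
      exact ((convex_ball _ _).isConnected ⟨_, Metric.mem_ball_self hε⟩).image _ hcont

/-! ### The functions `x` and `y` on the model -/

namespace TrigonalModel

theorem finite_setOf_pow_eq {n : ℕ} (hn : 0 < n) (a : ℂ) : {z : ℂ | z ^ n = a}.Finite := by
  refine (Polynomial.nthRoots n a).toFinset.finite_toSet.subset fun z hz => ?_
  simpa [Polynomial.mem_nthRoots hn] using hz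

theorem finite_setOf_snd_pow_eq (u : ℂ) :
    {m : TrigonalModel | m = OnePoint.infty ∨ (aff m).2 ^ 4 = u}.Finite := by
  have h : {z : ℂ × ℂ | z ∈ trigonalCurve ∧ z.2 ^ 4 = u}.Finite := by
    refine ((finite_setOf_pow_eq (n := 4) (by norm_num) u).biUnion fun r _ =>
      (finite_setOf_pow_eq (n := 3) (by norm_num) (r ^ 5 - r)).image fun q => (q, r)).subset ?_
    rintro ⟨q, r⟩ ⟨h1, h2⟩
    exact mem_biUnion (show r ∈ {r : ℂ | r ^ 4 = u} from h2) ⟨q, h1, rfl⟩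
  refine ((h.image mk).union (finite_singleton OnePoint.infty)).subset ?_
  intro m hm
  by_cases hinf : m = OnePoint.infty
  · exact Or.inr hinf
  · exact Or.inl ⟨aff m, ⟨aff_mem hinf, hm.resolve_left hinf⟩, mk_aff hinf⟩

variable (p : Fin 3 → ℂ)

/-- The value at `x = ∞` of the Möbius transformation `u` of `x` which takes the values `0, 1, ∞` at
`p 0, p 1, p 2`. -/
def lam : ℂ := (p 1 - p 2) / (p 1 - p 0)

/-- The Möbius transformation with values `p 0, p 1, p 2` at `0, 1, ∞`. -/
def mobius (u : ℂ) : OnePoint ℂ := sphereRatio (lam p * p 0 - u * p 2) (lam p - u)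

/-- The projection of the model to the sphere, the Möbius transform of `r ^ 4`. -/
def xMap (m : TrigonalModel) : OnePoint ℂ :=
  m.elim (p 2 : OnePoint ℂ) (fun z => mobius p ((z : ℂ × ℂ).2 ^ 4))

/-- A constant which normalizes the function `y`. -/
def kappa : ℂ :=
  ((p 2 - p 0) * (p 2 - p 1) ^ 4 * (lam p * (p 2 - p 0)) ^ 7) ^ (((12 : ℕ) : ℂ)⁻¹)

/-- The function `y` on the model, a multiple of `q / (r ^ 4 - λ)`. -/
def yMap (m : TrigonalModel) : OnePoint ℂ :=
  m.elim ((0 : ℂ) : OnePoint ℂ)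
    (fun z => sphereRatio (kappa p * (z : ℂ × ℂ).1) ((z : ℂ × ℂ).2 ^ 4 - lam p))

variable {p}

theorem xMap_infty : xMap p OnePoint.infty = (p 2 : OnePoint ℂ) := rfl

theorem yMap_infty : yMap p OnePoint.infty = ((0 : ℂ) : OnePoint ℂ) := rfl

theorem xMap_of_ne {m : TrigonalModel} (hm : m ≠ OnePoint.infty) :
    xMap p m = mobius p ((aff m).2 ^ 4) := by
  obtain ⟨z, rfl⟩ := OnePoint.ne_infty_iff_exists.1 hm
  rfl

theorem yMap_of_ne {m : TrigonalModel} (hm : m ≠ OnePoint.infty) :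
    yMap p m = sphereRatio (kappa p * (aff m).1) ((aff m).2 ^ 4 - lam p) := by
  obtain ⟨z, rfl⟩ := OnePoint.ne_infty_iff_exists.1 hm
  rfl

theorem kappa_pow : kappa p ^ 12 =
    (p 2 - p 0) * (p 2 - p 1) ^ 4 * (lam p * (p 2 - p 0)) ^ 7 :=
  Complex.cpow_nat_inv_pow _ (by norm_num)

theorem sub_ne (hp : Function.Injective p) {j k : Fin 3} (h : j ≠ k) : p j - p k ≠ 0 :=
  sub_ne_zero.2 (hp.ne h)

theorem lam_mul (hp : Function.Injective p) : lam p * (p 1 - p 0) = p 1 - p 2 :=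
  div_mul_cancel₀ _ (sub_ne hp (by decide))

theorem lam_ne_zero (hp : Function.Injective p) : lam p ≠ 0 :=
  div_ne_zero (sub_ne hp (by decide)) (sub_ne hp (by decide))

theorem lam_ne_one (hp : Function.Injective p) : lam p ≠ 1 := by
  intro h
  have h1 := lam_mul hp
  rw [h] at h1
  exact sub_ne hp (j := 0) (k := 2) (by decide) (by linear_combination -h1)

theorem kappa_ne_zero (hp : Function.Injective p) : kappa p ≠ 0 := by
  intro h
  have := kappa_pow (p := p)
  rw [h, zero_pow (by norm_num)] at this
  exact mul_ne_zero (mul_ne_zero (sub_ne hp (by decide)) (pow_ne_zero 4 (sub_ne hp (by decide))))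
    (pow_ne_zero 7 (mul_ne_zero (lam_ne_zero hp) (sub_ne hp (by decide)))) this.symm

theorem mobius_eq_coe_iff (hp : Function.Injective p) {u w : ℂ} :
    mobius p u = (w : OnePoint ℂ) ↔ lam p * (w - p 0) = u * (w - p 2) := by
  rw [mobius, sphereRatio_eq_coe_iff]
  constructor
  · rintro ⟨-, h⟩
    linear_combination -h
  · intro h
    refine ⟨fun h0 => ?_, by linear_combination -h⟩
    refine mul_ne_zero (lam_ne_zero hp) (sub_ne hp (j := 2) (k := 0) (by decide)) ?_
    linear_combination h - (w - p 2) * h0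

theorem mobius_eq_infty_iff {u : ℂ} : mobius p u = OnePoint.infty ↔ u = lam p := by
  rw [mobius, sphereRatio_eq_infty_iff, sub_eq_zero, eq_comm]

theorem mobius_ne (hp : Function.Injective p) {u : ℂ} : mobius p u ≠ (p 2 : OnePoint ℂ) := by
  intro h
  rw [mobius_eq_coe_iff hp] at h
  refine mul_ne_zero (lam_ne_zero hp) (sub_ne hp (j := 2) (k := 0) (by decide)) ?_
  linear_combination h

theorem mobius_injective (hp : Function.Injective p) : Function.Injective (mobius p) := by
  intro u u' h
  induction hu : mobius p u using OnePoint.rec with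
  | infty =>
    rw [mobius_eq_infty_iff.1 hu, mobius_eq_infty_iff.1 (h.symm.trans hu)]
  | coe w =>
    have hw : w - p 2 ≠ 0 := by
      intro h0
      rw [sub_eq_zero.1 h0] at hu
      exact mobius_ne hp hu
    have h1 := (mobius_eq_coe_iff hp).1 hu
    have h2 := (mobius_eq_coe_iff hp).1 (h.symm.trans hu)
    exact mul_right_cancel₀ hw (h1.symm.trans h2)

theorem xMap_eq_p2_iff (hp : Function.Injective p) {m : TrigonalModel} :
    xMap p m = (p 2 : OnePoint ℂ) ↔ m = OnePoint.infty := by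
  refine ⟨fun h => ?_, fun h => by rw [h, xMap_infty]⟩
  by_contra hm
  rw [xMap_of_ne hm] at h
  exact mobius_ne hp h

theorem finite_xMap_fiber (hp : Function.Injective p) (z : OnePoint ℂ) :
    (xMap p ⁻¹' {z}).Finite := by
  by_cases h : ∃ u, mobius p u = z
  · obtain ⟨u, rfl⟩ := h
    refine (finite_setOf_snd_pow_eq u).subset fun m hm => ?_
    by_cases hinf : m = OnePoint.infty
    · exact Or.inl hinf
    · refine Or.inr (mobius_injective hp ?_)
      rw [← xMap_of_ne hinf]
      exact hm
  · refine (finite_setOf_snd_pow_eq 0).subset fun m hm => Or.inl ?_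
    by_contra hinf
    exact h ⟨_, (xMap_of_ne hinf).symm.trans hm⟩

theorem fst_ne_zero {m : TrigonalModel} (hm : m ≠ OnePoint.infty) (h0 : (aff m).2 ≠ 0)
    (h1 : (aff m).2 ^ 4 ≠ 1) : (aff m).1 ≠ 0 := by
  intro h
  have := aff_mem hm
  rw [h] at this
  refine mul_ne_zero h0 (sub_ne_zero.2 h1) ?_
  linear_combination -this

/-- Near the point at infinity the involution is given by its formula, except at that point. -/
theorem eventually_flip : ∀ᶠ m in 𝓝 (OnePoint.infty : TrigonalModel), m = OnePoint.infty ∨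
    m ≠ OnePoint.infty ∧ (aff m).2 ≠ 0 ∧ aff (flip m) = flipFun (aff m) := by
  filter_upwards [continuous_flip.continuousAt.eventually
    (eventually_ne_infty (m := flip OnePoint.infty) (OnePoint.coe_ne_infty _))] with m hm
  by_cases hinf : m = OnePoint.infty
  · exact Or.inl hinf
  · exact Or.inr ⟨hinf, flip_ne_infty hinf hm⟩

theorem isLocallyRatio_xMap (hp : Function.Injective p) : IsLocallyRatio (xMap p) := by
  intro m
  by_cases hm : m = OnePoint.infty
  · refine ⟨fun z => lam p * p 0 * z.2 ^ 4 - p 2, fun z => lam p * z.2 ^ 4 - 1, flip, Or.inr rfl,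
      ?_, by fun_prop, by fun_prop, Or.inr ?_, ?_⟩
    · rw [hm]; exact OnePoint.coe_ne_infty _
    · rw [hm, flip_infty]
      simp [origin]
    · rw [hm]
      filter_upwards [eventually_flip] with m' hm'
      rcases hm' with rfl | ⟨hne, hr, hflip⟩
      · rw [flip_infty, xMap_infty]
        symm
        rw [sphereRatio_eq_coe_iff]
        simp [origin]
      · rw [xMap_of_ne hne, hflip, mobius]
        refine Eq.trans ?_ (sphereRatio_mul (pow_ne_zero 4 hr) _ _)
        simp only [flipFun]
        congr 1 <;> field_simp
  · refine ⟨fun z => lam p * p 0 - z.2 ^ 4 * p 2, fun z => lam p - z.2 ^ 4, id, Or.inl rfl,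
      hm, by fun_prop, by fun_prop, ?_, ?_⟩
    · by_contra! h
      refine mul_ne_zero (lam_ne_zero hp) (sub_ne hp (j := 0) (k := 2) (by decide)) ?_
      linear_combination h.1 - p 2 * h.2
    · filter_upwards [eventually_ne_infty hm] with m' hm'
      exact xMap_of_ne hm'

theorem isLocallyRatio_yMap (hp : Function.Injective p) : IsLocallyRatio (yMap p) := by
  intro m
  by_cases hm : m = OnePoint.infty
  · refine ⟨fun z => -kappa p * z.1 * z.2 ^ 2, fun z => 1 - lam p * z.2 ^ 4, flip, Or.inr rfl,
      ?_, by fun_prop, by fun_prop, Or.inr ?_, ?_⟩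
    · rw [hm]; exact OnePoint.coe_ne_infty _
    · rw [hm, flip_infty]
      simp [origin]
    · rw [hm]
      filter_upwards [eventually_flip] with m' hm'
      rcases hm' with rfl | ⟨hne, hr, hflip⟩
      · rw [flip_infty, yMap_infty]
        symm
        rw [sphereRatio_eq_coe_iff]
        simp [origin]
      · rw [yMap_of_ne hne, hflip]
        refine Eq.trans ?_ (sphereRatio_mul (pow_ne_zero 4 hr) _ _)
        simp only [flipFun]
        congr 1 <;> field_simp
  · refine ⟨fun z => kappa p * z.1, fun z => z.2 ^ 4 - lam p, id, Or.inl rfl,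
      hm, by fun_prop, by fun_prop, ?_, ?_⟩
    · by_contra! h
      have hu : (aff m).2 ^ 4 = lam p := sub_eq_zero.1 h.2
      refine mul_ne_zero (kappa_ne_zero hp) (fst_ne_zero hm ?_ ?_) h.1
      · intro h0
        rw [h0, zero_pow (by norm_num)] at hu
        exact lam_ne_zero hp hu.symm
      · rw [hu]
        exact lam_ne_one hp
    · filter_upwards [eventually_ne_infty hm] with m' hm'
      exact yMap_of_ne hm'

theorem continuous_xMap (hp : Function.Injective p) : Continuous (xMap p) :=
  (isLocallyRatio_xMap hp).continuous

theorem yMap_eq_coe_iff {m : TrigonalModel} (hm : m ≠ OnePoint.infty) {b : ℂ} :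
    yMap p m = (b : OnePoint ℂ) ↔
      (aff m).2 ^ 4 ≠ lam p ∧ kappa p * (aff m).1 = b * ((aff m).2 ^ 4 - lam p) := by
  rw [yMap_of_ne hm, sphereRatio_eq_coe_iff, sub_ne_zero]

theorem pow_mul_collect (a b c w : ℂ) :
    a * w * (b * w) ^ 4 * (c * w) ^ 7 = a ^ 1 * b ^ 4 * c ^ 7 * w ^ 12 := by ring

theorem pow_mul_rearrange (a b c u v : ℂ) :
    a * b ^ 4 * c ^ 7 * (u * v ^ 4) = u * a * (b * v) ^ 4 * c ^ 7 := by ring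

/-- `y ^ 12 = (x - p 0) (x - p 1) ^ 4 (x - p 2) ^ 7` holds on the model, as
`q ^ 12 = r ^ 4 (r ^ 4 - 1) ^ 4`. -/
theorem equation (hp : Function.Injective p) {m : TrigonalModel} {a b : ℂ}
    (ha : xMap p m = (a : OnePoint ℂ))
    (hb : yMap p m = (b : OnePoint ℂ)) :
    b ^ 12 = (a - p 0) ^ 1 * (a - p 1) ^ 4 * (a - p 2) ^ 7 := by
  by_cases hm : m = OnePoint.infty
  · rw [hm, xMap_infty, OnePoint.coe_eq_coe] at ha
    rw [hm, yMap_infty, OnePoint.coe_eq_coe] at hb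
    rw [← ha, ← hb]
    simp
  · have hcurve := aff_mem hm
    rw [xMap_of_ne hm, mobius_eq_coe_iff hp] at ha
    rw [yMap_eq_coe_iff hm] at hb
    obtain ⟨hu, hb⟩ := hb
    have hκ := kappa_pow (p := p)
    have hlam := lam_mul hp
    set u := (aff m).2 ^ 4 with hudef
    have hq : (aff m).1 ^ 12 = u * (u - 1) ^ 4 := by
      rw [show (aff m).1 ^ 12 = ((aff m).1 ^ 3) ^ 4 by ring, hcurve]
      ring
    have hu' : u - lam p ≠ 0 := sub_ne_zero.2 hu
    have h0 : (a - p 0) * (u - lam p) = u * (p 2 - p 0) := by linear_combination -ha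
    have h1 : (a - p 1) * (u - lam p) = (p 2 - p 1) * (u - 1) := by
      linear_combination -ha + hlam
    have h2 : (a - p 2) * (u - lam p) = lam p * (p 2 - p 0) := by linear_combination -ha
    refine mul_right_cancel₀ (pow_ne_zero 12 hu') ?_
    calc b ^ 12 * (u - lam p) ^ 12 = kappa p ^ 12 * (aff m).1 ^ 12 := by
          rw [← mul_pow, ← hb, mul_pow]
      _ = (u * (p 2 - p 0)) * ((p 2 - p 1) * (u - 1)) ^ 4 * (lam p * (p 2 - p 0)) ^ 7 := by
          rw [hκ, hq, pow_mul_rearrange]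
      _ = _ := by
          rw [← h0, ← h1, ← h2, pow_mul_collect]

theorem exists_of_equation (hp : Function.Injective p) {a b : ℂ}
    (h : b ^ 12 = (a - p 0) ^ 1 * (a - p 1) ^ 4 * (a - p 2) ^ 7) :
    ∃ m, xMap p m = (a : OnePoint ℂ) ∧ yMap p m = (b : OnePoint ℂ) := by
  by_cases ha : a = p 2
  · refine ⟨OnePoint.infty, ?_, ?_⟩
    · rw [xMap_infty, ha]
    · rw [ha, sub_self, zero_pow (by norm_num), mul_zero] at h
      rw [yMap_infty, eq_zero_of_pow_eq_zero h]
  have ha' : a - p 2 ≠ 0 := sub_ne_zero.2 ha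
  have hκ := kappa_pow (p := p)
  have hκ0 := kappa_ne_zero hp
  have hlam := lam_mul hp
  obtain ⟨u, hu⟩ : ∃ u, lam p * (a - p 0) = u * (a - p 2) :=
    ⟨lam p * (a - p 0) / (a - p 2), by field_simp⟩
  have hul : u - lam p ≠ 0 := by
    intro h0
    refine mul_ne_zero (lam_ne_zero hp) (sub_ne hp (j := 2) (k := 0) (by decide)) ?_
    linear_combination hu + (a - p 2) * h0
  set q : ℂ := b * (u - lam p) / kappa p with hq
  have hqb : kappa p * q = b * (u - lam p) := by rw [hq]; field_simp
  have h0 : (a - p 0) * (u - lam p) = u * (p 2 - p 0) := by linear_combination -hu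
  have h1 : (a - p 1) * (u - lam p) = (p 2 - p 1) * (u - 1) := by
    linear_combination -hu + hlam
  have h2 : (a - p 2) * (u - lam p) = lam p * (p 2 - p 0) := by linear_combination -hu
  have hq12 : q ^ 12 = u * (u - 1) ^ 4 := by
    refine mul_left_cancel₀ (pow_ne_zero 12 hκ0) ?_
    calc kappa p ^ 12 * q ^ 12 = b ^ 12 * (u - lam p) ^ 12 := by rw [← mul_pow, hqb, mul_pow]
      _ = ((a - p 0) * (u - lam p)) * ((a - p 1) * (u - lam p)) ^ 4 *
          ((a - p 2) * (u - lam p)) ^ 7 := by rw [h, pow_mul_collect]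
      _ = _ := by rw [h0, h1, h2, hκ, pow_mul_rearrange]
  obtain ⟨r, hr, hqr⟩ : ∃ r : ℂ, r ^ 4 = u ∧ q ^ 3 = r ^ 5 - r := by
    by_cases hu1 : u = 1
    · refine ⟨1, by rw [hu1]; ring, ?_⟩
      rw [hu1, sub_self, zero_pow (by norm_num), mul_zero] at hq12
      rw [eq_zero_of_pow_eq_zero hq12]
      norm_num
    · have hu1' : u - 1 ≠ 0 := sub_ne_zero.2 hu1
      have hr4 : (q ^ 3 / (u - 1)) ^ 4 = u := by
        rw [div_pow, ← pow_mul, hq12]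
        field_simp
      refine ⟨q ^ 3 / (u - 1), hr4, ?_⟩
      rw [pow_succ _ 4, hr4]
      field_simp
  have hz : (q, r) ∈ trigonalCurve := hqr
  refine ⟨mk (q, r), ?_, ?_⟩
  · rw [xMap_of_ne (mk_ne_infty hz), aff_mk hz, mobius_eq_coe_iff hp, hr, hu]
  · rw [yMap_eq_coe_iff (mk_ne_infty hz), aff_mk hz, hr]
    exact ⟨sub_ne_zero.1 hul, hqb⟩

theorem finite_poles :
    {m | xMap p m = OnePoint.infty ∨ yMap p m = OnePoint.infty}.Finite := by
  refine (finite_setOf_snd_pow_eq (lam p)).subset ?_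
  intro m hm
  by_cases hinf : m = OnePoint.infty
  · exact Or.inl hinf
  · right
    rcases hm with hm | hm
    · rwa [xMap_of_ne hinf, mobius_eq_infty_iff] at hm
    · rwa [yMap_of_ne hinf, sphereRatio_eq_infty_iff, sub_eq_zero] at hm

/-- Off the points with `r ^ 4 = 1` and the poles, `u = r ^ 4` and `q` are functions of `x` and `y`,
and `r = q ^ 3 / (u - 1)`. -/
theorem finite_multiple (hp : Function.Injective p) :
    {m | ∃ m', m' ≠ m ∧ xMap p m' = xMap p m ∧ yMap p m' = yMap p m}.Finite := by
  refine ((finite_setOf_snd_pow_eq (lam p)).union (finite_setOf_snd_pow_eq 1)).subset ?_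
  rintro m ⟨m', hne, hx, hy⟩
  by_contra hcon
  simp only [mem_union, mem_ofPred_eq, not_or] at hcon
  obtain ⟨⟨hm, hul⟩, -, hu1⟩ := hcon
  have hm' : m' ≠ OnePoint.infty := by
    rintro rfl
    exact hm ((xMap_eq_p2_iff hp).1 (hx.symm.trans xMap_infty))
  rw [xMap_of_ne hm, xMap_of_ne hm'] at hx
  have hu : (aff m').2 ^ 4 = (aff m).2 ^ 4 := mobius_injective hp hx
  have hul' : (aff m).2 ^ 4 - lam p ≠ 0 := sub_ne_zero.2 hul
  rw [yMap_of_ne hm, yMap_of_ne hm', hu, sphereRatio_of_ne _ hul', sphereRatio_of_ne _ hul',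
    OnePoint.coe_eq_coe, div_left_inj' hul'] at hy
  have hq : (aff m').1 = (aff m).1 := mul_left_cancel₀ (kappa_ne_zero hp) hy
  have hu1' : (aff m).2 ^ 4 - 1 ≠ 0 := sub_ne_zero.2 hu1
  have hr : (aff m').2 = (aff m).2 := by
    refine mul_right_cancel₀ hu1' ?_
    have h1 := aff_mem hm
    have h2 := aff_mem hm'
    rw [hq] at h2
    linear_combination h1 - h2 - (aff m').2 * hu
  exact hne (aff_injective hm' hm (Prod.ext hq hr))

end TrigonalModel

/-! ### Branches of the logarithms off the slits -/

namespace SlitSystem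

variable {p₀ : ℂ} {p : Fin 3 → ℂ} (Γ : SlitSystem p₀ p)

theorem arc_eq_arc {j k : Fin 3} (hjk : j ≠ k) {s t : ℝ} (hs : s ∈ Icc (0 : ℝ) 1)
    (ht : t ∈ Icc (0 : ℝ) 1) (h : Γ.arc j s = Γ.arc k t) : s = 0 ∧ t = 0 :=
  ⟨Γ.disjoint j k hjk s hs t ht h, Γ.disjoint k j hjk.symm t ht s hs h.symm⟩

theorem injective_endpoints (Γ : SlitSystem p₀ p) : Function.Injective p := by
  intro j k h
  by_contra hjk
  have := (Γ.arc_eq_arc hjk (s := 1) (t := 1) (by simp) (by simp)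
    (by rw [Γ.arc_one, Γ.arc_one, h])).1
  norm_num at this

theorem arc_ne_start (j : Fin 3) {t : ℝ} (ht : t ∈ Icc (0 : ℝ) 1) (h0 : t ≠ 0) :
    Γ.arc j t ≠ p₀ := by
  exact fun h => h0 (Γ.injOn j ht (by simp) (h.trans (Γ.arc_zero j).symm))

theorem arc_ne_endpoint (j k : Fin 3) {t : ℝ} (ht : t ∈ Icc (0 : ℝ) 1) (h1 : t ≠ 1) :
    Γ.arc j t ≠ p k := by
  rw [← Γ.arc_one k]
  intro h
  by_cases hjk : j = k
  · subst hjk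
    exact h1 (Γ.injOn j ht (by simp) h)
  · have := (Γ.arc_eq_arc hjk ht (by simp) h).2
    norm_num at this

theorem arc_mem_slits (j : Fin 3) {t : ℝ} (ht : t ∈ Icc (0 : ℝ) 1) :
    (Γ.arc j t : OnePoint ℂ) ∈ Γ.slits := ⟨j, t, ht, rfl⟩

theorem coe_notMem_slits {w : ℂ} :
    (w : OnePoint ℂ) ∉ Γ.slits ↔ ∀ j, w ∉ Γ.arc j '' Icc 0 1 := by
  constructor
  · rintro h j ⟨t, ht, rfl⟩
    exact h (Γ.arc_mem_slits j ht)
  · rintro h ⟨j, t, ht, hw⟩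
    exact h j ⟨t, ht, (OnePoint.coe_eq_coe.1 hw).symm⟩

theorem isClosed_arc_image (j : Fin 3) {K : Set ℝ} (hK : IsCompact K) (h : K ⊆ Icc 0 1) :
    IsClosed (Γ.arc j '' K) :=
  (hK.image_of_continuousOn ((Γ.contDiffOn j).continuousOn.mono h)).isClosed

theorem isClosed_slits : IsClosed Γ.slits := by
  have h : Γ.slits = ⋃ j, ((↑) : ℂ → OnePoint ℂ) '' (Γ.arc j '' Icc 0 1) := by
    ext z
    simp [slits, eq_comm]
  rw [h]
  refine isClosed_iUnion_of_finite fun j => ?_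
  exact ((isCompact_Icc.image_of_continuousOn (Γ.contDiffOn j).continuousOn).image
    OnePoint.continuous_coe).isClosed

theorem continuousAt_arc (j : Fin 3) {t : ℝ} (ht : t ∈ Ioo (0 : ℝ) 1) : ContinuousAt (Γ.arc j) t :=
  (hasStrictDerivAt_arc (Γ.contDiffOn j) ht).hasDerivAt.continuousAt

/-! #### Tubular coordinates along a slit -/

/-- The tubular coordinates `(s, r) ↦ γ s + r i γ' t` are a local homeomorphism at `(t, 0)`. -/
theorem exists_tubular (j : Fin 3) {t : ℝ} (ht : t ∈ Ioo (0 : ℝ) 1) :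
    ∃ e : OpenPartialHomeomorph (ℝ × ℝ) ℂ, (t, 0) ∈ e.source ∧
      ∀ q, e q = Γ.arc j q.1 + q.2 * (Complex.I * Γ.tangent j t) := by
  set τ := Γ.tangent j t
  have hτ : τ ≠ 0 := Γ.regular j t (Ioo_subset_Icc_self ht)
  let E : (ℝ × ℝ) ≃L[ℝ] ℂ := Complex.equivRealProdCLM.symm.trans
    (ContinuousLinearEquiv.smulLeft (Units.mk0 τ hτ))
  have h1 : HasStrictFDerivAt (fun q : ℝ × ℝ => Γ.arc j q.1 + q.2 * (Complex.I * τ))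
      (E : (ℝ × ℝ) →L[ℝ] ℂ) (t, 0) := by
    have ha := HasStrictFDerivAt.comp (f := Prod.fst) (t, (0 : ℝ))
      (hasStrictDerivAt_arc (Γ.contDiffOn j) ht).hasStrictFDerivAt
      (hasStrictFDerivAt_fst (𝕜 := ℝ) (E := ℝ) (F := ℝ))
    have hb := (Complex.ofRealCLM.hasStrictFDerivAt.comp (t, (0 : ℝ))
      (hasStrictFDerivAt_snd (𝕜 := ℝ) (E := ℝ) (F := ℝ))).mul_const (Complex.I * τ)
    refine (ha.add hb).congr_fderiv ?_
    have hI : Complex.equivRealProdCLM.symm (0, 1) = Complex.I := by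
      apply Complex.ext <;> simp
    have h1 : Complex.equivRealProdCLM.symm (1, 0) = 1 := by
      apply Complex.ext <;> simp
    ext <;> simp [E, τ, tangent, hI, h1, mul_comm]
  exact ⟨h1.toOpenPartialHomeomorph _, h1.mem_toOpenPartialHomeomorph_source, fun q => rfl⟩

theorem leftSide_le (j : Fin 3) {t : ℝ} (ht : t ∈ Ioo (0 : ℝ) 1) :
    Γ.leftSide j t ≤ 𝓝 (Γ.arc j t) := by
  obtain ⟨e, he, heq⟩ := Γ.exists_tubular j ht
  have h := (e.continuousAt he).tendsto
  rw [nhds_prod_eq, heq] at h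
  simp only [Complex.ofReal_zero, zero_mul, add_zero] at h
  refine le_trans (map_mono (Filter.prod_mono le_rfl nhdsWithin_le_nhds)) ?_
  exact h.congr fun q => heq q

theorem rightSide_le (j : Fin 3) {t : ℝ} (ht : t ∈ Ioo (0 : ℝ) 1) :
    Γ.rightSide j t ≤ 𝓝 (Γ.arc j t) := by
  obtain ⟨e, he, heq⟩ := Γ.exists_tubular j ht
  have h := (e.continuousAt he).tendsto
  rw [nhds_prod_eq, heq] at h
  simp only [Complex.ofReal_zero, zero_mul, add_zero] at h
  refine le_trans (map_mono (Filter.prod_mono le_rfl nhdsWithin_le_nhds)) ?_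
  exact h.congr fun q => heq q

instance (j : Fin 3) (t : ℝ) : (Γ.leftSide j t).NeBot := by
  unfold leftSide; infer_instance

/-- The points near an inner point of a slit are on the left, on the right, or on the slit. -/
theorem eventually_nhds_arc (j : Fin 3) {t : ℝ} (ht : t ∈ Ioo (0 : ℝ) 1) {P : ℂ → Prop}
    (hl : ∀ᶠ w in Γ.leftSide j t, P w) (hr : ∀ᶠ w in Γ.rightSide j t, P w)
    (hs : ∀ᶠ s in 𝓝 t, P (Γ.arc j s)) : ∀ᶠ w in 𝓝 (Γ.arc j t), P w := by
  obtain ⟨e, he, heq⟩ := Γ.exists_tubular j ht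
  have h := e.map_nhds_eq he
  rw [heq] at h
  simp only [Complex.ofReal_zero, zero_mul, add_zero] at h
  rw [← h, eventually_map]
  rw [leftSide, eventually_map] at hl
  rw [rightSide, eventually_map] at hr
  have hs' : ∀ᶠ q : ℝ × ℝ in 𝓝 t ×ˢ pure 0, P (e q) := by
    rw [prod_pure, eventually_map]
    filter_upwards [hs] with s hs
    rw [heq]
    simpa using hs
  have hsplit : 𝓝 (t, (0 : ℝ)) = (𝓝 t ×ˢ 𝓝[<] 0) ⊔ (𝓝 t ×ˢ pure 0) ⊔ (𝓝 t ×ˢ 𝓝[>] 0) := by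
    rw [nhds_prod_eq, ← prod_sup, ← prod_sup]
    congr 1
    rw [← nhdsWithin_singleton, ← nhdsWithin_union, ← nhdsWithin_union, union_singleton,
      Iio_insert, Iic_union_Ioi, nhdsWithin_univ]
  rw [hsplit, eventually_sup, eventually_sup]
  simp only [heq] at hs' ⊢
  exact ⟨⟨hr, hs'⟩, hl⟩

theorem eventually_notMem_slits (j : Fin 3) {t : ℝ} (ht : t ∈ Ioo (0 : ℝ) 1) :
    ∀ᶠ q : ℝ × ℝ in 𝓝 t ×ˢ 𝓝 0, q.2 ≠ 0 →
      ((Γ.arc j q.1 + q.2 * (Complex.I * Γ.tangent j t) : ℂ) : OnePoint ℂ) ∉ Γ.slits := by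
  obtain ⟨e, he, heq⟩ := Γ.exists_tubular j ht
  have hV : ∀ᶠ s in 𝓝 t, (s, (0 : ℝ)) ∈ e.source :=
    (show ContinuousAt (fun s : ℝ => (s, (0 : ℝ))) t by fun_prop).eventually
      (e.open_source.mem_nhds he)
  obtain ⟨V, hVsub, hVo, htV⟩ := mem_nhds_iff.1 hV
  have htI := Ioo_subset_Icc_self ht
  have hown : ∀ᶠ w in 𝓝 (Γ.arc j t), w ∉ Γ.arc j '' (Icc 0 1 \ V) := by
    refine (Γ.isClosed_arc_image j (isCompact_Icc.diff hVo) sdiff_subset).isOpen_compl.mem_nhds ?_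
    rintro ⟨u, hu, h⟩
    rw [Γ.injOn j hu.1 htI h] at hu
    exact hu.2 htV
  have hother : ∀ᶠ w in 𝓝 (Γ.arc j t), ∀ k, k ≠ j → w ∉ Γ.arc k '' Icc 0 1 := by
    refine eventually_all.2 fun k => ?_
    by_cases hk : k = j
    · exact Eventually.of_forall fun _ h => absurd hk h
    · refine Filter.mem_of_superset
        ((Γ.isClosed_arc_image k isCompact_Icc le_rfl).isOpen_compl.mem_nhds ?_) fun w hw _ => hw
      rintro ⟨u, hu, h⟩
      exact ht.1.ne' (Γ.arc_eq_arc hk hu htI h).2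
  have hcont := (e.continuousAt he).tendsto
  rw [heq] at hcont
  simp only [Complex.ofReal_zero, zero_mul, add_zero] at hcont
  rw [← nhds_prod_eq]
  filter_upwards [hcont.eventually hown, hcont.eventually hother, e.open_source.mem_nhds he]
    with q h1 h2 h3 hq
  rw [← heq, coe_notMem_slits]
  intro k
  by_cases hk : k = j
  · subst hk
    rintro ⟨u, hu, h⟩
    by_cases huV : u ∈ V
    · have h4 : e (u, 0) = e q := by rw [heq (u, 0), ← h]; simp
      exact hq (congrArg Prod.snd (e.injOn (hVsub huV) h3 h4)).symm
    · exact h1 ⟨u, ⟨hu, huV⟩, h⟩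
  · exact h2 k hk

theorem eventually_leftSide_notMem_slits (j : Fin 3) {t : ℝ} (ht : t ∈ Ioo (0 : ℝ) 1) :
    ∀ᶠ w : ℂ in Γ.leftSide j t, (w : OnePoint ℂ) ∉ Γ.slits := by
  rw [leftSide, eventually_map]
  have h1 := (Γ.eventually_notMem_slits j ht).filter_mono
    (Filter.prod_mono (le_refl (𝓝 t)) (nhdsWithin_le_nhds (s := Ioi (0 : ℝ))))
  filter_upwards [h1, tendsto_snd.eventually (self_mem_nhdsWithin (s := Ioi (0 : ℝ)))] with q h2 h3
  exact h2 (ne_of_gt h3)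

theorem eventually_rightSide_notMem_slits (j : Fin 3) {t : ℝ} (ht : t ∈ Ioo (0 : ℝ) 1) :
    ∀ᶠ w : ℂ in Γ.rightSide j t, (w : OnePoint ℂ) ∉ Γ.slits := by
  rw [rightSide, eventually_map]
  have h1 := (Γ.eventually_notMem_slits j ht).filter_mono
    (Filter.prod_mono (le_refl (𝓝 t)) (nhdsWithin_le_nhds (s := Iio (0 : ℝ))))
  filter_upwards [h1, tendsto_snd.eventually (self_mem_nhdsWithin (s := Iio (0 : ℝ)))] with q h2 h3
  exact h2 (ne_of_lt h3)

/-! #### The logarithms and their values on the two banks -/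

/-- The branches of the logarithms of `(z - p k) / (z - p₀)` off the slits which vanish at infinity,
given by Cauchy integrals. -/
def logs (z : OnePoint ℂ) (k : Fin 3) : ℂ := z.elim 0 (cauchyIntegral (Γ.arc k) 0 1)

/-- `ℓ` consists of logarithms of `(z - p k) / (z - p₀)`, `k = 0, 1, 2`, and these are finite. -/
def IsLogTriple (p₀ : ℂ) (p : Fin 3 → ℂ) (z : OnePoint ℂ) (ℓ : Fin 3 → ℂ) : Prop :=
  (z = OnePoint.infty ∧ ∀ k, Complex.exp (ℓ k) = 1) ∨
  ∃ w : ℂ, z = w ∧ w ≠ p₀ ∧ (∀ k, w ≠ p k) ∧ ∀ k, Complex.exp (ℓ k) = (w - p k) / (w - p₀)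

theorem continuousAt_logs_apply {z : OnePoint ℂ} {k : Fin 3}
    (hz : ∀ w : ℂ, z = w → w ∉ Γ.arc k '' Icc 0 1) : ContinuousAt (fun z => Γ.logs z k) z := by
  induction z using OnePoint.rec with
  | infty =>
    refine OnePoint.continuousAt_infty'.2 ?_
    rw [coclosedCompact_eq_cocompact]
    exact tendsto_cauchyIntegral_cocompact (Γ.contDiffOn k)
  | coe w =>
    refine OnePoint.continuousAt_coe.2 ?_
    exact continuousAt_cauchyIntegral (Γ.contDiffOn k) zero_le_one le_rfl (hz w rfl)

theorem continuousAt_logs {z : OnePoint ℂ} (hz : z ∉ Γ.slits) : ContinuousAt Γ.logs z := by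
  refine continuousAt_pi.2 fun k => Γ.continuousAt_logs_apply ?_
  rintro w rfl
  exact Γ.coe_notMem_slits.1 hz k

theorem isLogTriple_logs {z : OnePoint ℂ} (hz : z ∉ Γ.slits) : IsLogTriple p₀ p z (Γ.logs z) := by
  induction z using OnePoint.rec with
  | infty => exact Or.inl ⟨rfl, fun k => Complex.exp_zero⟩
  | coe w =>
    have hw := Γ.coe_notMem_slits.1 hz
    refine Or.inr ⟨w, rfl, ?_, fun k => ?_, fun k => ?_⟩
    · rintro rfl
      exact hw 0 ⟨0, by simp, Γ.arc_zero 0⟩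
    · rintro rfl
      exact hw k ⟨1, by simp, Γ.arc_one k⟩
    · have h := exp_cauchyIntegral (Γ.contDiffOn k) (hw k)
      rwa [Γ.arc_one k, Γ.arc_zero k] at h

theorem isLogTriple_add_two_pi {z : OnePoint ℂ} {ℓ : Fin 3 → ℂ} (j : Fin 3) :
    IsLogTriple p₀ p z (ℓ + Pi.single j (2 * Real.pi * Complex.I)) ↔ IsLogTriple p₀ p z ℓ := by
  have h1 : ∀ k, Complex.exp ((ℓ + Pi.single j (2 * Real.pi * Complex.I) : Fin 3 → ℂ) k) =
      Complex.exp (ℓ k) := by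
    intro k
    by_cases hk : k = j
    · subst hk
      simp [Complex.exp_add, Complex.exp_two_pi_mul_I]
    · simp [hk]
  simp only [IsLogTriple, h1]

/-- The vector with entry `π i` at `j`, by which the logarithms on the banks of the `j`-th slit
differ from their mean value. -/
def halfJump (j : Fin 3) : Fin 3 → ℂ := Pi.single j (Real.pi * Complex.I)

theorem halfJump_add (j : Fin 3) :
    halfJump j + halfJump j = Pi.single j (2 * Real.pi * Complex.I) := by
  rw [halfJump, ← Pi.single_add]
  congr 1
  ring

/-- The mean value of the limits of the logarithms from the two sides of a slit. -/
def meanLogs (j : Fin 3) (t : ℝ) (k : Fin 3) : ℂ :=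
  if k = j then limUnder (Γ.leftSide j t) (cauchyIntegral (Γ.arc j) 0 1) - Real.pi * Complex.I
  else Γ.logs (Γ.arc j t) k

/-- Near an inner point of the `j`-th slit the logarithms are given by continuous functions, up to a
shift of the `j`-th one by `± π i`. -/
theorem exists_logs_eq (j : Fin 3) {t : ℝ} (ht : t ∈ Ioo (0 : ℝ) 1) :
    ∃ C : OnePoint ℂ → Fin 3 → ℂ, ContinuousAt C (Γ.arc j t : OnePoint ℂ) ∧
      (∀ᶠ s in 𝓝 t, Γ.meanLogs j s = C (Γ.arc j s)) ∧
      (∀ᶠ w : ℂ in Γ.leftSide j t, Γ.logs w = C w + halfJump j) ∧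
      (∀ᶠ w : ℂ in Γ.rightSide j t, Γ.logs w = C w - halfJump j) := by
  obtain ⟨C₀, hC₀, hjump⟩ := exists_cauchyIntegral_eq (Γ.contDiffOn j) (Γ.injOn j) ht
    (Γ.regular j t (Ioo_subset_Icc_self ht))
  obtain ⟨pa, hpa, pb, hpb, hjump⟩ := eventually_prod_iff.1 hjump
  obtain ⟨pc, hpc, pd, hpd, hpa⟩ := eventually_prod_iff.1 hpa
  have hside : ∀ᶠ s in 𝓝 t,
      (∀ᶠ w in Γ.leftSide j s, cauchyIntegral (Γ.arc j) 0 1 w = C₀ w + Real.pi * Complex.I) ∧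
      (∀ᶠ w in Γ.rightSide j s, cauchyIntegral (Γ.arc j) 0 1 w = C₀ w - Real.pi * Complex.I) := by
    filter_upwards [eventually_eventually_nhds.2 hpc, hpd] with s h1 h2
    rw [leftSide, rightSide, eventually_map, eventually_map]
    constructor
    · filter_upwards [prod_mem_prod h1 (inter_mem (nhdsWithin_le_nhds hpb)
        (self_mem_nhdsWithin (s := Ioi (0 : ℝ))))] with q hq
      exact (hjump (x := (q.1, s)) (hpa hq.1 h2) hq.2.1 _ rfl).1 hq.2.2
    · filter_upwards [prod_mem_prod h1 (inter_mem (nhdsWithin_le_nhds hpb)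
        (self_mem_nhdsWithin (s := Iio (0 : ℝ))))] with q hq
      exact (hjump (x := (q.1, s)) (hpa hq.1 h2) hq.2.1 _ rfl).2 hq.2.2
  refine ⟨fun z k => if k = j then C₀ (sphereCoord z) else Γ.logs z k, ?_, ?_, ?_, ?_⟩
  · refine continuousAt_pi.2 fun k => ?_
    by_cases hk : k = j
    · simp only [hk, if_true]
      refine OnePoint.continuousAt_coe.2 ?_
      exact hC₀.self_of_nhds
    · simp only [hk, if_false]
      refine Γ.continuousAt_logs_apply ?_
      rintro w hw ⟨u, hu, h⟩
      rw [OnePoint.coe_eq_coe] at hw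
      exact ht.1.ne' (Γ.arc_eq_arc hk hu (Ioo_subset_Icc_self ht) (h.trans hw.symm)).2
  · filter_upwards [hside, (Γ.continuousAt_arc j ht).eventually hC₀, Ioo_mem_nhds ht.1 ht.2]
      with s h1 h2 h3
    funext k
    by_cases hk : k = j
    · simp only [meanLogs, hk, if_true]
      have h4 : Tendsto (cauchyIntegral (Γ.arc j) 0 1) (Γ.leftSide j s)
          (𝓝 (C₀ (Γ.arc j s) + Real.pi * Complex.I)) :=
        ((h2.tendsto.mono_left (Γ.leftSide_le j h3)).add_const _).congr'
          (h1.1.mono fun w hw => hw.symm)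
      rw [h4.limUnder_eq, add_sub_cancel_right]
      rfl
    · simp only [meanLogs, hk, if_false]
  · filter_upwards [hside.self_of_nhds.1] with w hw
    funext k
    by_cases hk : k = j
    · subst hk
      simp only [if_true, halfJump, Pi.add_apply, Pi.single_eq_same]
      exact hw
    · simp [hk, halfJump]
  · filter_upwards [hside.self_of_nhds.2] with w hw
    funext k
    by_cases hk : k = j
    · subst hk
      simp only [if_true, halfJump, Pi.sub_apply, Pi.single_eq_same]
      exact hw
    · simp [hk, halfJump]

theorem isLogTriple_meanLogs_add (j : Fin 3) {t : ℝ} (ht : t ∈ Ioo (0 : ℝ) 1) :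
    IsLogTriple p₀ p (Γ.arc j t) (Γ.meanLogs j t + halfJump j) := by
  have htI := Ioo_subset_Icc_self ht
  have h0 : Γ.arc j t ≠ p₀ := Γ.arc_ne_start j htI ht.1.ne'
  refine Or.inr ⟨_, rfl, h0, fun k => Γ.arc_ne_endpoint j k htI ht.2.ne, fun k => ?_⟩
  obtain ⟨C, hC, hmean, hleft, -⟩ := Γ.exists_logs_eq j ht
  rw [hmean.self_of_nhds]
  -- Both sides are limits from the left of the same function.
  have h1 : Tendsto (fun w : ℂ => Complex.exp ((C w + halfJump j) k)) (Γ.leftSide j t)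
      (𝓝 (Complex.exp ((C (Γ.arc j t) + halfJump j) k))) := by
    have h2 := ((OnePoint.continuousAt_coe.1 hC).tendsto.mono_left (Γ.leftSide_le j ht)).add_const
      (halfJump j)
    exact (Complex.continuous_exp.tendsto _).comp ((continuous_apply k).tendsto _ |>.comp h2)
  have h2 : Tendsto (fun w : ℂ => (w - p k) / (w - p₀)) (Γ.leftSide j t)
      (𝓝 ((Γ.arc j t - p k) / (Γ.arc j t - p₀))) := by
    refine Tendsto.mono_left ?_ (Γ.leftSide_le j ht)
    exact ContinuousAt.div (by fun_prop) (by fun_prop) (sub_ne_zero.2 h0)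
  refine tendsto_nhds_unique h1 (h2.congr' ?_)
  filter_upwards [hleft, Γ.eventually_leftSide_notMem_slits j ht] with w h3 h4
  rw [← h3]
  rcases Γ.isLogTriple_logs h4 with h5 | ⟨w', hw', -, -, h5⟩
  · exact absurd h5.1 (OnePoint.coe_ne_infty _)
  · rw [h5 k, OnePoint.coe_eq_coe.1 hw']

/-- The logarithms, extended to the banks of the slits. -/
def SlitSphere.logs : Γ.SlitSphere → Fin 3 → ℂ
  | .inner z _ => Γ.logs z
  | .left j t => Γ.meanLogs j t + halfJump j
  | .right j t => Γ.meanLogs j t - halfJump j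

theorem SlitSphere.isLogTriple_logs (s : Γ.SlitSphere) :
    IsLogTriple p₀ p s.toSphere (SlitSphere.logs Γ s) := by
  cases s with
  | inner z hz => exact Γ.isLogTriple_logs hz
  | left j t => exact Γ.isLogTriple_meanLogs_add j t.2
  | right j t =>
    have h := Γ.isLogTriple_meanLogs_add j t.2
    rw [show Γ.meanLogs j t + halfJump j =
        Γ.meanLogs j t - halfJump j + (halfJump j + halfJump j) by
      abel, halfJump_add, isLogTriple_add_two_pi] at h
    exact h

theorem SlitSphere.continuous_logs : Continuous (SlitSphere.logs Γ) := by
  refine continuous_def.2 fun O hO =>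
    ⟨fun z hz h => ?_, fun j t h => ⟨?_, ?_⟩, fun j t h => ⟨?_, ?_⟩⟩
  · filter_upwards [(Γ.continuousAt_logs hz).eventually (hO.mem_nhds h)] with w hw _ using hw
  all_goals
    obtain ⟨C, hC, hmean, hleft, hright⟩ := Γ.exists_logs_eq j t.2
    have hCc := OnePoint.continuousAt_coe.1 hC
    simp only [mem_preimage, SlitSphere.logs, hmean.self_of_nhds] at h ⊢
  · have h1 : ContinuousAt (fun s : Ioo (0 : ℝ) 1 => C (Γ.arc j s) + halfJump j) t := by
      refine ContinuousAt.add ?_ continuousAt_const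
      exact ContinuousAt.comp (f := fun s : Ioo (0 : ℝ) 1 => Γ.arc j s) hCc
        ((Γ.continuousAt_arc j t.2).comp continuous_subtype_val.continuousAt)
    filter_upwards [h1.eventually (hO.mem_nhds h),
      continuous_subtype_val.continuousAt.eventually hmean] with s h2 h3
    rwa [h3]
  · have h1 := (hCc.tendsto.mono_left (Γ.leftSide_le j t.2)).add_const (halfJump j)
    filter_upwards [h1.eventually (hO.mem_nhds h), hleft] with w h2 h3 _
    rwa [h3]
  · have h1 : ContinuousAt (fun s : Ioo (0 : ℝ) 1 => C (Γ.arc j s) - halfJump j) t := by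
      refine ContinuousAt.sub ?_ continuousAt_const
      exact ContinuousAt.comp (f := fun s : Ioo (0 : ℝ) 1 => Γ.arc j s) hCc
        ((Γ.continuousAt_arc j t.2).comp continuous_subtype_val.continuousAt)
    filter_upwards [h1.eventually (hO.mem_nhds h),
      continuous_subtype_val.continuousAt.eventually hmean] with s h2 h3
    rwa [h3]
  · have h1 := (hCc.tendsto.mono_left (Γ.rightSide_le j t.2)).sub_const (halfJump j)
    filter_upwards [h1.eventually (hO.mem_nhds h), hright] with w h2 h3 _
    rwa [h3]

end SlitSystem

/-! ### The glued surface as a part of the model -/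

namespace TrigonalModel

variable (p : Fin 3 → ℂ)

/-- A fourth root of `λ`, the value of `r` at a point over `x = ∞`. -/
def rootR : ℂ := lam p ^ (((4 : ℕ) : ℂ)⁻¹)

/-- The value of `q` at the same point over `x = ∞`. -/
def rootQ : ℂ := (rootR p * (lam p - 1)) ^ (((3 : ℕ) : ℂ)⁻¹)

/-- The coordinates `(q, r)` of the point in the sheet number `a` with given logarithms of
`(x - p k) / (x - p₀)`. -/
def sheet (a : ZMod 12) (ℓ : Fin 3 → ℂ) : ℂ × ℂ :=
  (rootQ p * ZMod.stdAddChar a * Complex.exp ((ℓ 0 + 4 * ℓ 1 - 5 * ℓ 2) / 12),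
    rootR p * ZMod.stdAddChar a ^ 3 * Complex.exp ((ℓ 0 - ℓ 2) / 4))

variable {p}

theorem rootR_pow : rootR p ^ 4 = lam p := Complex.cpow_nat_inv_pow _ (by norm_num)

theorem rootQ_pow : rootQ p ^ 3 = rootR p * (lam p - 1) := Complex.cpow_nat_inv_pow _ (by norm_num)

theorem rootR_ne_zero (hp : Function.Injective p) : rootR p ≠ 0 := by
  intro h
  have := rootR_pow (p := p)
  rw [h, zero_pow (by norm_num)] at this
  exact lam_ne_zero hp this.symm

theorem rootQ_ne_zero (hp : Function.Injective p) : rootQ p ≠ 0 := by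
  intro h
  have := rootQ_pow (p := p)
  rw [h, zero_pow (by norm_num)] at this
  exact mul_ne_zero (rootR_ne_zero hp) (sub_ne_zero.2 (lam_ne_one hp)) this.symm

theorem stdAddChar_pow_twelve (a : ZMod 12) : (ZMod.stdAddChar a : ℂ) ^ 12 = 1 := by
  rw [← AddChar.map_nsmul_eq_pow]
  have : (12 : ℕ) • a = 0 := by
    rw [nsmul_eq_mul]
    have h : ((12 : ℕ) : ZMod 12) = 0 := ZMod.natCast_self 12
    rw [h, zero_mul]
  rw [this, AddChar.map_zero_eq_one]

theorem exists_stdAddChar_eq {ξ : ℂ} (h : ξ ^ 12 = 1) : ∃ b : ZMod 12, ZMod.stdAddChar b = ξ := by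
  obtain ⟨n, -, hn⟩ := (Complex.isPrimitiveRoot_exp 12 (by norm_num)).eq_pow_of_pow_eq_one h
  refine ⟨((n : ℤ) : ZMod 12), ?_⟩
  rw [ZMod.stdAddChar_coe, ← hn, ← Complex.exp_nat_mul]
  congr 1
  push_cast
  ring

theorem sheet_fst_ne_zero (hp : Function.Injective p) (a : ZMod 12) (ℓ : Fin 3 → ℂ) :
    (sheet p a ℓ).1 ≠ 0 := by
  refine mul_ne_zero (mul_ne_zero (rootQ_ne_zero hp) ?_) (Complex.exp_ne_zero _)
  intro h
  have := stdAddChar_pow_twelve a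
  rw [h, zero_pow (by norm_num)] at this
  exact zero_ne_one this

theorem continuous_sheet (a : ZMod 12) : Continuous (sheet p a) := by
  unfold sheet
  fun_prop

theorem sheet_snd_pow (a : ZMod 12) (ℓ : Fin 3 → ℂ) :
    (sheet p a ℓ).2 ^ 4 = lam p * Complex.exp (ℓ 0 - ℓ 2) := by
  simp only [sheet]
  rw [mul_pow, mul_pow, ← pow_mul, stdAddChar_pow_twelve, rootR_pow, ← Complex.exp_nat_mul]
  congr 1
  · ring
  · congr 1
    push_cast
    ring

/-- Crossing the `j`-th slit, which adds `2 π i` to the `j`-th logarithm, leads to the sheet whose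
number is larger by `1`, `4` or `7`; this is where the exponents of the equation enter. -/
theorem sheet_add (a : ZMod 12) (j : Fin 3) (ℓ : Fin 3 → ℂ) :
    sheet p (a + ((![1, 4, 7] : Fin 3 → ℕ) j : ZMod 12)) ℓ =
      sheet p a (ℓ + Pi.single j (2 * Real.pi * Complex.I)) := by
  have hχ : ∀ d : ℕ, (ZMod.stdAddChar ((d : ℕ) : ZMod 12) : ℂ) =
      Complex.exp (2 * Real.pi * Complex.I * d / 12) := by
    intro d
    have := ZMod.stdAddChar_coe (N := 12) (d : ℤ)
    push_cast at this
    exact this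
  have key : ∀ (d : ℕ) (v w v' w' : ℂ),
      (∃ n : ℤ, v' = v + 2 * Real.pi * Complex.I * d / 12 + n * (2 * Real.pi * Complex.I)) →
      (∃ n : ℤ, w' = w + 3 * (2 * Real.pi * Complex.I * d / 12) + n * (2 * Real.pi * Complex.I)) →
      (rootQ p * ZMod.stdAddChar (a + (d : ZMod 12)) * Complex.exp v,
        rootR p * ZMod.stdAddChar (a + (d : ZMod 12)) ^ 3 * Complex.exp w) =
      (rootQ p * ZMod.stdAddChar a * Complex.exp v',
        rootR p * ZMod.stdAddChar a ^ 3 * Complex.exp w') := by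
    rintro d v w v' w' hv hw
    rw [Complex.exp_eq_exp_iff_exists_int.2 hv, Complex.exp_eq_exp_iff_exists_int.2 hw,
      AddChar.map_add_eq_mul, hχ, Complex.exp_add, Complex.exp_add, mul_pow, ← Complex.exp_nat_mul]
    push_cast
    exact Prod.ext (by ring) (by ring)
  refine key _ _ _ _ _ ?_ ?_ <;> fin_cases j
  · exact ⟨0, by simp; ring⟩
  · exact ⟨0, by simp; ring⟩
  · exact ⟨-1, by simp; ring⟩
  · exact ⟨0, by simp; ring⟩
  · exact ⟨-1, by simp; ring⟩
  · exact ⟨-2, by simp; ring⟩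

variable {p₀ : ℂ}

open SlitSystem in
theorem mobius_of_isLogTriple (hp : Function.Injective p) {z : OnePoint ℂ} {ℓ : Fin 3 → ℂ}
    (h : IsLogTriple p₀ p z ℓ) : mobius p (lam p * Complex.exp (ℓ 0 - ℓ 2)) = z := by
  rcases h with ⟨rfl, h⟩ | ⟨w, rfl, h0, hk, h⟩
  · rw [Complex.exp_sub, h, h, div_one, mul_one, mobius_eq_infty_iff]
  · have h0' := sub_ne_zero.2 h0
    have h2' := sub_ne_zero.2 (hk 2)
    rw [mobius_eq_coe_iff hp, Complex.exp_sub, h, h]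
    field_simp

open SlitSystem in
theorem sheet_mem (hp : Function.Injective p) {z : OnePoint ℂ} {ℓ : Fin 3 → ℂ}
    (h : IsLogTriple p₀ p z ℓ) (a : ZMod 12) : sheet p a ℓ ∈ trigonalCurve := by
  have h1 : lam p * Complex.exp (ℓ 0 - ℓ 2) - 1 = (lam p - 1) * Complex.exp (ℓ 1 - ℓ 2) := by
    rcases h with ⟨rfl, h⟩ | ⟨w, rfl, h0, hk, h⟩
    · rw [Complex.exp_sub, Complex.exp_sub, h, h, h]
      ring
    · have h0' := sub_ne_zero.2 h0
      have h2' := sub_ne_zero.2 (hk 2)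
      rw [Complex.exp_sub, Complex.exp_sub, h, h, h]
      field_simp
      linear_combination lam_mul hp
  have h2 : (sheet p a ℓ).1 ^ 3 = (sheet p a ℓ).2 * ((lam p - 1) * Complex.exp (ℓ 1 - ℓ 2)) := by
    have h3 : Complex.exp ((ℓ 0 + 4 * ℓ 1 - 5 * ℓ 2) / 12) ^ 3 =
        Complex.exp ((ℓ 0 - ℓ 2) / 4) * Complex.exp (ℓ 1 - ℓ 2) := by
      rw [← Complex.exp_nat_mul, ← Complex.exp_add]
      congr 1
      push_cast
      ring
    simp only [sheet]
    rw [mul_pow, mul_pow, rootQ_pow, h3]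
    ring
  change (sheet p a ℓ).1 ^ 3 = _
  rw [h2, ← h1, ← sheet_snd_pow a]
  ring

open SlitSystem in
theorem xMap_mk_sheet (hp : Function.Injective p) {z : OnePoint ℂ} {ℓ : Fin 3 → ℂ}
    (h : IsLogTriple p₀ p z ℓ) (a : ZMod 12) : xMap p (mk (sheet p a ℓ)) = z := by
  have hm := sheet_mem hp h a
  rw [xMap_of_ne (mk_ne_infty hm), aff_mk hm, sheet_snd_pow, mobius_of_isLogTriple hp h]

theorem sheet_injective (hp : Function.Injective p) {a b : ZMod 12} {ℓ : Fin 3 → ℂ}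
    (h : sheet p a ℓ = sheet p b ℓ) : a = b := by
  have h1 := congrArg Prod.fst h
  have h2 := mul_left_cancel₀ (rootQ_ne_zero hp) (mul_right_cancel₀ (Complex.exp_ne_zero _) h1)
  exact ZMod.injective_stdAddChar h2

open SlitSystem in
/-- The points of the model over a point which is not a branch point are those of the twelve
sheets. -/
theorem exists_aff_eq_sheet (hp : Function.Injective p) {m : TrigonalModel} {ℓ : Fin 3 → ℂ}
    (h : IsLogTriple p₀ p (xMap p m) ℓ) : ∃ a, aff m = sheet p a ℓ := by
  have hm : m ≠ OnePoint.infty := by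
    rintro rfl
    rw [xMap_infty] at h
    rcases h with h | ⟨w, hw, -, hk, -⟩
    · exact OnePoint.coe_ne_infty _ h.1
    · exact hk 2 (OnePoint.coe_eq_coe.1 hw).symm
  have hu : (aff m).2 ^ 4 = (sheet p 0 ℓ).2 ^ 4 := by
    refine mobius_injective hp ?_
    rw [← xMap_of_ne hm, sheet_snd_pow, mobius_of_isLogTriple hp h]
  have hc := aff_mem hm
  have hc' : (sheet p 0 ℓ).1 ^ 3 = _ := sheet_mem hp h 0
  have hq0 := sheet_fst_ne_zero hp 0 ℓ
  have hq : ((aff m).1 / (sheet p 0 ℓ).1) ^ 12 = 1 := by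
    rw [div_pow, div_eq_one_iff_eq (pow_ne_zero _ hq0)]
    have h3 : ∀ q r : ℂ, q ^ 3 = r ^ 5 - r → q ^ 12 = r ^ 4 * (r ^ 4 - 1) ^ 4 := by
      intro q r h
      rw [show q ^ 12 = (q ^ 3) ^ 4 by ring, h]
      ring
    rw [h3 _ _ hc, h3 _ _ hc', hu]
  obtain ⟨b, hb⟩ := exists_stdAddChar_eq hq
  have hfst : (aff m).1 = (sheet p b ℓ).1 := by
    rw [eq_div_iff hq0] at hb
    rw [← hb]
    simp only [sheet, AddChar.map_zero_eq_one]
    ring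
  refine ⟨b, Prod.ext hfst ?_⟩
  have hu' : (aff m).2 ^ 4 = (sheet p b ℓ).2 ^ 4 := by rw [hu, sheet_snd_pow, sheet_snd_pow]
  have hc'' : (sheet p b ℓ).1 ^ 3 = _ := sheet_mem hp h b
  have hne : (sheet p b ℓ).2 ^ 4 - 1 ≠ 0 := by
    intro h0
    refine pow_ne_zero 3 (sheet_fst_ne_zero hp b ℓ) ?_
    rw [hc'']
    linear_combination (sheet p b ℓ).2 * h0
  refine mul_right_cancel₀ hne ?_
  rw [hfst] at hc
  linear_combination hc'' - hc - (aff m).2 * hu'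

open SlitSystem in
/-- If the logarithms depend continuously on `x`, then the number of the sheet is locally
constant. -/
theorem eventually_aff_eq_sheet (hp : Function.Injective p) {m₀ : TrigonalModel}
    (hm₀ : m₀ ≠ OnePoint.infty) {C : OnePoint ℂ → Fin 3 → ℂ} (hC : ContinuousAt C (xMap p m₀))
    {a : ZMod 12} (h : aff m₀ = sheet p a (C (xMap p m₀))) :
    ∀ᶠ m in 𝓝 m₀, IsLogTriple p₀ p (xMap p m) (C (xMap p m)) →
      aff m = sheet p a (C (xMap p m)) := by
  set g : TrigonalModel → ℂ := fun m => (aff m).1 / (sheet p 0 (C (xMap p m))).1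
  have hquot : ∀ b ℓ, (sheet p b ℓ).1 / (sheet p 0 ℓ).1 = ZMod.stdAddChar b := by
    intro b ℓ
    rw [div_eq_iff (sheet_fst_ne_zero hp 0 ℓ)]
    simp only [sheet, AddChar.map_zero_eq_one]
    ring
  have hg : ContinuousAt g m₀ := by
    refine ContinuousAt.div ?_ ?_ (sheet_fst_ne_zero hp _ _)
    · exact continuous_fst.continuousAt.comp (continuousAt_aff hm₀)
    · have h1 : ContinuousAt (fun m => C (xMap p m)) m₀ :=
        ContinuousAt.comp (f := xMap p) hC (continuous_xMap hp).continuousAt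
      exact (continuous_fst.comp (continuous_sheet 0)).continuousAt.comp h1
  have hfin : ((fun b : ZMod 12 => (ZMod.stdAddChar b : ℂ)) '' {b | b ≠ a}).Finite := toFinite _
  have hnot : g m₀ ∈ ((fun b : ZMod 12 => (ZMod.stdAddChar b : ℂ)) '' {b | b ≠ a})ᶜ := by
    rintro ⟨b, hb, hbg⟩
    simp only [g, h, hquot] at hbg
    exact hb (ZMod.injective_stdAddChar hbg)
  filter_upwards [hg.eventually (hfin.isClosed.isOpen_compl.mem_nhds hnot)] with m hm hlog
  obtain ⟨b, hb⟩ := exists_aff_eq_sheet hp hlog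
  by_cases hba : b = a
  · rwa [hba] at hb
  · refine absurd ⟨b, hba, ?_⟩ hm
    simp only [g, hb, hquot]

end TrigonalModel

namespace SlitSystem

open TrigonalModel

variable {p₀ : ℂ} {p : Fin 3 → ℂ} (Γ : SlitSystem p₀ p)

/-- The map from the glued surface to the model. -/
def toModel : Γ.GluedSurface 12 ![1, 4, 7] → TrigonalModel :=
  Quot.lift (fun a => TrigonalModel.mk (sheet p a.1 (SlitSphere.logs Γ a.2))) (by
    rintro _ _ ⟨i, j, t⟩
    simp only [SlitSphere.logs]
    rw [sheet_add, ← halfJump_add]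
    congr 2
    abel)

/-- The point of the glued surface given by a point in one of the copies of the slit sphere. -/
def gluedMk (a : ZMod 12) (s : Γ.SlitSphere) : Γ.GluedSurface 12 ![1, 4, 7] := Quot.mk _ ⟨a, s⟩

theorem gluedMk_left (a : ZMod 12) (j : Fin 3) (t : Ioo (0 : ℝ) 1) :
    Γ.gluedMk a (.left j t) =
      Γ.gluedMk (a + ((![1, 4, 7] : Fin 3 → ℕ) j : ZMod 12)) (.right j t) :=
  Quot.sound ⟨a, j, t⟩

/-- Every point of the glued surface lies off the slits or on the left bank of a slit. -/
@[elab_as_elim]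
theorem gluedMk_cases {P : Γ.GluedSurface 12 ![1, 4, 7] → Prop}
    (inner : ∀ a z hz, P (Γ.gluedMk a (.inner z hz))) (left : ∀ a j t, P (Γ.gluedMk a (.left j t)))
    (e : Γ.GluedSurface 12 ![1, 4, 7]) : P e := by
  induction e using Quot.ind with
  | mk b =>
    obtain ⟨a, s⟩ := b
    cases s with
    | inner z hz => exact inner a z hz
    | left j t => exact left a j t
    | right j t =>
      have h := left (a - ((![1, 4, 7] : Fin 3 → ℕ) j : ZMod 12)) j t
      rw [gluedMk_left, sub_add_cancel] at h
      exact h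

theorem aff_toModel (a : ZMod 12) (s : Γ.SlitSphere) :
    aff (Γ.toModel (Γ.gluedMk a s)) = sheet p a (SlitSphere.logs Γ s) :=
  aff_mk (sheet_mem Γ.injective_endpoints (SlitSphere.isLogTriple_logs Γ s) a)

theorem toModel_ne_infty (a : ZMod 12) (s : Γ.SlitSphere) :
    Γ.toModel (Γ.gluedMk a s) ≠ OnePoint.infty :=
  mk_ne_infty (sheet_mem Γ.injective_endpoints (SlitSphere.isLogTriple_logs Γ s) a)

theorem xMap_toModel_gluedMk (a : ZMod 12) (s : Γ.SlitSphere) :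
    xMap p (Γ.toModel (Γ.gluedMk a s)) = SlitSphere.toSphere Γ s :=
  xMap_mk_sheet Γ.injective_endpoints (SlitSphere.isLogTriple_logs Γ s) a

theorem xMap_toModel (e : Γ.GluedSurface 12 ![1, 4, 7]) :
    xMap p (Γ.toModel e) = GluedSurface.toSphere Γ 12 ![1, 4, 7] e := by
  induction e using Quot.ind with
  | mk b => exact Γ.xMap_toModel_gluedMk b.1 b.2

theorem continuous_toModel : Continuous Γ.toModel := by
  refine continuous_quot_lift _ (continuous_sigma fun a => ?_)
  refine continuous_iff_continuousAt.2 fun s => ?_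
  refine tendsto_of_tendsto_aff (Γ.toModel_ne_infty a s)
    (Eventually.of_forall fun s' => Γ.toModel_ne_infty a s') ?_
  have h := ((continuous_sheet (p := p) a).comp (SlitSphere.continuous_logs Γ)).tendsto s
  change Tendsto (fun s' => aff (Γ.toModel (Γ.gluedMk a s'))) (𝓝 s)
    (𝓝 (aff (Γ.toModel (Γ.gluedMk a s))))
  rw [aff_toModel]
  exact h.congr fun s' => (Γ.aff_toModel a s').symm

theorem injective_toModel : Function.Injective Γ.toModel := by
  have hp := Γ.injective_endpoints
  have hsheet : ∀ a b s, Γ.toModel (Γ.gluedMk a s) = Γ.toModel (Γ.gluedMk b s) → a = b := by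
    intro a b s h
    have h1 := congrArg aff h
    rw [aff_toModel, aff_toModel] at h1
    exact sheet_injective hp h1
  intro e
  refine Γ.gluedMk_cases ?_ ?_ e <;> clear e
  · intro a z hz e'
    refine Γ.gluedMk_cases ?_ ?_ e' <;> clear e'
    · intro b w hw h
      have hx := congrArg (xMap p) h
      rw [xMap_toModel_gluedMk, xMap_toModel_gluedMk] at hx
      obtain rfl : z = w := hx
      rw [hsheet a b _ h]
    · intro b j t h
      have hx := congrArg (xMap p) h
      rw [xMap_toModel_gluedMk, xMap_toModel_gluedMk] at hx
      obtain rfl : z = Γ.arc j t := hx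
      exact absurd (Γ.arc_mem_slits j (Ioo_subset_Icc_self t.2)) hz
  · intro a j t e'
    refine Γ.gluedMk_cases ?_ ?_ e' <;> clear e'
    · intro b w hw h
      have hx := congrArg (xMap p) h
      rw [xMap_toModel_gluedMk, xMap_toModel_gluedMk] at hx
      obtain rfl : Γ.arc j t = w := hx
      exact absurd (Γ.arc_mem_slits j (Ioo_subset_Icc_self t.2)) hw
    · intro b k s h
      have hx := congrArg (xMap p) h
      rw [xMap_toModel_gluedMk, xMap_toModel_gluedMk] at hx
      have hx' : Γ.arc j t = Γ.arc k s := OnePoint.coe_eq_coe.1 hx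
      have hjk : j = k := by
        by_contra hne
        exact t.2.1.ne' (Γ.arc_eq_arc hne (Ioo_subset_Icc_self t.2) (Ioo_subset_Icc_self s.2) hx').1
      subst hjk
      obtain rfl : t = s :=
        Subtype.ext (Γ.injOn j (Ioo_subset_Icc_self t.2) (Ioo_subset_Icc_self s.2) hx')
      rw [hsheet a b _ h]

theorem isOpenMap_toModel : IsOpenMap Γ.toModel := by
  have hp := Γ.injective_endpoints
  intro O hO
  have hsheet : ∀ a, IsOpen (Γ.gluedMk a ⁻¹' O) := fun a =>
    hO.preimage (continuous_quot_mk.comp continuous_sigmaMk)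
  refine isOpen_iff_mem_nhds.2 ?_
  rintro _ ⟨e, he, rfl⟩
  revert he
  refine Γ.gluedMk_cases ?_ ?_ e
  · intro a z hz he
    have hx := Γ.xMap_toModel_gluedMk a (.inner z hz)
    change xMap p _ = z at hx
    have h1 := eventually_aff_eq_sheet (p₀ := p₀) hp (Γ.toModel_ne_infty a (.inner z hz))
      (C := Γ.logs) (a := a) (by rw [hx]; exact Γ.continuousAt_logs hz)
      (by rw [hx, aff_toModel]; rfl)
    have hxc := (continuous_xMap hp).continuousAt (x := Γ.toModel (Γ.gluedMk a (.inner z hz)))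
    have h2 : ∀ᶠ m in 𝓝 (Γ.toModel (Γ.gluedMk a (.inner z hz))), xMap p m ∉ Γ.slits :=
      hxc.eventually (Γ.isClosed_slits.isOpen_compl.mem_nhds (by rw [hx]; exact hz))
    have h3 := hxc.tendsto.eventually (by rw [hx]; exact (hsheet a).1 z hz he)
    filter_upwards [h1, h2, h3, eventually_ne_infty (Γ.toModel_ne_infty a (.inner z hz))]
      with m h4 h5 h6 h7
    refine ⟨_, h6 h5, aff_injective (Γ.toModel_ne_infty _ _) h7 ?_⟩
    rw [aff_toModel, h4 (Γ.isLogTriple_logs h5)]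
    rfl
  · intro a j t he
    have hx := Γ.xMap_toModel_gluedMk a (.left j t)
    change xMap p _ = (Γ.arc j t : OnePoint ℂ) at hx
    obtain ⟨C, hC, hmean, hleft, hright⟩ := Γ.exists_logs_eq j t.2
    have h1 := eventually_aff_eq_sheet (p₀ := p₀) hp (Γ.toModel_ne_infty a (.left j t))
      (C := fun z => C z + halfJump j) (a := a) (by rw [hx]; exact hC.add continuousAt_const)
      (by rw [hx, aff_toModel, ← hmean.self_of_nhds]; rfl)
    have hxc := (continuous_xMap hp).continuousAt (x := Γ.toModel (Γ.gluedMk a (.left j t)))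
    have he' : Γ.gluedMk (a + ((![1, 4, 7] : Fin 3 → ℕ) j : ZMod 12)) (.right j t) ∈ O := by
      rwa [← gluedMk_left]
    have hl := (hsheet a).2.1 j t he
    have hr := (hsheet _).2.2 j t he'
    -- The points over the left side, the right side and the slit are treated separately.
    have h2 : ∀ᶠ w : ℂ in 𝓝 (Γ.arc j t), IsLogTriple p₀ p w (C w + halfJump j) ∧
        ∀ m, m ≠ OnePoint.infty → aff m = sheet p a (C w + halfJump j) → m ∈ Γ.toModel '' O := by
      refine Γ.eventually_nhds_arc j t.2 ?_ ?_ ?_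
      · filter_upwards [hleft, hl.2, Γ.eventually_leftSide_notMem_slits j t.2] with w h3 h4 h5
        rw [← h3]
        refine ⟨Γ.isLogTriple_logs h5, fun m hm hmw => ⟨_, h4 h5, ?_⟩⟩
        exact aff_injective (Γ.toModel_ne_infty _ _) hm ((Γ.aff_toModel _ _).trans hmw.symm)
      · filter_upwards [hright, hr.2, Γ.eventually_rightSide_notMem_slits j t.2] with w h3 h4 h5
        have h6 : C w + halfJump j = Γ.logs w + Pi.single j (2 * Real.pi * Complex.I) := by
          rw [h3, ← halfJump_add]
          abel
        rw [h6]
        refine ⟨(isLogTriple_add_two_pi j).2 (Γ.isLogTriple_logs h5), fun m hm hmw =>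
          ⟨_, h4 h5, ?_⟩⟩
        rw [← sheet_add] at hmw
        exact aff_injective (Γ.toModel_ne_infty _ _) hm ((Γ.aff_toModel _ _).trans hmw.symm)
      · have h3 : ∀ᶠ s : ℝ in 𝓝 (t : ℝ), ∀ hs : s ∈ Ioo (0 : ℝ) 1,
            Γ.gluedMk a (.left j ⟨s, hs⟩) ∈ O := by
          have h4 := hl.1
          rw [nhds_subtype_eq_comap, eventually_comap] at h4
          filter_upwards [h4] with s h5 hs using h5 ⟨s, hs⟩ rfl
        filter_upwards [hmean, h3, Ioo_mem_nhds t.2.1 t.2.2] with s h4 h5 hs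
        rw [← h4]
        refine ⟨Γ.isLogTriple_meanLogs_add j hs, fun m hm hmw => ⟨_, h5 hs, ?_⟩⟩
        exact aff_injective (Γ.toModel_ne_infty _ _) hm ((Γ.aff_toModel _ _).trans hmw.symm)
    have h3 : ∀ᶠ z : OnePoint ℂ in 𝓝 (Γ.arc j t : OnePoint ℂ),
        IsLogTriple p₀ p z (C z + halfJump j) ∧
        ∀ m, m ≠ OnePoint.infty → aff m = sheet p a (C z + halfJump j) → m ∈ Γ.toModel '' O := by
      rw [OnePoint.nhds_coe_eq, eventually_map]
      exact h2
    filter_upwards [h1, hxc.tendsto.eventually (by rw [hx]; exact h3),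
      eventually_ne_infty (Γ.toModel_ne_infty a (.left j t))] with m h4 h5 h6
    exact h5.2 m h6 (h4 h5.1)

theorem isOpenEmbedding_toModel : IsOpenEmbedding Γ.toModel :=
  .of_continuous_injective_isOpenMap Γ.continuous_toModel Γ.injective_toModel Γ.isOpenMap_toModel

/-- The glued surface is the part of the model over the complement of the four punctures. -/
theorem range_toModel :
    range Γ.toModel =
      (xMap p ⁻¹' insert (p₀ : OnePoint ℂ) (range fun k => (p k : OnePoint ℂ)))ᶜ := by
  have hp := Γ.injective_endpoints
  ext m
  constructor
  · rintro ⟨e, rfl⟩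
    induction e using Quot.ind with
    | mk b =>
      obtain ⟨a, s⟩ := b
      have hx := Γ.xMap_toModel_gluedMk a s
      have hlog := SlitSphere.isLogTriple_logs Γ s
      rw [← hx] at hlog
      intro hmem
      rcases hlog with ⟨h, -⟩ | ⟨w, hw, h0, hk, -⟩
      · rcases hmem with h' | ⟨k, h'⟩
        · exact OnePoint.coe_ne_infty _ (h'.symm.trans h)
        · exact OnePoint.coe_ne_infty _ (h'.trans h)
      · rcases hmem with h' | ⟨k, h'⟩
        · exact h0 (OnePoint.coe_eq_coe.1 (hw.symm.trans h'))
        · exact hk k (OnePoint.coe_eq_coe.1 (h'.trans hw)).symm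
  · intro hm
    have hm0 : xMap p m ≠ (p₀ : OnePoint ℂ) := fun h => hm (Or.inl h)
    have hmk : ∀ k, xMap p m ≠ (p k : OnePoint ℂ) := fun k h => hm (Or.inr ⟨k, h.symm⟩)
    have hinf : m ≠ OnePoint.infty := fun h => hmk 2 (by rw [h, xMap_infty])
    obtain ⟨s, hs⟩ : ∃ s : Γ.SlitSphere, SlitSphere.toSphere Γ s = xMap p m := by
      by_cases hslit : xMap p m ∈ Γ.slits
      · obtain ⟨j, t, ht, h⟩ := hslit
        have ht0 : t ≠ 0 := by
          rintro rfl
          exact hm0 (by rw [h, Γ.arc_zero])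
        have ht1 : t ≠ 1 := by
          rintro rfl
          exact hmk j (by rw [h, Γ.arc_one])
        exact ⟨.left j ⟨t, lt_of_le_of_ne ht.1 ht0.symm, lt_of_le_of_ne ht.2 ht1⟩, h.symm⟩
      · exact ⟨.inner _ hslit, rfl⟩
    have hlog := SlitSphere.isLogTriple_logs Γ s
    rw [show SlitSphere.toSphere Γ s = xMap p m from hs] at hlog
    obtain ⟨a, ha⟩ := exists_aff_eq_sheet hp hlog
    refine ⟨Γ.gluedMk a s, aff_injective (Γ.toModel_ne_infty _ _) hinf ?_⟩
    rw [aff_toModel, ha]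

/-- The curve is a model of the completed cover. -/
theorem isModel : BranchedCompletion.IsModel (GluedSurface.toSphere Γ 12 ![1, 4, 7]) (xMap p)
    Γ.toModel where
  isEmbedding := Γ.isOpenEmbedding_toModel.isEmbedding
  comp_eq := Γ.xMap_toModel
  continuous := continuous_xMap Γ.injective_endpoints
  finite_fiber := finite_xMap_fiber Γ.injective_endpoints
  exists_isConnected := by
    intro m W hW
    obtain ⟨e, -, hme⟩ := exists_mem_charts m
    have hF : (xMap p ⁻¹' insert (p₀ : OnePoint ℂ) (range fun k => (p k : OnePoint ℂ))).Finite := by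
      refine Set.Finite.preimage' (toFinite _) fun z _ => ?_
      exact finite_xMap_fiber Γ.injective_endpoints z
    obtain ⟨W', hsub, hW'o, hmW', hc⟩ := exists_isConnected_diff_finite hme hF hW
    refine ⟨W', hsub, hW'o, hmW', ?_⟩
    rw [sdiff_eq, ← Γ.range_toModel, inter_comm, ← image_preimage_eq_range_inter] at hc
    refine ⟨hc.nonempty.of_image, ?_⟩
    exact Γ.isOpenEmbedding_toModel.isEmbedding.isInducing.isPreconnected_image.1
      hc.isPreconnected

/-- The completed cover is homeomorphic to the curve, over the sphere. -/
theorem exists_homeomorph_model :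
    ∃ Ψ : S147 Γ ≃ₜ TrigonalModel, ∀ s, xMap p (Ψ s) = S147.x Γ s :=
  Γ.isModel.exists_homeomorph

end SlitSystem

/-! ### The Euler characteristic from a finite cell decomposition -/

/-- A Hausdorff space with a finite partition into open cells has the Euler characteristic which
counts these cells, if the characteristic maps extend continuously to the boundary of the balls and
map it to cells of smaller dimension. Here `d x` is the dimension of the open cell of `x`. -/
theorem hasEulerCharacteristic_of_cells.{u} {X : Type u} [TopologicalSpace X] [T2Space X]
    (cell : ℕ → Type u) [∀ n, Finite (cell n)] (N : ℕ) (hN : ∀ n, N ≤ n → IsEmpty (cell n))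
    (Φ : ∀ n, cell n → (Fin n → ℝ) → X) (d : X → ℕ)
    (hc : ∀ n i, ContinuousOn (Φ n i) (Metric.closedBall 0 1))
    (hinj : ∀ n i j, ∀ v ∈ Metric.ball 0 1, ∀ w ∈ Metric.ball 0 1, Φ n i v = Φ n j w →
      i = j ∧ v = w)
    (hd : ∀ n i, ∀ v ∈ Metric.ball 0 1, d (Φ n i v) = n)
    (hbd : ∀ n i, ∀ v ∈ Metric.sphere 0 1, d (Φ n i v) < n)
    (hcov : ∀ x, ∃ i, ∃ v ∈ Metric.ball 0 1, Φ (d x) i v = x) :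
    HasEulerCharacteristic X (∑ n ∈ Finset.range N, (-1 : ℤ) ^ n * (Nat.card (cell n) : ℤ)) := by
  have hio : ∀ n i, InjOn (Φ n i) (Metric.ball 0 1) := fun n i v hv w hw h =>
    (hinj n i i v hv w hw h).2
  let map : ∀ n, cell n → PartialEquiv (Fin n → ℝ) X := fun n i =>
    (hio n i).toPartialEquiv (Φ n i) (Metric.ball 0 1)
  have hev : ∀ᶠ n in atTop, IsEmpty (cell n) := eventually_atTop.2 ⟨N, hN⟩
  have hsymm : ∀ n i, ContinuousOn (map n i).symm (map n i).target := by
    intro n i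
    refine continuousOn_iff_isClosed.2 fun t ht =>
      ⟨Φ n i '' (t ∩ Metric.closedBall 0 1), ?_, ?_⟩
    · refine IsCompact.isClosed
        (IsCompact.image_of_continuousOn ?_ ((hc n i).mono inter_subset_right))
      exact (isCompact_closedBall _ _).inter_left ht
    · ext x
      constructor
      · rintro ⟨hxt, hx⟩
        refine ⟨⟨(map n i).symm x,
          ⟨hxt, Metric.ball_subset_closedBall ((map n i).map_target hx)⟩, ?_⟩, hx⟩
        exact (map n i).right_inv hx
      · rintro ⟨⟨v, ⟨hvt, hv⟩, rfl⟩, hx⟩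
        refine ⟨?_, hx⟩
        have hvb : v ∈ Metric.ball (0 : Fin n → ℝ) 1 := by
          rcases (Metric.mem_closedBall.1 hv).lt_or_eq with h | h
          · exact h
          · obtain ⟨w, hw, hwv⟩ := hx
            have h1 := hbd n i v h
            rw [← hwv, hd n i w hw] at h1
            exact absurd h1 (lt_irrefl _)
        rw [mem_preimage]
        have : (map n i).symm (Φ n i v) = v := (map n i).left_inv hvb
        rwa [this]
  have hdisj : (univ : Set (Σ n, cell n)).PairwiseDisjoint
      (fun ni ↦ map ni.1 ni.2 '' Metric.ball 0 1) := by
    rintro ⟨n, i⟩ - ⟨m, j⟩ - hne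
    refine disjoint_left.2 ?_
    rintro _ ⟨v, hv, rfl⟩ ⟨w, hw, h⟩
    have h : Φ m j w = Φ n i v := h
    have hnm : m = n := by rw [← hd m j w hw, h, hd n i v hv]
    subst hnm
    exact hne (by rw [(hinj m j i w hw v hv h).1])
  have hmem : ∀ x, ∃ i, x ∈ map (d x) i '' Metric.closedBall 0 1 := fun x => by
    obtain ⟨i, v, hv, h⟩ := hcov x
    exact ⟨i, v, Metric.ball_subset_closedBall hv, h⟩
  have hmaps : ∀ n i, MapsTo (map n i) (Metric.sphere 0 1)
      (⋃ (m < n) (j : cell m), map m j '' Metric.closedBall 0 1) := by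
    intro n i v hv
    obtain ⟨j, hj⟩ := hmem (Φ n i v)
    simp only [mem_iUnion]
    exact ⟨_, hbd n i v hv, j, hj⟩
  have hunion : ⋃ (n : ℕ) (j : cell n), map n j '' Metric.closedBall 0 1 = univ := by
    refine eq_univ_of_forall fun x => ?_
    simp only [mem_iUnion]
    exact ⟨_, hmem x⟩
  refine ⟨CWComplex.mkFinite univ cell map hev inferInstance (fun _ _ => rfl) hc hsymm hdisj hmaps
    hunion, CWComplex.finite_mkFinite univ cell map hev inferInstance (fun _ _ => rfl) hc hsymm
    hdisj hmaps hunion, ?_⟩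
  refine finsum_eq_sum_of_support_subset _ fun n hn => ?_
  by_contra h
  have : IsEmpty (cell n) := hN n (by simpa using h)
  refine hn ?_
  change (-1 : ℤ) ^ n * (Nat.card (cell n) : ℤ) = 0
  simp

/-- The plane with the maximum norm is homeomorphic to the Euclidean plane, with the unit balls
corresponding to each other. -/
theorem exists_homeomorph_complex : ∃ η : (Fin 2 → ℝ) ≃ₜ ℂ,
    (∀ v, v ∈ Metric.ball 0 1 ↔ η v ∈ Metric.ball 0 1) ∧
    (∀ v, v ∈ Metric.closedBall 0 1 ↔ η v ∈ Metric.closedBall 0 1) := by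
  let L : (Fin 2 → ℝ) ≃L[ℝ] ℂ :=
    (ContinuousLinearEquiv.finTwoArrow ℝ ℝ).trans Complex.equivRealProdCLM.symm
  obtain ⟨h, h1, h2, -⟩ := exists_homeomorph_image_interior_closure_frontier_eq_unitBall
    (s := L ⁻¹' Metric.ball 0 1) ((convex_ball (0 : ℂ) 1).is_linear_preimage L.toLinearMap.isLinear)
    (by
      rw [(Metric.isOpen_ball.preimage L.continuous).interior_eq]
      exact ⟨0, by simp⟩)
    (by
      have := L.symm.lipschitz.isBounded_image (Metric.isBounded_ball (x := (0 : ℂ)) (r := 1))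
      rwa [L.symm.image_eq_preimage_symm] at this)
  rw [(Metric.isOpen_ball.preimage L.continuous).interior_eq] at h1
  have h3 : closure (L ⁻¹' Metric.ball 0 1) = L ⁻¹' Metric.closedBall 0 1 := by
    rw [← closure_ball (0 : ℂ) one_ne_zero]
    exact (L.toHomeomorph.preimage_closure _).symm
  rw [h3] at h2
  refine ⟨h.symm.trans L.toHomeomorph, fun v => ?_, fun v => ?_⟩
  · rw [← h1, h.image_eq_preimage_symm]
    rfl
  · rw [← h2, h.image_eq_preimage_symm]
    rfl

namespace TrigonalModel

/-! ### A cell decomposition of the model -/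

/-- The action of the group `ℤ/4 × ℤ/3` (with elements encoded as pairs of exponents) on the curve;
the function `r ^ 4` is invariant. -/
def act (g : Fin 4 × Fin 3) (z : ℂ × ℂ) : ℂ × ℂ :=
  ((-Complex.I) ^ (g.1 : ℕ) * Complex.exp (2 * Real.pi * Complex.I / (3 : ℕ)) ^ (g.2 : ℕ) * z.1,
    Complex.I ^ (g.1 : ℕ) * z.2)

theorem isPrimitiveRoot_exp_three :
    IsPrimitiveRoot (Complex.exp (2 * Real.pi * Complex.I / (3 : ℕ))) 3 :=
  Complex.isPrimitiveRoot_exp 3 (by norm_num)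

theorem isPrimitiveRoot_I : IsPrimitiveRoot Complex.I 4 := by
  have h := Complex.isPrimitiveRoot_exp 4 (by norm_num)
  have h2 : Complex.exp (2 * Real.pi * Complex.I / (4 : ℕ)) = Complex.I := by
    rw [show 2 * (Real.pi : ℂ) * Complex.I / (4 : ℕ) = Real.pi / 2 * Complex.I by push_cast; ring,
      Complex.exp_pi_div_two_mul_I]
  rwa [h2] at h

theorem continuous_act (g : Fin 4 × Fin 3) : Continuous (act g) := by
  unfold act
  fun_prop

theorem I_pow_pow_four (k : ℕ) : (Complex.I ^ k) ^ 4 = 1 := by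
  rw [← pow_mul, mul_comm, pow_mul, Complex.I_pow_four, one_pow]

theorem neg_I_pow_pow_three (k : ℕ) : ((-Complex.I) ^ k) ^ 3 = Complex.I ^ k := by
  rw [← pow_mul, mul_comm, pow_mul]
  congr 1
  linear_combination -Complex.I * Complex.I_sq

theorem act_snd_pow_four (g : Fin 4 × Fin 3) (z : ℂ × ℂ) : (act g z).2 ^ 4 = z.2 ^ 4 := by
  simp only [act]
  rw [mul_pow, I_pow_pow_four, one_mul]

theorem act_mem {g : Fin 4 × Fin 3} {z : ℂ × ℂ} (hz : z ∈ trigonalCurve) :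
    act g z ∈ trigonalCurve := by
  have hz' : z.1 ^ 3 = z.2 ^ 5 - z.2 := hz
  simp only [act, trigonalCurve, mem_ofPred_eq, mul_pow]
  rw [neg_I_pow_pow_three, ← pow_mul, mul_comm _ 3, pow_mul, isPrimitiveRoot_exp_three.pow_eq_one,
    one_pow, hz']
  linear_combination (-Complex.I ^ (g.1 : ℕ) * z.2 ^ 5) * I_pow_pow_four g.1

/-- Two points of the curve in the same fibre of `r ^ 4` are in the same orbit. -/
theorem exists_act_eq {z z' : ℂ × ℂ} (hz : z ∈ trigonalCurve) (hz' : z' ∈ trigonalCurve)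
    (h0 : z.2 ≠ 0) (h1 : z.2 ^ 4 ≠ 1) (h : z.2 ^ 4 = z'.2 ^ 4) : ∃ g, act g z = z' := by
  have e : z.1 ^ 3 = z.2 ^ 5 - z.2 := hz
  have e' : z'.1 ^ 3 = z'.2 ^ 5 - z'.2 := hz'
  have hq : z.1 ≠ 0 := by
    intro hq
    rw [hq] at e
    have : z.2 * (z.2 ^ 4 - 1) = 0 := by linear_combination -e
    exact (mul_ne_zero h0 (sub_ne_zero.2 h1)) this
  obtain ⟨k, hk, hk'⟩ := isPrimitiveRoot_I.eq_pow_of_pow_eq_one (ξ := z'.2 / z.2)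
    (by rw [div_pow, h, div_self]; rw [← h]; exact pow_ne_zero _ h0)
  have hr : z'.2 = Complex.I ^ k * z.2 := by rw [hk', div_mul_cancel₀ _ h0]
  have hI : (-Complex.I) ^ k ≠ 0 := pow_ne_zero _ (neg_ne_zero.2 Complex.I_ne_zero)
  obtain ⟨m, hm, hm'⟩ := isPrimitiveRoot_exp_three.eq_pow_of_pow_eq_one
    (ξ := z'.1 / ((-Complex.I) ^ k * z.1)) (by
      rw [div_pow, div_eq_one_iff_eq (pow_ne_zero _ (mul_ne_zero hI hq)), mul_pow,
        neg_I_pow_pow_three, e, e']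
      linear_combination (1 - z.2 ^ 4) * (-hr) - z'.2 * h)
  refine ⟨⟨⟨k, hk⟩, ⟨m, hm⟩⟩, Prod.ext ?_ hr.symm⟩
  simp only [act]
  rw [hm']
  field_simp

theorem act_left_injective {z : ℂ × ℂ} (hz : z ∈ trigonalCurve) (h0 : z.2 ≠ 0) (h1 : z.2 ^ 4 ≠ 1)
    {g g' : Fin 4 × Fin 3} (h : act g z = act g' z) : g = g' := by
  have e : z.1 ^ 3 = z.2 ^ 5 - z.2 := hz
  have hq : z.1 ≠ 0 := by
    intro hq
    rw [hq] at e
    have : z.2 * (z.2 ^ 4 - 1) = 0 := by linear_combination -e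
    exact (mul_ne_zero h0 (sub_ne_zero.2 h1)) this
  have hk := Fin.ext (isPrimitiveRoot_I.pow_inj g.1.2 g'.1.2
    (mul_right_cancel₀ h0 (Prod.ext_iff.1 h).2))
  refine Prod.ext hk (Fin.ext (isPrimitiveRoot_exp_three.pow_inj g.2.2 g'.2.2 ?_))
  have h2 := mul_right_cancel₀ hq (Prod.ext_iff.1 h).1
  rw [hk] at h2
  exact mul_left_cancel₀ (pow_ne_zero _ (neg_ne_zero.2 Complex.I_ne_zero)) h2

/-- The dimension of the cell of a point, for the cell decomposition whose vertices are the points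
over `0`, `1`, `∞`, whose edges are over `(0, 1)` and `(1, ∞)`, and whose faces are over the
complement of `[0, ∞]` under the function `r ^ 4`. (The junk value of `aff` at the point at infinity
gives the correct dimension `0`.) -/
def cellDim (m : TrigonalModel) : ℕ :=
  open Classical in
  if (aff m).2 ^ 4 = 0 ∨ (aff m).2 ^ 4 = 1 then 0
    else if ((aff m).2 ^ 4).im = 0 ∧ 0 < ((aff m).2 ^ 4).re then 1 else 2

theorem cellDim_eq_zero {m : TrigonalModel} :
    cellDim m = 0 ↔ (aff m).2 ^ 4 = 0 ∨ (aff m).2 ^ 4 = 1 := by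
  unfold cellDim
  split_ifs <;> simp_all

theorem cellDim_eq_one {m : TrigonalModel} : cellDim m = 1 ↔
    ¬((aff m).2 ^ 4 = 0 ∨ (aff m).2 ^ 4 = 1) ∧
      (((aff m).2 ^ 4).im = 0 ∧ 0 < ((aff m).2 ^ 4).re) := by
  unfold cellDim
  split_ifs <;> simp_all

theorem cellDim_eq_two {m : TrigonalModel} : cellDim m = 2 ↔
    ¬((aff m).2 ^ 4 = 0 ∨ (aff m).2 ^ 4 = 1) ∧
      ¬(((aff m).2 ^ 4).im = 0 ∧ 0 < ((aff m).2 ^ 4).re) := by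
  unfold cellDim
  split_ifs <;> simp_all

theorem cellDim_le_two (m : TrigonalModel) : cellDim m ≤ 2 := by
  unfold cellDim
  split_ifs <;> simp

/-- A vertex of the cell decomposition: the point at infinity, the origin, or a point
`(0, I ^ k)`. -/
def vertex : Option (Option (Fin 4)) → TrigonalModel
  | none => OnePoint.infty
  | some none => (origin : TrigonalModel)
  | some (some k) => mk (0, Complex.I ^ (k : ℕ))

theorem zero_I_pow_mem (k : ℕ) : ((0 : ℂ), Complex.I ^ k) ∈ trigonalCurve := by
  simp only [trigonalCurve, mem_ofPred_eq]
  rw [pow_succ _ 4, I_pow_pow_four]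
  ring

theorem vertex_injective : Function.Injective vertex := by
  have h1 : ∀ k : Fin 4, aff (mk ((0 : ℂ), Complex.I ^ (k : ℕ))) = (0, Complex.I ^ (k : ℕ)) :=
    fun k => aff_mk (zero_I_pow_mem k)
  have h2 : ∀ k : Fin 4, (origin : TrigonalModel) ≠ mk ((0 : ℂ), Complex.I ^ (k : ℕ)) := by
    intro k h
    have := h1 k
    rw [← h, aff_coe] at this
    exact pow_ne_zero (k : ℕ) Complex.I_ne_zero (Prod.ext_iff.1 this).2.symm
  rintro (_ | _ | k) (_ | _ | l) h
  · rfl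
  · exact absurd h.symm (OnePoint.coe_ne_infty _)
  · exact absurd h.symm (mk_ne_infty (zero_I_pow_mem l))
  · exact absurd h (OnePoint.coe_ne_infty _)
  · rfl
  · exact absurd h (h2 l)
  · exact absurd h (mk_ne_infty (zero_I_pow_mem k))
  · exact absurd h.symm (h2 k)
  · have h3 := h1 k
    rw [show mk ((0 : ℂ), Complex.I ^ (k : ℕ)) = mk ((0 : ℂ), Complex.I ^ (l : ℕ)) from h,
      h1 l] at h3
    have := Fin.ext (isPrimitiveRoot_I.pow_inj l.2 k.2 (Prod.ext_iff.1 h3).2)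
    rw [this]

theorem cellDim_vertex (i : Option (Option (Fin 4))) : cellDim (vertex i) = 0 := by
  rw [cellDim_eq_zero]
  rcases i with _ | _ | k
  · left
    simp [vertex, aff]
  · left
    simp [vertex, origin]
  · right
    rw [vertex, aff_mk (zero_I_pow_mem k), I_pow_pow_four]

theorem exists_vertex_eq {m : TrigonalModel} (h : cellDim m = 0) : ∃ i, vertex i = m := by
  induction m using OnePoint.rec with
  | infty => exact ⟨none, rfl⟩
  | coe z =>
    rw [cellDim_eq_zero, aff_coe] at h
    rcases h with h | h
    · exact ⟨some none, by rw [eq_origin (eq_zero_of_pow_eq_zero h)]; rfl⟩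
    · obtain ⟨k, hk, hk'⟩ := isPrimitiveRoot_I.eq_pow_of_pow_eq_one h
      refine ⟨some (some ⟨k, hk⟩), aff_injective (mk_ne_infty (zero_I_pow_mem k))
        (OnePoint.coe_ne_infty _) ?_⟩
      rw [vertex, aff_mk (zero_I_pow_mem k), aff_coe]
      refine Prod.ext ?_ hk'
      have hz : (z : ℂ × ℂ).1 ^ 3 = (z : ℂ × ℂ).2 ^ 5 - (z : ℂ × ℂ).2 := z.2
      refine (eq_zero_of_pow_eq_zero (n := 3) ?_).symm
      linear_combination hz + (z : ℂ × ℂ).2 * h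

/-- The edge over `[0, 1]` (for `r ^ 4`) on which `r` is real and nonnegative. -/
def edgeBase (t : ℝ) : ℂ × ℂ := (-((t - t ^ 5) ^ (1 / 3 : ℝ) : ℝ), t)

theorem edgeBase_mem {t : ℝ} (ht : t ∈ Icc (0 : ℝ) 1) : edgeBase t ∈ trigonalCurve := by
  have h : 0 ≤ t - t ^ 5 := sub_nonneg.2 (pow_le_of_le_one ht.1 ht.2 (by norm_num))
  simp only [edgeBase, trigonalCurve, mem_ofPred_eq]
  have h2 : ((t - t ^ 5) ^ (1 / 3 : ℝ)) ^ 3 = t - t ^ 5 := by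
    rw [← Real.rpow_natCast, ← Real.rpow_mul h]
    norm_num
  have h3 : (((t - t ^ 5) ^ (1 / 3 : ℝ) : ℝ) : ℂ) ^ 3 = t - t ^ 5 := by exact_mod_cast h2
  linear_combination -h3

theorem continuous_edgeBase : Continuous edgeBase := by
  refine Continuous.prodMk ?_ Complex.continuous_ofReal
  refine (Complex.continuous_ofReal.comp ?_).neg
  exact Continuous.rpow_const (by fun_prop) fun t => Or.inr (by norm_num)

/-- The edges over `[0, 1]`, and their images under the involution, which are the edges over
`[1, ∞]`. -/
def edge (i : Bool × Fin 4 × Fin 3) (t : ℝ) : TrigonalModel :=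
  if i.1 then flip (mk (act i.2 (edgeBase t))) else mk (act i.2 (edgeBase t))

theorem continuousOn_edge (i : Bool × Fin 4 × Fin 3) : ContinuousOn (edge i) (Icc 0 1) := by
  have h : ContinuousOn (fun t => mk (act i.2 (edgeBase t))) (Icc 0 1) := by
    intro t ht
    refine tendsto_of_tendsto_aff (mk_ne_infty (act_mem (edgeBase_mem ht))) ?_ ?_
    · filter_upwards [self_mem_nhdsWithin] with t' ht'
        using mk_ne_infty (act_mem (edgeBase_mem ht'))
    · rw [aff_mk (act_mem (edgeBase_mem ht))]
      refine Tendsto.congr' ?_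
        (((continuous_act i.2).comp continuous_edgeBase).continuousWithinAt
          (s := Icc 0 1) (x := t)).tendsto
      filter_upwards [self_mem_nhdsWithin] with t' ht'
        using (aff_mk (act_mem (edgeBase_mem ht'))).symm
  obtain ⟨b, g⟩ := i
  cases b
  · exact h
  · exact continuous_flip.comp_continuousOn h

theorem edge_zero (i : Bool × Fin 4 × Fin 3) :
    edge i 0 = if i.1 then OnePoint.infty else (origin : TrigonalModel) := by
  have h : mk (act i.2 (edgeBase 0)) = (origin : TrigonalModel) := by
    refine aff_injective (mk_ne_infty (act_mem (edgeBase_mem (by simp))))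
      (OnePoint.coe_ne_infty _) ?_
    rw [aff_mk (act_mem (edgeBase_mem (by simp))), aff_coe]
    simp [act, edgeBase, origin]
  rw [edge, h, flip_coe_of_eq rfl]

/-- The function `r ^ 4` on the open edges: it is `t ^ 4`, or its inverse. -/
theorem edge_snd_pow_four (i : Bool × Fin 4 × Fin 3) {t : ℝ} (ht : t ∈ Ioc (0 : ℝ) 1) :
    edge i t ≠ OnePoint.infty ∧
    (aff (edge i t)).2 ^ 4 = ((if i.1 then 1 / t ^ 4 else t ^ 4 : ℝ) : ℂ) := by
  have hm := act_mem (g := i.2) (edgeBase_mem (Ioc_subset_Icc_self ht))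
  have h4 : (act i.2 (edgeBase t)).2 ^ 4 = (t : ℂ) ^ 4 := by rw [act_snd_pow_four]; rfl
  obtain ⟨b, g⟩ := i
  cases b
  · refine ⟨mk_ne_infty hm, ?_⟩
    change (aff (mk _)).2 ^ 4 = _
    rw [aff_mk hm, h4]
    simp
  · have h0 : (aff (mk (act g (edgeBase t)))).2 ≠ 0 := by
      rw [aff_mk hm]
      intro h
      change (act g (edgeBase t)).2 ^ 4 = (t : ℂ) ^ 4 at h4
      rw [h] at h4
      have : (t : ℂ) ≠ 0 := by exact_mod_cast ht.1.ne'
      exact pow_ne_zero 4 this (by rw [← h4]; simp)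
    have hne : flip (mk (act g (edgeBase t))) ≠ OnePoint.infty := by
      intro h
      have h2 := flip_flip (mk (act g (edgeBase t)))
      rw [h, flip_infty] at h2
      rw [← h2] at h0
      exact h0 rfl
    refine ⟨hne, ?_⟩
    change (aff (flip (mk _))).2 ^ 4 = _
    rw [(flip_ne_infty (mk_ne_infty hm) hne).2, aff_mk hm]
    simp only [flipFun]
    rw [div_pow, h4]
    simp

theorem cellDim_edge (i : Bool × Fin 4 × Fin 3) {t : ℝ} (ht : t ∈ Ioo (0 : ℝ) 1) :
    cellDim (edge i t) = 1 := by
  rw [cellDim_eq_one, (edge_snd_pow_four i (Ioo_subset_Ioc_self ht)).2]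
  have h4 : t ^ 4 < 1 := pow_lt_one₀ ht.1.le ht.2 (by norm_num)
  have h40 : 0 < t ^ 4 := pow_pos ht.1 4
  have h41 : 1 < 1 / t ^ 4 := by rwa [lt_one_div one_pos h40, div_one]
  set s : ℝ := if i.1 then 1 / t ^ 4 else t ^ 4
  have hs : 0 < s ∧ s ≠ 1 := by
    unfold s
    split_ifs
    · exact ⟨by linarith, h41.ne'⟩
    · exact ⟨h40, h4.ne⟩
  refine ⟨?_, Complex.ofReal_im s, by simpa using hs.1⟩
  rintro (h | h)
  · exact hs.1.ne' (by exact_mod_cast h)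
  · exact hs.2 (by exact_mod_cast h)

theorem cellDim_edge_zero (i : Bool × Fin 4 × Fin 3) : cellDim (edge i 0) = 0 := by
  rw [edge_zero]
  split_ifs
  · exact cellDim_vertex none
  · exact cellDim_vertex (some none)

theorem cellDim_edge_one (i : Bool × Fin 4 × Fin 3) : cellDim (edge i 1) = 0 := by
  rw [cellDim_eq_zero, (edge_snd_pow_four i (by simp)).2]
  right
  simp

theorem edge_injective {i j : Bool × Fin 4 × Fin 3} {s t : ℝ} (hs : s ∈ Ioo (0 : ℝ) 1)
    (ht : t ∈ Ioo (0 : ℝ) 1) (h : edge i s = edge j t) : i = j ∧ s = t := by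
  have hs4 : s ^ 4 < 1 := pow_lt_one₀ hs.1.le hs.2 (by norm_num)
  have ht4 : t ^ 4 < 1 := pow_lt_one₀ ht.1.le ht.2 (by norm_num)
  have hs41 : 1 < 1 / s ^ 4 := by rwa [lt_one_div one_pos (pow_pos hs.1 4), div_one]
  have ht41 : 1 < 1 / t ^ 4 := by rwa [lt_one_div one_pos (pow_pos ht.1 4), div_one]
  have h4 := (edge_snd_pow_four i (Ioo_subset_Ioc_self hs)).2
  rw [h, (edge_snd_pow_four j (Ioo_subset_Ioc_self ht)).2, Complex.ofReal_inj] at h4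
  have key : i.1 = j.1 ∧ s = t := by
    cases hi : i.1 <;> cases hj : j.1 <;> rw [hi, hj] at h4 <;> simp only [if_true, if_false,
      Bool.false_eq_true] at h4
    · exact ⟨rfl, (pow_left_inj₀ hs.1.le ht.1.le four_ne_zero).1 h4.symm⟩
    · linarith
    · linarith
    · refine ⟨rfl, (pow_left_inj₀ hs.1.le ht.1.le four_ne_zero).1 ?_⟩
      rw [one_div, one_div] at h4
      exact (inv_injective h4).symm
  obtain ⟨hb, rfl⟩ := key
  obtain ⟨b, g⟩ := i
  obtain ⟨b', g'⟩ := j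
  obtain rfl : b = b' := hb
  refine ⟨?_, rfl⟩
  have hm := edgeBase_mem (Ioo_subset_Icc_self hs)
  have h2 : mk (act g (edgeBase s)) = mk (act g' (edgeBase s)) := by
    cases b
    · exact h
    · exact flipHomeomorph.injective h
  have h3 := congrArg aff h2
  rw [aff_mk (act_mem hm), aff_mk (act_mem hm)] at h3
  have hs0 : (s : ℂ) ≠ 0 := by exact_mod_cast hs.1.ne'
  have hs1 : (s : ℂ) ^ 4 ≠ 1 := by exact_mod_cast hs4.ne
  rw [act_left_injective hm hs0 hs1 h3]

theorem exists_edge_eq {m : TrigonalModel} (h : cellDim m = 1) :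
    ∃ i, ∃ t ∈ Ioo (0 : ℝ) 1, edge i t = m := by
  -- The case of a value of `r ^ 4` in `(0, 1)`, to which the other case reduces by the involution.
  have key : ∀ (m : TrigonalModel) (x : ℝ), m ≠ OnePoint.infty → (aff m).2 ^ 4 = x → 0 < x → x < 1 →
      ∃ g, ∃ t ∈ Ioo (0 : ℝ) 1, mk (act g (edgeBase t)) = m := by
    intro m x hm hx h0 h1
    have ht0 : 0 < x ^ (1 / 4 : ℝ) := Real.rpow_pos_of_pos h0 _
    have ht1 : x ^ (1 / 4 : ℝ) < 1 := Real.rpow_lt_one h0.le h1 (by norm_num)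
    have ht4 : (x ^ (1 / 4 : ℝ)) ^ 4 = x := by
      rw [← Real.rpow_natCast, ← Real.rpow_mul h0.le]
      norm_num
    set t := x ^ (1 / 4 : ℝ)
    have ht : t ∈ Icc (0 : ℝ) 1 := ⟨ht0.le, ht1.le⟩
    have h2 : (edgeBase t).2 ^ 4 = (x : ℂ) := by
      rw [← ht4]
      simp [edgeBase]
    have hx0 : (x : ℂ) ≠ 0 := by exact_mod_cast h0.ne'
    have hx1 : (x : ℂ) ≠ 1 := by exact_mod_cast h1.ne
    obtain ⟨g, hg⟩ := exists_act_eq (edgeBase_mem ht) (aff_mem hm)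
      (by intro h; rw [h] at h2; exact hx0 (by rw [← h2]; simp)) (by rwa [h2]) (by rw [h2, hx])
    exact ⟨g, t, ⟨ht0, ht1⟩, by rw [hg, mk_aff hm]⟩
  rw [cellDim_eq_one] at h
  obtain ⟨h1, him, hre⟩ := h
  have hm : m ≠ OnePoint.infty := by
    rintro rfl
    exact h1 (Or.inl (by simp [aff]))
  obtain ⟨x, hx⟩ : ∃ x : ℝ, (aff m).2 ^ 4 = x := ⟨_, (Complex.ext rfl (by simpa using him))⟩
  rw [hx, Complex.ofReal_re] at hre
  have hx1 : x ≠ 1 := by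
    rintro rfl
    exact h1 (Or.inr (by rw [hx]; simp))
  rcases hx1.lt_or_gt with hlt | hlt
  · obtain ⟨g, t, ht, h⟩ := key m x hm hx hre hlt
    exact ⟨(false, g), t, ht, h⟩
  · have h0 : (aff m).2 ≠ 0 := fun h => h1 (Or.inl (by rw [h]; simp))
    have hne : flip m ≠ OnePoint.infty := by
      intro h
      have h2 := flip_flip m
      rw [h, flip_infty] at h2
      rw [← h2] at h0
      exact h0 rfl
    obtain ⟨g, t, ht, h⟩ := key (flip m) (1 / x) hne
      (by
        rw [(flip_ne_infty hm hne).2]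
        simp only [flipFun]
        rw [div_pow, hx]
        simp)
      (by positivity) (by rwa [div_lt_one hre])
    refine ⟨(true, g), t, ht, ?_⟩
    change flip (mk _) = m
    rw [h, flip_flip]

end TrigonalModel

namespace TrigonalModel

theorem exists_neg_one_roots : ∃ c : ℂ × ℂ, c.2 ^ 4 = -1 ∧ c.1 ^ 3 = -2 * c.2 := by
  obtain ⟨c, hc⟩ := IsAlgClosed.exists_pow_nat_eq (-1 : ℂ) (n := 4) (by norm_num)
  obtain ⟨c', hc'⟩ := IsAlgClosed.exists_pow_nat_eq (-2 * c : ℂ) (n := 3) (by norm_num)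
  exact ⟨(c', c), hc, hc'⟩

/-- A face over the complement of `[0, ∞]` (for `r ^ 4`), parametrized by the unit disc without the
point `1`, which corresponds to the point at infinity. The coordinates satisfy
`r ^ 4 = -((1 + w) / (1 - w)) ^ 2`. They are products of powers of the functions `1 ± w` and
`1 ± I * w`, which have nonnegative real parts on the disc, so that the principal branches of the
powers with positive exponents are continuous up to the boundary. -/
def faceBase (w : ℂ) : ℂ × ℂ :=
  (exists_neg_one_roots.choose.1 * (1 + w) ^ (1 / 6 : ℂ) * (1 + Complex.I * w) ^ (1 / 3 : ℂ) *
    (1 - Complex.I * w) ^ (1 / 3 : ℂ) / ((1 - w) ^ (1 / 6 : ℂ)) ^ 5,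
    exists_neg_one_roots.choose.2 * ((1 + w) ^ (1 / 6 : ℂ)) ^ 3 / ((1 - w) ^ (1 / 6 : ℂ)) ^ 3)

theorem cpow_one_div_pow (z : ℂ) {n : ℕ} (hn : n ≠ 0) : (z ^ (1 / (n : ℂ))) ^ n = z := by
  rw [one_div, Complex.cpow_nat_inv_pow z hn]

theorem faceBase_snd_pow_four {w : ℂ} : (faceBase w).2 ^ 4 = -((1 + w) / (1 - w)) ^ 2 := by
  have ha := cpow_one_div_pow (1 + w) (n := 6) (by norm_num)
  have hb := cpow_one_div_pow (1 - w) (n := 6) (by norm_num)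
  push_cast at ha hb
  have hc := exists_neg_one_roots.choose_spec.1
  simp only [faceBase]
  rw [div_pow, mul_pow, hc, ← pow_mul, ← pow_mul, show 3 * 4 = 6 * 2 from rfl, pow_mul, pow_mul, ha,
    hb, div_pow]
  ring

theorem faceBase_mem {w : ℂ} (hw : w ≠ 1) : faceBase w ∈ trigonalCurve := by
  have ha := cpow_one_div_pow (1 + w) (n := 6) (by norm_num)
  have hb := cpow_one_div_pow (1 - w) (n := 6) (by norm_num)
  have hd := cpow_one_div_pow (1 + Complex.I * w) (n := 3) (by norm_num)
  have he := cpow_one_div_pow (1 - Complex.I * w) (n := 3) (by norm_num)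
  push_cast at ha hb hd he
  obtain ⟨hc, hc'⟩ := exists_neg_one_roots.choose_spec
  have h1 : (1 - w) ^ (1 / 6 : ℂ) ≠ 0 := by
    intro h
    rw [h, zero_pow (by norm_num)] at hb
    exact hw (by linear_combination hb)
  simp only [faceBase, trigonalCurve, mem_ofPred_eq]
  set c := exists_neg_one_roots.choose
  set a := (1 + w) ^ (1 / 6 : ℂ)
  set b := (1 - w) ^ (1 / 6 : ℂ)
  set d := (1 + Complex.I * w) ^ (1 / 3 : ℂ)
  set e := (1 - Complex.I * w) ^ (1 / 3 : ℂ)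
  have h2 : d ^ 3 * e ^ 3 = 1 + w ^ 2 := by
    rw [hd, he]
    linear_combination -w ^ 2 * Complex.I_sq
  have h3 : a ^ 12 + b ^ 12 = 2 * (1 + w ^ 2) := by
    rw [show a ^ 12 = (a ^ 6) ^ 2 by ring, show b ^ 12 = (b ^ 6) ^ 2 by ring, ha, hb]
    ring
  have h4 : (c.1 * a * d * e) ^ 3 = c.2 ^ 5 * a ^ 15 - c.2 * a ^ 3 * b ^ 12 := by
    linear_combination a ^ 3 * d ^ 3 * e ^ 3 * hc' - 2 * c.2 * a ^ 3 * h2 + c.2 * a ^ 3 * h3 -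
      c.2 * a ^ 15 * hc
  rw [div_pow, h4]
  field_simp

theorem continuousOn_cpow_closedBall {u : ℂ} (hu : ‖u‖ = 1) {s : ℂ} (hs : 0 < s.re) :
    ContinuousOn (fun w : ℂ => (1 + u * w) ^ s) (Metric.closedBall 0 1) := by
  intro w hw
  have h1 : 0 ≤ (1 + u * w).re := by
    have h2 : ‖u * w‖ ≤ 1 := by rw [norm_mul, hu, one_mul]; simpa using hw
    have h3 := (abs_le.1 ((Complex.abs_re_le_norm (u * w)).trans h2)).1
    rw [Complex.add_re, Complex.one_re]
    linarith
  have h2 : ContinuousAt (fun w : ℂ => 1 + u * w) w := by fun_prop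
  exact (ContinuousAt.comp (f := fun w : ℂ => 1 + u * w) (g := fun z : ℂ => z ^ s)
    (Complex.continuousAt_cpow_const_of_re_pos (Or.inl h1) hs) h2).continuousWithinAt

theorem continuousOn_cpow_one_add :
    ContinuousOn (fun w : ℂ => (1 + w) ^ (1 / 6 : ℂ)) (Metric.closedBall 0 1) := by
  simpa using continuousOn_cpow_closedBall (u := 1) (by simp) (s := 1 / 6) (by norm_num)

theorem continuousOn_cpow_one_sub :
    ContinuousOn (fun w : ℂ => (1 - w) ^ (1 / 6 : ℂ)) (Metric.closedBall 0 1) := by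
  simpa [← sub_eq_add_neg] using
    continuousOn_cpow_closedBall (u := -1) (by simp) (s := 1 / 6) (by norm_num)

theorem cpow_one_sub_ne_zero {w : ℂ} (hw : w ≠ 1) : (1 - w) ^ (1 / 6 : ℂ) ≠ 0 := by
  rw [Complex.cpow_ne_zero_iff_of_exponent_ne_zero (by norm_num)]
  exact sub_ne_zero.2 hw.symm

theorem continuousOn_faceBase : ContinuousOn faceBase (Metric.closedBall 0 1 \ {1}) := by
  have ha := continuousOn_cpow_one_add.mono (sdiff_subset (t := {1}))
  have hb := continuousOn_cpow_one_sub.mono (sdiff_subset (t := {1}))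
  have hd := (continuousOn_cpow_closedBall (u := Complex.I) (by simp) (s := 1 / 3)
    (by norm_num)).mono (sdiff_subset (t := {1}))
  have he := (continuousOn_cpow_closedBall (u := -Complex.I) (by simp) (s := 1 / 3)
    (by norm_num)).mono (sdiff_subset (t := {1}))
  simp only [neg_mul, ← sub_eq_add_neg] at he
  refine ContinuousOn.prodMk ?_ ?_
  · exact (((continuousOn_const.mul ha).mul hd).mul he).div (hb.pow 5)
      fun w hw => pow_ne_zero 5 (cpow_one_sub_ne_zero hw.2)
  · exact (continuousOn_const.mul (ha.pow 3)).div (hb.pow 3)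
      fun w hw => pow_ne_zero 3 (cpow_one_sub_ne_zero hw.2)

/-- The closed faces, as functions on the closed unit disc. -/
def face (g : Fin 4 × Fin 3) (w : ℂ) : TrigonalModel :=
  open Classical in if w = 1 then OnePoint.infty else mk (act g (faceBase w))

theorem face_one (g : Fin 4 × Fin 3) : face g 1 = OnePoint.infty := if_pos rfl

theorem face_of_ne (g : Fin 4 × Fin 3) {w : ℂ} (hw : w ≠ 1) : face g w = mk (act g (faceBase w)) :=
  if_neg hw

theorem aff_face (g : Fin 4 × Fin 3) {w : ℂ} (hw : w ≠ 1) :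
    aff (face g w) = act g (faceBase w) := by
  rw [face_of_ne g hw, aff_mk (act_mem (faceBase_mem hw))]

theorem face_ne_infty (g : Fin 4 × Fin 3) {w : ℂ} (hw : w ≠ 1) : face g w ≠ OnePoint.infty := by
  rw [face_of_ne g hw]
  exact mk_ne_infty (act_mem (faceBase_mem hw))

theorem face_snd_pow_four (g : Fin 4 × Fin 3) {w : ℂ} (hw : w ≠ 1) :
    (aff (face g w)).2 ^ 4 = -((1 + w) / (1 - w)) ^ 2 := by
  rw [aff_face g hw, act_snd_pow_four, faceBase_snd_pow_four]

theorem face_neg_one (g : Fin 4 × Fin 3) : face g (-1) = (origin : TrigonalModel) := by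
  have hne : (-1 : ℂ) ≠ 1 := by norm_num
  refine aff_injective (face_ne_infty g hne) (OnePoint.coe_ne_infty _) ?_
  rw [aff_face g hne, aff_coe]
  simp [act, faceBase, origin]

theorem continuousOn_face (g : Fin 4 × Fin 3) : ContinuousOn (face g) (Metric.closedBall 0 1) := by
  intro w hw
  by_cases hw1 : w = 1
  · subst hw1
    unfold ContinuousWithinAt
    rw [face_one]
    refine tendsto_nhds_infty_of_norm fun B => ?_
    -- The inverse of `r ^ 4` tends to zero at `1`.
    have h1 : ContinuousAt (fun w : ℂ => ((1 - w) / (1 + w)) ^ 2) 1 := by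
      refine ContinuousAt.pow (ContinuousAt.div (by fun_prop) (by fun_prop) ?_) 2
      norm_num
    have h2 := h1.norm.eventually (gt_mem_nhds
      (show ‖((1 - (1 : ℂ)) / (1 + 1)) ^ 2‖ < 1 / (|B| + 1) ^ 4 by simp; positivity))
    filter_upwards [h2.filter_mono nhdsWithin_le_nhds, mem_nhdsWithin_of_mem_nhds
      (isOpen_ne.mem_nhds (show (1 : ℂ) ≠ -1 by norm_num))] with w hw hwn
    by_cases hw1 : w = 1
    · exact Or.inl (by rw [hw1, face_one])
    · right
      by_contra! h
      have h3 : ‖(aff (face g w)).2‖ ≤ |B| + 1 := by linarith [le_abs_self B]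
      have h4 : ‖(aff (face g w)).2‖ ^ 4 * ‖((1 - w) / (1 + w)) ^ 2‖ = 1 := by
        have h5 : 1 - w ≠ 0 := sub_ne_zero.2 (Ne.symm hw1)
        have h6 : 1 + w ≠ 0 := fun h => hwn (by linear_combination h)
        rw [← norm_pow, ← norm_mul, face_snd_pow_four g hw1, neg_mul, norm_neg, ← mul_pow,
          div_mul_div_comm, mul_comm, div_self (mul_ne_zero h5 h6), one_pow, norm_one]
      have h7 : (0 : ℝ) < (|B| + 1) ^ 4 := by positivity
      rw [lt_div_iff₀ h7, mul_comm] at hw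
      have h8 := mul_le_mul_of_nonneg_right (pow_le_pow_left₀ (norm_nonneg _) h3 4)
        (norm_nonneg (((1 - w) / (1 + w)) ^ 2))
      linarith
  · refine tendsto_of_tendsto_aff (face_ne_infty g hw1) ?_ ?_
    · filter_upwards [mem_nhdsWithin_of_mem_nhds (isOpen_ne.mem_nhds hw1)]
        with w' hw' using face_ne_infty g hw'
    · rw [aff_face g hw1]
      have h1 : ContinuousWithinAt faceBase (Metric.closedBall 0 1) w := by
        refine (continuousOn_faceBase w ⟨hw, hw1⟩).mono_of_mem_nhdsWithin ?_
        exact inter_mem self_mem_nhdsWithin (mem_nhdsWithin_of_mem_nhds (isOpen_ne.mem_nhds hw1))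
      refine (((continuous_act g).tendsto _).comp h1).congr' ?_
      filter_upwards [mem_nhdsWithin_of_mem_nhds (isOpen_ne.mem_nhds hw1)]
        with w' hw' using (aff_face g hw').symm

theorem re_cayley {w : ℂ} (hw : w ≠ 1) :
    ((1 + w) / (1 - w)).re * Complex.normSq (1 - w) = 1 - ‖w‖ ^ 2 := by
  have h : Complex.normSq (1 - w) ≠ 0 := by
    rw [Ne, Complex.normSq_eq_zero]
    exact sub_ne_zero.2 hw.symm
  rw [Complex.div_re, add_mul, div_mul_cancel₀ _ h, div_mul_cancel₀ _ h,
    ← Complex.normSq_eq_norm_sq, Complex.normSq_apply]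
  simp
  ring

theorem re_cayley_pos {w : ℂ} (hw : w ∈ Metric.ball (0 : ℂ) 1) : 0 < ((1 + w) / (1 - w)).re := by
  have hw' : ‖w‖ < 1 := by simpa using hw
  have hw1 : w ≠ 1 := by
    rintro rfl
    simp at hw'
  have h := re_cayley hw1
  have h1 : 0 < 1 - ‖w‖ ^ 2 := by
    have := pow_lt_one₀ (norm_nonneg w) hw' two_ne_zero
    linarith
  rw [← h] at h1
  exact pos_of_mul_pos_left h1 (Complex.normSq_nonneg _)

/-- The function `((1 + w) / (1 - w)) ^ 2` maps the open unit disc to the complement of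
`(-∞, 0]`. -/
theorem cellDim_face (g : Fin 4 × Fin 3) {w : ℂ} (hw : w ∈ Metric.ball (0 : ℂ) 1) :
    cellDim (face g w) = 2 := by
  have hw1 : w ≠ 1 := by
    rintro rfl
    simp at hw
  have hre := re_cayley_pos hw
  have h := face_snd_pow_four g hw1
  rw [cellDim_eq_two, h]
  set s := (1 + w) / (1 - w)
  have key : ¬ ((-s ^ 2).im = 0 ∧ 0 ≤ (-s ^ 2).re) := by
    rintro ⟨h1, h2⟩
    simp only [Complex.neg_im, Complex.neg_re, pow_two, Complex.mul_im, Complex.mul_re] at h1 h2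
    have h3 : s.im = 0 := by
      have : s.re * s.im = 0 := by linarith
      exact (mul_eq_zero.1 this).resolve_left hre.ne'
    rw [h3] at h2
    nlinarith
  refine ⟨?_, fun h => key ⟨h.1, h.2.le⟩⟩
  rintro (h | h) <;> rw [h] at key <;> exact key (by simp)

/-- On the unit circle `(1 + w) / (1 - w)` is imaginary, so that `r ^ 4` is in `[0, ∞]`. -/
theorem cellDim_face_sphere (g : Fin 4 × Fin 3) {w : ℂ} (hw : ‖w‖ = 1) :
    cellDim (face g w) < 2 := by
  by_cases hw1 : w = 1
  · rw [hw1, face_one, show cellDim OnePoint.infty = 0 from cellDim_vertex none]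
    norm_num
  refine lt_of_le_of_ne (cellDim_le_two _) fun h => ?_
  rw [cellDim_eq_two, face_snd_pow_four g hw1] at h
  have hre := re_cayley hw1
  rw [hw, one_pow, sub_self] at hre
  have hre : ((1 + w) / (1 - w)).re = 0 := (mul_eq_zero.1 hre).resolve_right (by
    rw [Complex.normSq_eq_zero]
    exact sub_ne_zero.2 (Ne.symm hw1))
  set s := (1 + w) / (1 - w)
  have hs : -s ^ 2 = ((s.im ^ 2 : ℝ) : ℂ) := by
    apply Complex.ext <;> simp [pow_two, hre]
  rw [hs] at h
  rcases (sq_nonneg s.im).eq_or_lt with h0 | h0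
  · exact h.1 (Or.inl (by rw [← h0]; simp))
  · exact h.2 ⟨Complex.ofReal_im _, by rwa [Complex.ofReal_re]⟩

theorem face_injective {g g' : Fin 4 × Fin 3} {w w' : ℂ} (hw : w ∈ Metric.ball (0 : ℂ) 1)
    (hw' : w' ∈ Metric.ball (0 : ℂ) 1) (h : face g w = face g' w') : g = g' ∧ w = w' := by
  have hw1 : w ≠ 1 := by rintro rfl; simp at hw
  have hw1' : w' ≠ 1 := by rintro rfl; simp at hw'
  have h4 := face_snd_pow_four g hw1
  rw [h, face_snd_pow_four g' hw1', neg_inj, sq_eq_sq_iff_eq_or_eq_neg] at h4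
  have hre := re_cayley_pos hw
  have hre' := re_cayley_pos hw'
  have hww : w = w' := by
    rcases h4 with h4 | h4
    · rw [div_eq_div_iff (sub_ne_zero.2 hw1'.symm) (sub_ne_zero.2 hw1.symm)] at h4
      linear_combination -h4 / 2
    · rw [h4, Complex.neg_re] at hre'
      linarith
  subst hww
  refine ⟨?_, rfl⟩
  have h2 := congrArg aff h
  rw [aff_face g hw1, aff_face g' hw1] at h2
  have h3 := cellDim_eq_two.1 (cellDim_face g hw)
  rw [aff_face g hw1, act_snd_pow_four] at h3
  exact act_left_injective (faceBase_mem hw1) (fun h => h3.1 (Or.inl (by rw [h]; simp)))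
    (fun h => h3.1 (Or.inr h)) h2

theorem exists_face_eq {m : TrigonalModel} (h : cellDim m = 2) :
    ∃ g, ∃ w ∈ Metric.ball (0 : ℂ) 1, face g w = m := by
  rw [cellDim_eq_two] at h
  obtain ⟨h1, h2⟩ := h
  have hm : m ≠ OnePoint.infty := by
    rintro rfl
    exact h1 (Or.inl (by simp [aff]))
  obtain ⟨s, hs, hre⟩ : ∃ s : ℂ, s ^ 2 = -(aff m).2 ^ 4 ∧ 0 < s.re := by
    obtain ⟨s, hs⟩ := IsAlgClosed.exists_pow_nat_eq (-(aff m).2 ^ 4) (n := 2) (by norm_num)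
    rcases lt_trichotomy s.re 0 with h | h | h
    · exact ⟨-s, by rw [neg_sq, hs], by rw [Complex.neg_re]; linarith⟩
    · have h3 : (aff m).2 ^ 4 = ((s.im ^ 2 : ℝ) : ℂ) := by
        rw [← neg_inj, ← hs]
        apply Complex.ext <;> simp [pow_two, h]
      rw [h3] at h1 h2
      rcases (sq_nonneg s.im).eq_or_lt with h0 | h0
      · exact absurd (Or.inl (by rw [← h0]; simp)) h1
      · exact absurd ⟨Complex.ofReal_im _, by rwa [Complex.ofReal_re]⟩ h2
    · exact ⟨s, hs, h⟩
  have hs1 : s + 1 ≠ 0 := by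
    intro h
    have := congrArg Complex.re h
    simp at this
    linarith
  have hw : (s - 1) / (s + 1) ∈ Metric.ball (0 : ℂ) 1 := by
    rw [mem_ball_zero_iff, norm_div, div_lt_one (norm_pos_iff.2 hs1)]
    refine lt_of_pow_lt_pow_left₀ 2 (norm_nonneg _) ?_
    rw [← Complex.normSq_eq_norm_sq, ← Complex.normSq_eq_norm_sq, Complex.normSq_apply,
      Complex.normSq_apply]
    simp only [Complex.sub_re, Complex.one_re, Complex.sub_im, Complex.one_im, Complex.add_re,
      Complex.add_im]
    nlinarith
  have hw1 : (s - 1) / (s + 1) ≠ 1 := by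
    intro h
    rw [h] at hw
    simp at hw
  have hcay : (1 + (s - 1) / (s + 1)) / (1 - (s - 1) / (s + 1)) = s := by
    have : 1 - (s - 1) / (s + 1) ≠ 0 := sub_ne_zero.2 hw1.symm
    rw [div_eq_iff this]
    field_simp
    ring
  have h4 : (faceBase ((s - 1) / (s + 1))).2 ^ 4 = (aff m).2 ^ 4 := by
    rw [faceBase_snd_pow_four, hcay, hs, neg_neg]
  obtain ⟨g, hg⟩ := exists_act_eq (faceBase_mem hw1) (aff_mem hm)
    (fun h => h1 (Or.inl (by rw [← h4, h]; simp))) (fun h => h1 (Or.inr (by rw [← h4, h]))) h4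
  exact ⟨g, _, hw, by rw [face_of_ne g hw1, hg, mk_aff hm]⟩

end TrigonalModel

namespace TrigonalModel

/-- The index types of the cells in each dimension: `6` vertices, `24` edges and `12` faces. -/
def Cell : ℕ → Type
  | 0 => Option (Option (Fin 4))
  | 1 => Bool × Fin 4 × Fin 3
  | 2 => Fin 4 × Fin 3
  | _ => Empty

instance (n : ℕ) : Finite (Cell n) :=
  match n with
  | 0 => inferInstanceAs (Finite (Option (Option (Fin 4))))
  | 1 => inferInstanceAs (Finite (Bool × Fin 4 × Fin 3))
  | 2 => inferInstanceAs (Finite (Fin 4 × Fin 3))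
  | _ + 3 => inferInstanceAs (Finite Empty)

/-- The characteristic maps of the cells. -/
def cellMap : ∀ n, Cell n → (Fin n → ℝ) → TrigonalModel
  | 0, i, _ => vertex i
  | 1, i, v => edge i ((1 + v 0) / 2)
  | 2, i, v => face i (exists_homeomorph_complex.choose v)
  | _ + 3, i, _ => Empty.elim i

theorem mem_ball_fin_one {v : Fin 1 → ℝ} : v ∈ Metric.ball 0 1 ↔ (1 + v 0) / 2 ∈ Ioo (0 : ℝ) 1 := by
  rw [mem_ball_zero_iff, pi_norm_lt_iff one_pos, Fin.forall_fin_one, Real.norm_eq_abs, abs_lt]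
  constructor <;> rintro ⟨h1, h2⟩ <;> constructor <;> linarith

theorem mem_closedBall_fin_one {v : Fin 1 → ℝ} :
    v ∈ Metric.closedBall 0 1 ↔ (1 + v 0) / 2 ∈ Icc (0 : ℝ) 1 := by
  rw [mem_closedBall_zero_iff, pi_norm_le_iff_of_nonneg zero_le_one, Fin.forall_fin_one,
    Real.norm_eq_abs, abs_le]
  constructor <;> rintro ⟨h1, h2⟩ <;> constructor <;> linarith

theorem continuousOn_cellMap (n : ℕ) (i : Cell n) :
    ContinuousOn (cellMap n i) (Metric.closedBall 0 1) := by
  match n with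
  | 0 => exact continuousOn_const
  | 1 =>
    exact (continuousOn_edge i).comp (by fun_prop) fun v hv => mem_closedBall_fin_one.1 hv
  | 2 =>
    exact (continuousOn_face i).comp (Homeomorph.continuous _).continuousOn
      fun v hv => (exists_homeomorph_complex.choose_spec.2 v).1 hv
  | _ + 3 => exact Empty.elim i

theorem cellMap_injective (n : ℕ) (i j : Cell n) : ∀ v ∈ Metric.ball 0 1, ∀ w ∈ Metric.ball 0 1,
    cellMap n i v = cellMap n j w → i = j ∧ v = w := by
  intro v hv w hw h
  match n with
  | 0 => exact ⟨vertex_injective h, Subsingleton.elim _ _⟩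
  | 1 =>
    obtain ⟨h1, h2⟩ := edge_injective (mem_ball_fin_one.1 hv) (mem_ball_fin_one.1 hw) h
    refine ⟨h1, funext fun k => ?_⟩
    rw [Subsingleton.elim k 0]
    linarith
  | 2 =>
    obtain ⟨h1, h2⟩ := face_injective ((exists_homeomorph_complex.choose_spec.1 v).1 hv)
      ((exists_homeomorph_complex.choose_spec.1 w).1 hw) h
    exact ⟨h1, Homeomorph.injective _ h2⟩
  | _ + 3 => exact Empty.elim i

theorem cellDim_cellMap (n : ℕ) (i : Cell n) : ∀ v ∈ Metric.ball 0 1,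
    cellDim (cellMap n i v) = n := by
  intro v hv
  match n with
  | 0 => exact cellDim_vertex i
  | 1 => exact cellDim_edge i (mem_ball_fin_one.1 hv)
  | 2 => exact cellDim_face i ((exists_homeomorph_complex.choose_spec.1 v).1 hv)
  | _ + 3 => exact Empty.elim i

theorem cellDim_cellMap_sphere (n : ℕ) (i : Cell n) : ∀ v ∈ Metric.sphere 0 1,
    cellDim (cellMap n i v) < n := by
  intro v hv
  have hcb := Metric.sphere_subset_closedBall hv
  have hb : v ∉ Metric.ball 0 1 := fun h => by
    rw [Metric.mem_ball, Metric.mem_sphere.1 hv] at h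
    exact lt_irrefl _ h
  match n with
  | 0 =>
    rw [mem_sphere_zero_iff_norm, Subsingleton.elim v 0, norm_zero] at hv
    exact absurd hv zero_ne_one
  | 1 =>
    rw [mem_ball_fin_one] at hb
    rw [mem_closedBall_fin_one] at hcb
    refine Nat.lt_one_iff.2 ?_
    change cellDim (edge i _) = 0
    rcases hcb.1.eq_or_lt with h | h
    · rw [← h]
      exact cellDim_edge_zero i
    · rw [hcb.2.antisymm (not_lt.1 fun h' => hb ⟨h, h'⟩)]
      exact cellDim_edge_one i
  | 2 =>
    rw [(exists_homeomorph_complex.choose_spec.1 v), mem_ball_zero_iff, not_lt] at hb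
    rw [(exists_homeomorph_complex.choose_spec.2 v), mem_closedBall_zero_iff] at hcb
    exact cellDim_face_sphere i (hcb.antisymm hb)
  | _ + 3 => exact Empty.elim i

theorem exists_cellMap_eq (m : TrigonalModel) :
    ∃ i, ∃ v ∈ Metric.ball 0 1, cellMap (cellDim m) i v = m := by
  have key : ∀ n, cellDim m = n → ∃ i, ∃ v ∈ Metric.ball 0 1, cellMap n i v = m := by
    intro n hn
    match n with
    | 0 =>
      obtain ⟨i, hi⟩ := exists_vertex_eq hn
      exact ⟨i, 0, by simp, hi⟩
    | 1 =>
      obtain ⟨i, t, ht, h⟩ := exists_edge_eq hn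
      have h2 : (1 + (2 * t - 1)) / 2 = t := by ring
      refine ⟨i, fun _ => 2 * t - 1, mem_ball_fin_one.2 ?_, ?_⟩
      · rwa [h2]
      · change edge i ((1 + (2 * t - 1)) / 2) = m
        rw [h2, h]
    | 2 =>
      obtain ⟨i, w, hw, h⟩ := exists_face_eq hn
      refine ⟨i, exists_homeomorph_complex.choose.symm w, ?_, ?_⟩
      · rw [exists_homeomorph_complex.choose_spec.1, Homeomorph.apply_symm_apply]
        exact hw
      · change face i _ = m
        rw [Homeomorph.apply_symm_apply, h]
    | n + 3 =>
      have := cellDim_le_two m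
      omega
  exact key _ rfl

/-- A space homeomorphic to the model has Euler characteristic `6 - 24 + 12`. -/
theorem hasEulerCharacteristic_of_homeomorph {S : Type} [TopologicalSpace S]
    (Ψ : S ≃ₜ TrigonalModel) : HasEulerCharacteristic S (-6) := by
  have : T2Space S := Ψ.symm.t2Space
  have h := hasEulerCharacteristic_of_cells (X := S) Cell 3
    (fun n hn => by
      obtain ⟨k, rfl⟩ := Nat.exists_eq_add_of_le' hn
      exact inferInstanceAs (IsEmpty Empty))
    (fun n i v => Ψ.symm (cellMap n i v)) (fun s => cellDim (Ψ s))
    (fun n i => Ψ.symm.continuous.comp_continuousOn (continuousOn_cellMap n i))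
    (fun n i j v hv w hw h => cellMap_injective n i j v hv w hw (Ψ.symm.injective h))
    (fun n i v hv => by rw [Ψ.apply_symm_apply, cellDim_cellMap n i v hv])
    (fun n i v hv => by rw [Ψ.apply_symm_apply]; exact cellDim_cellMap_sphere n i v hv)
    (fun s => by
      obtain ⟨i, v, hv, h⟩ := exists_cellMap_eq (Ψ s)
      exact ⟨i, v, hv, by rw [h, Ψ.symm_apply_apply]⟩)
  have h0 : Nat.card (Cell 0) = 6 := by
    change Nat.card (Option (Option (Fin 4))) = 6
    simp
  have h1 : Nat.card (Cell 1) = 24 := by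
    change Nat.card (Bool × Fin 4 × Fin 3) = 24
    simp
  have h2 : Nat.card (Cell 2) = 12 := by
    change Nat.card (Fin 4 × Fin 3) = 12
    simp
  simpa [Finset.sum_range_succ, h0, h1, h2] using h

instance : ConnectedSpace TrigonalModel := by
  -- Every closed face contains the origin and the point at infinity, and every closed edge contains
  -- one of them, so all points are joined to the origin by the face with index `0`.
  have hface : ∀ g, IsPreconnected (face g '' Metric.closedBall 0 1) := fun g =>
    (convex_closedBall (0 : ℂ) 1).isPreconnected.image _ (continuousOn_face g)
  have hedge : ∀ i, IsPreconnected (edge i '' Icc 0 1) := fun i =>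
    isPreconnected_Icc.image _ (continuousOn_edge i)
  have h0 : ∀ g, (origin : TrigonalModel) ∈ face g '' Metric.closedBall 0 1 := fun g =>
    ⟨-1, by simp, face_neg_one g⟩
  have h1 : ∀ g, OnePoint.infty ∈ face g '' Metric.closedBall 0 1 := fun g =>
    ⟨1, by simp, face_one g⟩
  have h2 : ∀ i, (edge i '' Icc 0 1 ∩ face 0 '' Metric.closedBall 0 1).Nonempty := by
    intro i
    refine ⟨edge i 0, ⟨0, by simp, rfl⟩, ?_⟩
    rw [edge_zero]
    split_ifs
    · exact h1 0
    · exact h0 0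
  have h3 : ∀ i t, t ∈ Icc (0 : ℝ) 1 → ∃ T : Set TrigonalModel, (origin : TrigonalModel) ∈ T ∧
      edge i t ∈ T ∧ IsPreconnected T := fun i t ht =>
    ⟨edge i '' Icc 0 1 ∪ face 0 '' Metric.closedBall 0 1, Or.inr (h0 0), Or.inl ⟨t, ht, rfl⟩,
      (hedge i).union' (h2 i) (hface 0)⟩
  have hpre : IsPreconnected (univ : Set TrigonalModel) := by
    refine isPreconnected_of_forall (origin : TrigonalModel) fun m _ => ?_
    suffices h : ∃ T : Set TrigonalModel, (origin : TrigonalModel) ∈ T ∧ m ∈ T ∧ IsPreconnected T by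
      obtain ⟨T, hT⟩ := h
      exact ⟨T, subset_univ T, hT⟩
    have hd := cellDim_le_two m
    obtain hd | hd | hd : cellDim m = 0 ∨ cellDim m = 1 ∨ cellDim m = 2 := by omega
    · obtain ⟨i, rfl⟩ := exists_vertex_eq hd
      rcases i with _ | _ | k
      · exact ⟨_, h0 0, h1 0, hface 0⟩
      · exact ⟨_, h0 0, h0 0, hface 0⟩
      · have h4 : edge (false, k, 0) 1 = vertex (some (some k)) := by
          change mk _ = mk _
          simp [act, edgeBase]
        rw [← h4]
        exact h3 _ 1 (by simp)
    · obtain ⟨i, t, ht, rfl⟩ := exists_edge_eq hd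
      exact h3 i t (Ioo_subset_Icc_self ht)
    · obtain ⟨g, w, hw, rfl⟩ := exists_face_eq hd
      exact ⟨_, h0 g, ⟨w, Metric.ball_subset_closedBall hw, rfl⟩, hface g⟩
  exact { isPreconnected_univ := hpre, toNonempty := ⟨OnePoint.infty⟩ }

end TrigonalModel

/-! ### The surface of the curve -/

theorem mainTheorem8 (p₀ : ℂ) (p : Fin 3 → ℂ) (Γ : SlitSystem p₀ p) :
    CompactSpace (S147 Γ) ∧ T2Space (S147 Γ) ∧ ConnectedSpace (S147 Γ) ∧
    HasGenus (S147 Γ) 4 ∧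
    ∃ (_ : ChartedSpace ℂ (S147 Γ)) (_ : IsManifold 𝓘(ℂ) ω (S147 Γ)),
      IsHolomorphicToSphere (S147.x Γ) ∧
      ∃ y : S147 Γ → OnePoint ℂ,
        IsRiemannSurfaceOfCurve
          {q : ℂ × ℂ | q.2 ^ 12 = (q.1 - p 0) ^ 1 * (q.1 - p 1) ^ 4 * (q.1 - p 2) ^ 7}
          (S147.x Γ) y := by
  obtain ⟨Ψ, hΨ⟩ := Γ.exists_homeomorph_model
  have hp := Γ.injective_endpoints
  have hx : S147.x Γ = fun s => TrigonalModel.xMap p (Ψ s) := funext fun s => (hΨ s).symm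
  refine ⟨Ψ.symm.compactSpace, Ψ.symm.t2Space, ?_, ?_, ?_⟩
  · exact Ψ.symm.surjective.connectedSpace Ψ.symm.continuous
  · have h := TrigonalModel.hasEulerCharacteristic_of_homeomorph Ψ
    unfold HasGenus
    norm_num
    exact h
  obtain ⟨hC, hM, hhol⟩ := exists_chartedSpace_isHolomorphicToSphere Ψ
  have hxh : IsHolomorphicToSphere (S147.x Γ) := by
    rw [hx]
    exact hhol _ (TrigonalModel.isLocallyRatio_xMap hp)
  refine ⟨hC, hM, hxh, fun s => TrigonalModel.yMap p (Ψ s), hxh,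
    hhol _ (TrigonalModel.isLocallyRatio_yMap hp), ?_, ?_, ?_, ?_⟩
  · rw [hx]
    exact (TrigonalModel.finite_poles (p := p)).preimage Ψ.injective.injOn
  · intro s a b ha hb
    rw [hx] at ha
    exact TrigonalModel.equation hp ha hb
  · intro a b hab
    obtain ⟨m, hm1, hm2⟩ := TrigonalModel.exists_of_equation hp hab
    exact ⟨Ψ.symm m, by simpa [hx] using hm1, by simpa using hm2⟩
  · rw [hx]
    refine ((TrigonalModel.finite_multiple hp).preimage Ψ.injective.injOn).subset ?_
    rintro s ⟨s', hne, h1, h2⟩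
    exact ⟨Ψ s', Ψ.injective.ne hne, h1, h2⟩

end
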